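/- Let $M$ be a compact connected complex manifold of dimension $n\ge 2$ and let $\omega_g=\sqrt{-1}\,g_{i\bar j}\,dz^i\wedge d\bar z^j$ be a smooth Hermitian metric on $M$. The Chern scalar curvature of $\omega_g$ is $s_g=g^{i\bar j}g^{k\bar l}\Theta_{i\bar jk\bar l}$, where $\Theta_{i\bar jk\bar l}=-\frac{\partial^2 g_{k\bar l}}{\partial z^i\partial\bar z^j}+g^{p\bar q}\frac{\partial g_{k\bar q}}{\partial z^i}\frac{\partial g_{p\bar l}}{\partial\bar z^j}$ is the curvature of the Chern connection. For real $p>1$ put $$C_p(\omega_g)=\Big(\int_M|s_g|^p\,\frac{\omega_g^n}{n!}\Big)\Big(\int_M\frac{\omega_g^n}{n!}\Big)^{-\frac{n-p}{n}},$$ and call $\omega_g$ *$p$-conformal extremal* if it is a critical point of $C_p$ within its conformal class, that is, $\frac{d}{dt}\big|_{t=0}C_p(e^{tf}\omega_g)=0$ for every $f\in C^\infty(M,\mathbb R)$. Call $\omega_g$ *Gauduchon* if $\partial\bar\partial\,\omega_g^{n-1}=0$. Let $\omega_E=e^{f}\omega_g$, with $f\in C^\infty(M,\mathbb R)$, be an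 $n$-conformal extremal metric in the conformal class of $\omega_g$. Then: 1. If $\omega_E$ is Gauduchon, then its Chern scalar curvature is constant. 2. If $\omega_E$ has constant nonzero Chern scalar curvature, then $\omega_E$ is Gauduchon. -/

import Mathlib

open scoped Manifold ContDiff
open MeasureTheory

noncomputable section

namespace ConformalExtremal

/-! ### Calculus on `ℂⁿ`: Wirtinger derivatives and complex-valued differential forms -/

/-- `∂F/∂zⁱ = ½ (∂F/∂xⁱ - √-1 ∂F/∂yⁱ)`, where `zⁱ = xⁱ + √-1 yⁱ`. -/
def dWirt {n : ℕ} (i : Fin n) (F : (Fin n → ℂ) → ℂ) (z : Fin n → ℂ) : ℂ :=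
  (1 / 2 : ℂ) * (fderiv ℝ F z (Pi.single i 1) - Complex.I * fderiv ℝ F z (Pi.single i Complex.I))

/-- `∂F/∂z̄ⁱ = ½ (∂F/∂xⁱ + √-1 ∂F/∂yⁱ)`. -/
def dbarWirt {n : ℕ} (i : Fin n) (F : (Fin n → ℂ) → ℂ) (z : Fin n → ℂ) : ℂ :=
  (1 / 2 : ℂ) * (fderiv ℝ F z (Pi.single i 1) + Complex.I * fderiv ℝ F z (Pi.single i Complex.I))

/-- The algebra of complex covectors of all degrees at a point of `ℂⁿ`: the exterior algebra on
the space with basis `dz¹, …, dzⁿ, dz̄¹, …, dz̄ⁿ`. Its multiplication is the wedge product. A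
differential form on (an open subset of) `ℂⁿ` is a function with values in it. -/
abbrev Covec (n : ℕ) : Type := ExteriorAlgebra ℂ (Fin n ⊕ₗ Fin n → ℂ)

/-- The covector `dzⁱ`. -/
def dz {n : ℕ} (i : Fin n) : Covec n :=
  ExteriorAlgebra.ι ℂ (Pi.single (Sum.inlₗ i) 1 : Fin n ⊕ₗ Fin n → ℂ)

/-- The covector `dz̄ⁱ`. -/
def dzbar {n : ℕ} (i : Fin n) : Covec n :=
  ExteriorAlgebra.ι ℂ (Pi.single (Sum.inrₗ i) 1 : Fin n ⊕ₗ Fin n → ℂ)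

/-- The basis of the covector algebra which consists of the ordered wedge products of the `dzⁱ`
and `dz̄ⁱ`. -/
def covecBasis (n : ℕ) : Module.Basis (Finset (Fin n ⊕ₗ Fin n)) ℂ (Covec n) :=
  (Pi.basisFun ℂ (Fin n ⊕ₗ Fin n)).ExteriorAlgebra

/-- `∂α = ∑ᵢ dzⁱ ∧ ∂α/∂zⁱ`, where `∂α/∂zⁱ` is taken coefficientwise. -/
def delForm {n : ℕ} (α : (Fin n → ℂ) → Covec n) (z : Fin n → ℂ) : Covec n :=
  ∑ i, dz i * ∑ S, dWirt i (fun w => (covecBasis n).repr (α w) S) z • covecBasis n S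

/-- `∂̄α = ∑ᵢ dz̄ⁱ ∧ ∂α/∂z̄ⁱ`, where `∂α/∂z̄ⁱ` is taken coefficientwise. -/
def delbarForm {n : ℕ} (α : (Fin n → ℂ) → Covec n) (z : Fin n → ℂ) : Covec n :=
  ∑ i, dzbar i * ∑ S, dbarWirt i (fun w => (covecBasis n).repr (α w) S) z • covecBasis n S

/-! ### Hermitian metrics on complex manifolds -/

section Manifold

variable {n : ℕ} {M : Type*} [TopologicalSpace M] [ChartedSpace (Fin n → ℂ) M]

/-- The coordinate vector `∂/∂zⁱ` of the chart `e` at the point with coordinates `z`. -/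
def coordVec (e : OpenPartialHomeomorph M (Fin n → ℂ)) (z : Fin n → ℂ) (i : Fin n) :
    TangentSpace 𝓘(ℂ, Fin n → ℂ) (e.symm z) :=
  mfderiv 𝓘(ℂ, Fin n → ℂ) 𝓘(ℂ, Fin n → ℂ) e.symm z (Pi.single i 1 : Fin n → ℂ)

/-- The matrix `g_{i j̄}(z) = h(∂/∂zⁱ, ∂/∂zʲ)`, in the chart `e`, of a family `h` of sesquilinear
forms on the holomorphic tangent spaces (linear in the first, conjugate linear in the second
argument). -/
def coeffMatrix
    (h : ∀ x : M, TangentSpace 𝓘(ℂ, Fin n → ℂ) x →ₗ[ℂ] TangentSpace 𝓘(ℂ, Fin n → ℂ) x →ₗ⋆[ℂ] ℂ)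
    (e : OpenPartialHomeomorph M (Fin n → ℂ)) (z : Fin n → ℂ) : Matrix (Fin n) (Fin n) ℂ :=
  Matrix.of fun i j => h (e.symm z) (coordVec e z i) (coordVec e z j)

variable (n M) in
/-- A smooth Hermitian metric on a complex manifold `M` of dimension `n`. -/
structure HermitianMetric where
  /-- The Hermitian inner product on each holomorphic tangent space. -/
  form : ∀ x : M,
    TangentSpace 𝓘(ℂ, Fin n → ℂ) x →ₗ[ℂ] TangentSpace 𝓘(ℂ, Fin n → ℂ) x →ₗ⋆[ℂ] ℂ
  conj_symm : ∀ (x : M) (v w : TangentSpace 𝓘(ℂ, Fin n → ℂ) x),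
    form x v w = starRingEnd ℂ (form x w v)
  pos : ∀ (x : M) (v : TangentSpace 𝓘(ℂ, Fin n → ℂ) x), v ≠ 0 → 0 < (form x v v).re
  smooth : ∀ e ∈ atlas (Fin n → ℂ) M, ∀ i j : Fin n,
    ContDiffOn ℝ ∞ (fun z => coeffMatrix form e z i j) e.target

/-- A complex manifold is in particular a smooth real manifold. -/
theorem isManifold_real [IsManifold 𝓘(ℂ, Fin n → ℂ) ω M] :
    IsManifold 𝓘(ℝ, Fin n → ℂ) ∞ M := by
  apply isManifold_of_contDiffOn
  intro e e' he he'
  have h := (contDiffGroupoid ω 𝓘(ℂ, Fin n → ℂ)).compatible he he'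
  rw [contDiffGroupoid, mem_groupoid_of_pregroupoid] at h
  have h1 : ContDiffOn ℂ ω (e.symm ≫ₕ e') (e.symm ≫ₕ e').source := by
    simpa [contDiffPregroupoid] using h.1
  have h2 := (h1.restrict_scalars ℝ).of_le (m := ∞) le_top
  simpa using h2

theorem contDiffOn_chart [IsManifold 𝓘(ℂ, Fin n → ℂ) ω M]
    (f : C^∞⟮𝓘(ℝ, Fin n → ℂ), M; ℝ⟯) {e : OpenPartialHomeomorph M (Fin n → ℂ)}
    (he : e ∈ atlas (Fin n → ℂ) M) : ContDiffOn ℝ ∞ (fun z => f (e.symm z)) e.target := by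
  have : IsManifold 𝓘(ℝ, Fin n → ℂ) ∞ M := isManifold_real
  rw [← contMDiffOn_iff_contDiffOn]
  have h1 := contMDiffOn_symm_of_mem_maximalAtlas (I := 𝓘(ℝ, Fin n → ℂ)) (n := ∞)
    (IsManifold.subset_maximalAtlas he)
  exact f.contMDiff.comp_contMDiffOn h1

namespace HermitianMetric

/-- The metric `e^f ω_g`, for a smooth real function `f` on `M`. -/
def conformal [IsManifold 𝓘(ℂ, Fin n → ℂ) ω M] (g : HermitianMetric n M)
    (f : C^∞⟮𝓘(ℝ, Fin n → ℂ), M; ℝ⟯) : HermitianMetric n M where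
  form x := ((Real.exp (f x) : ℝ) : ℂ) • g.form x
  conj_symm x v w := by
    simp only [LinearMap.smul_apply, smul_eq_mul, map_mul, Complex.conj_ofReal]
    rw [← g.conj_symm x v w]
  pos x v hv := by
    simp only [LinearMap.smul_apply, smul_eq_mul, Complex.re_ofReal_mul]
    exact mul_pos (Real.exp_pos _) (g.pos x v hv)
  smooth e he i j := by
    have h1 : ContDiffOn ℝ ∞ (fun z => ((Real.exp (f (e.symm z)) : ℝ) : ℂ)) e.target :=
      Complex.ofRealCLM.contDiff.comp_contDiffOn (contDiffOn_chart f he).exp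
    exact h1.mul (g.smooth e he i j)

/-- The matrix `(g_{i j̄})` of the metric in the chart `e`, as a function of the coordinates. -/
def coeff (g : HermitianMetric n M) (e : OpenPartialHomeomorph M (Fin n → ℂ)) (z : Fin n → ℂ) :
    Matrix (Fin n) (Fin n) ℂ :=
  coeffMatrix g.form e z

/-- The inverse matrix `g^{i j̄}`, normalized by `∑_j g^{i j̄} g_{k j̄} = δ_{ik}`. -/
def invCoeff (g : HermitianMetric n M) (e : OpenPartialHomeomorph M (Fin n → ℂ)) (z : Fin n → ℂ)
    (i j : Fin n) : ℂ :=
  (g.coeff e z)⁻¹ j i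

/-- The fundamental form `ω_g = √-1 ∑ g_{i j̄} dzⁱ ∧ dz̄ʲ` in the chart `e`. -/
def fundForm (g : HermitianMetric n M) (e : OpenPartialHomeomorph M (Fin n → ℂ))
    (z : Fin n → ℂ) : Covec n :=
  Complex.I • ∑ i, ∑ j, g.coeff e z i j • (dz i * dzbar j)

/-- `ω_g` is a Gauduchon metric: `∂∂̄ (ω_g^{n-1}) = 0` (in every chart). -/
def IsGauduchon (g : HermitianMetric n M) : Prop :=
  ∀ e ∈ atlas (Fin n → ℂ) M, ∀ z ∈ e.target,
    delForm (delbarForm fun w => g.fundForm e w ^ (n - 1)) z = 0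

/-- The components of the curvature of the Chern connection in the chart `e`:
`Θ_{i j̄ k l̄} = - ∂²g_{k l̄}/∂zⁱ∂z̄ʲ + ∑ g^{p q̄} (∂g_{k q̄}/∂zⁱ) (∂g_{p l̄}/∂z̄ʲ)`. -/
def chernCurv (g : HermitianMetric n M) (e : OpenPartialHomeomorph M (Fin n → ℂ))
    (z : Fin n → ℂ) (i j k l : Fin n) : ℂ :=
  -dWirt i (dbarWirt j fun w => g.coeff e w k l) z +
    ∑ p, ∑ q, g.invCoeff e z p q *
      dWirt i (fun w => g.coeff e w k q) z * dbarWirt j (fun w => g.coeff e w p l) z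

/-- The Chern scalar curvature `s_g = ∑ g^{i j̄} g^{k l̄} Θ_{i j̄ k l̄}`. The sum is a real number
and does not depend on the holomorphic chart; it is computed in the preferred chart at `x`. -/
def chernScalar (g : HermitianMetric n M) (x : M) : ℝ :=
  (∑ i, ∑ j, ∑ k, ∑ l,
    g.invCoeff (chartAt (Fin n → ℂ) x) (chartAt (Fin n → ℂ) x x) i j *
    g.invCoeff (chartAt (Fin n → ℂ) x) (chartAt (Fin n → ℂ) x x) k l *
    g.chernCurv (chartAt (Fin n → ℂ) x) (chartAt (Fin n → ℂ) x x) i j k l).re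

/-- The measure which the volume form `ω_g^n / n!` induces on the domain of the chart `e`. There
`ω_g^n / n! = det (g_{i j̄}) ∏ (√-1 dzⁱ ∧ dz̄ⁱ) = 2ⁿ det (g_{i j̄}) dx¹ dy¹ ⋯ dxⁿ dyⁿ`. -/
def chartVolume [MeasurableSpace M] (g : HermitianMetric n M)
    (e : OpenPartialHomeomorph M (Fin n → ℂ)) : Measure M :=
  Measure.map e.symm (((volume : Measure (Fin n → ℂ)).restrict e.target).withDensity
    fun z => ENNReal.ofReal (2 ^ n * (g.coeff e z).det.re))

/-- The measure on `M` given by the volume form `ω_g^n / n!`. The measures `chartVolume g e` agree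
on the overlaps of the chart domains, so their least upper bound is the measure on `M` that
restricts to `chartVolume g e` on the domain of each chart `e`. -/
def volumeMeasure [MeasurableSpace M] (g : HermitianMetric n M) : Measure M :=
  ⨆ e ∈ atlas (Fin n → ℂ) M, g.chartVolume e

/-- The `p`-Calabi functional
`C_p(ω_g) = (∫ |s_g|^p ω_g^n/n!) (∫ ω_g^n/n!)^{-(n-p)/n}`. -/
def calabi [MeasurableSpace M] (p : ℝ) (g : HermitianMetric n M) : ℝ :=
  (∫ x, |g.chernScalar x| ^ p ∂g.volumeMeasure) *
    (g.volumeMeasure.real Set.univ) ^ (-((n - p) / n) : ℝ)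

/-- `ω_g` is `p`-conformal extremal: it is a critical point of `C_p` in its conformal class, that
is, `d/dt C_p(e^{tf} ω_g) = 0` at `t = 0` for all smooth real functions `f`. -/
def IsConformalExtremal [MeasurableSpace M] [IsManifold 𝓘(ℂ, Fin n → ℂ) ω M] (p : ℝ)
    (g : HermitianMetric n M) : Prop :=
  ∀ f : C^∞⟮𝓘(ℝ, Fin n → ℂ), M; ℝ⟯,
    HasDerivAt (fun t : ℝ => (g.conformal (t • f)).calabi p) 0 0

end HermitianMetric

end Manifold

end ConformalExtremal

end

/-!
For `p = n` the power of the volume in the Calabi functional is trivial. A conformal change gives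
`s̃ = e^{-f} (s - n Δf)` and `dṼ = e^{nf} dV`, where `Δ = ∑ g^{i j̄} ∂²/∂zⁱ∂z̄ʲ`, so that
`C_n(e^{tf} ω) = ∫ |s - n t Δf|^n dV` (`HermitianMetric.calabi_conformal_smul`). Differentiation under
the integral turns extremality into the weak equation `∫ |s|^{n-2} s Δf dV = 0` for all smooth `f`
(`HermitianMetric.IsConformalExtremal.integral_eq_zero`).

The metric is Gauduchon if and only if `∫ Δu dV = 0` for all `u`. Indeed
`dzⁱ ∧ dz̄ʲ ∧ ω^{n-1}` is a constant multiple of the cofactor `det G · G^{i j̄}` times the top covector,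
so `∂∂̄ ω^{n-1}` is, up to a constant, `∑ ∂²(det G · G^{i j̄})/∂zⁱ∂z̄ʲ`
(`delForm_delbarForm_fundForm_pow`), and two integrations by parts in a chart identify this function
with the density of `u ↦ ∫ Δu dV` (`HermitianMetric.integral_lap_of_tsupport_subset`). A partition of
unity gives one direction (`HermitianMetric.integral_lap_eq_zero`), the fundamental lemma of the calculus
of variations the other (`HermitianMetric.gauduchonCoeff_eq_zero`).

If `s` is a nonzero constant, extremality says `∫ Δf dV = 0` for all smooth `f`, so the metric is
Gauduchon. If the metric is Gauduchon, no elliptic theory is needed: take `f = s` in the weak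
equation, and compare with `0 = ∫ Δ(|s|^n) dV = ∫ n |s|^{n-2} s Δs dV + n (n-1) ∫ |s|^{n-2} |∂s|² dV`.
Hence `|s|^{n-2} |∂s|² = 0`, so `d(s³) = 0` and `s` is constant
(`HermitianMetric.exists_eq_const_of_integral_eq_zero`).

That `s` and `Δf` are independent of the chart, hence smooth resp. continuous, follows from the
tensoriality of the curvature under `G = J (G' ∘ φ) Jᴴ` with `J` the holomorphic Jacobian matrix of the
transition map `φ` (`localScalar_eq_of_change`, `localLap_eq_of_change`).
-/

noncomputable section

namespace ConformalExtremal

open Filter Topology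

/-! ### Wirtinger calculus -/

section Wirtinger

variable {n : ℕ} {F H : (Fin n → ℂ) → ℂ} {z : Fin n → ℂ}

theorem dWirt_congr (h : F =ᶠ[𝓝 z] H) (i : Fin n) : dWirt i F z = dWirt i H z := by
  simp only [dWirt, h.fderiv_eq]

theorem dbarWirt_congr (h : F =ᶠ[𝓝 z] H) (i : Fin n) : dbarWirt i F z = dbarWirt i H z := by
  simp only [dbarWirt, h.fderiv_eq]

theorem eventuallyEq_dbarWirt (h : F =ᶠ[𝓝 z] H) (i : Fin n) :
    dbarWirt i F =ᶠ[𝓝 z] dbarWirt i H :=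
  h.eventuallyEq_nhds.mono fun _ hw => dbarWirt_congr hw i

@[simp] theorem dWirt_const (c : ℂ) (i : Fin n) : dWirt i (fun _ => c) z = 0 := by simp [dWirt]

@[simp] theorem dbarWirt_const (c : ℂ) (i : Fin n) : dbarWirt i (fun _ => c) z = 0 := by
  simp [dbarWirt]

theorem dWirt_add (hF : DifferentiableAt ℝ F z) (hH : DifferentiableAt ℝ H z) (i : Fin n) :
    dWirt i (fun w => F w + H w) z = dWirt i F z + dWirt i H z := by
  simp only [dWirt, fderiv_fun_add hF hH, add_apply]; ring

theorem dWirt_mul (hF : DifferentiableAt ℝ F z) (hH : DifferentiableAt ℝ H z) (i : Fin n) :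
    dWirt i (fun w => F w * H w) z = dWirt i F z * H z + F z * dWirt i H z := by
  simp only [dWirt, fderiv_fun_mul hF hH, add_apply, smul_apply, smul_eq_mul]
  ring

theorem dbarWirt_mul (hF : DifferentiableAt ℝ F z) (hH : DifferentiableAt ℝ H z) (i : Fin n) :
    dbarWirt i (fun w => F w * H w) z = dbarWirt i F z * H z + F z * dbarWirt i H z := by
  simp only [dbarWirt, fderiv_fun_mul hF hH, add_apply, smul_apply, smul_eq_mul]
  ring

theorem dWirt_const_mul (c : ℂ) (hF : DifferentiableAt ℝ F z) (i : Fin n) :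
    dWirt i (fun w => c * F w) z = c * dWirt i F z := by
  rw [dWirt_mul (by fun_prop) hF]; simp

theorem dbarWirt_const_mul (c : ℂ) (hF : DifferentiableAt ℝ F z) (i : Fin n) :
    dbarWirt i (fun w => c * F w) z = c * dbarWirt i F z := by
  rw [dbarWirt_mul (by fun_prop) hF]; simp

theorem dWirt_sum {ι : Type*} (s : Finset ι) {F : ι → (Fin n → ℂ) → ℂ}
    (hF : ∀ a ∈ s, DifferentiableAt ℝ (F a) z) (i : Fin n) :
    dWirt i (fun w => ∑ a ∈ s, F a w) z = ∑ a ∈ s, dWirt i (F a) z := by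
  simp only [dWirt, fderiv_fun_sum hF, sum_apply, Finset.mul_sum, ← Finset.sum_sub_distrib]

theorem dbarWirt_sum {ι : Type*} (s : Finset ι) {F : ι → (Fin n → ℂ) → ℂ}
    (hF : ∀ a ∈ s, DifferentiableAt ℝ (F a) z) (i : Fin n) :
    dbarWirt i (fun w => ∑ a ∈ s, F a w) z = ∑ a ∈ s, dbarWirt i (F a) z := by
  simp only [dbarWirt, fderiv_fun_sum hF, sum_apply, Finset.mul_sum, ← Finset.sum_add_distrib]

theorem _root_.ContDiffAt.dWirt {m k : ℕ∞ω} (hF : ContDiffAt ℝ k F z) (hm : m + 1 ≤ k) (i : Fin n) :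
    ContDiffAt ℝ m (ConformalExtremal.dWirt i F) z := by
  have h := hF.fderiv_right hm
  unfold ConformalExtremal.dWirt
  fun_prop

theorem _root_.ContDiffAt.dbarWirt {m k : ℕ∞ω} (hF : ContDiffAt ℝ k F z) (hm : m + 1 ≤ k) (i : Fin n) :
    ContDiffAt ℝ m (ConformalExtremal.dbarWirt i F) z := by
  have h := hF.fderiv_right hm
  unfold ConformalExtremal.dbarWirt
  fun_prop

/-- Mixed derivatives commute, by the symmetry of the second real derivative. -/
theorem dWirt_dbarWirt_comm (hF : ContDiffAt ℝ 2 F z) (i j : Fin n) :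
    dWirt i (dbarWirt j F) z = dbarWirt j (dWirt i F) z := by
  have hd : DifferentiableAt ℝ (fderiv ℝ F) z :=
    (hF.fderiv_right (m := 1) (by norm_num)).differentiableAt (by norm_num)
  have hs : IsSymmSndFDerivAt ℝ F z := hF.isSymmSndFDerivAt (by simp)
  have key : ∀ c : ℂ, ∀ v w w' : Fin n → ℂ,
      fderiv ℝ (fun y => (1 / 2 : ℂ) * (fderiv ℝ F y w + c * fderiv ℝ F y w')) z v =
        (1 / 2 : ℂ) * (fderiv ℝ (fderiv ℝ F) z v w + c * fderiv ℝ (fderiv ℝ F) z v w') := by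
    intro c v w w'
    have e : ∀ u : Fin n → ℂ, HasFDerivAt (fun y => fderiv ℝ F y u)
        ((fderiv ℝ (fderiv ℝ F) z).flip u) z := fun u => by
      simpa using hd.hasFDerivAt.clm_apply (hasFDerivAt_const u z)
    have := (((e w).add ((e w').const_mul c)).const_mul (1 / 2 : ℂ)).fderiv
    simp only [Pi.add_apply] at this
    rw [this]
    simp; ring
  have key' : ∀ c : ℂ, ∀ v w w' : Fin n → ℂ,
      fderiv ℝ (fun y => (1 / 2 : ℂ) * (fderiv ℝ F y w - c * fderiv ℝ F y w')) z v =
        (1 / 2 : ℂ) * (fderiv ℝ (fderiv ℝ F) z v w - c * fderiv ℝ (fderiv ℝ F) z v w') := by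
    intro c v w w'
    have := key (-c) v w w'
    simpa only [neg_mul, ← sub_eq_add_neg] using this
  unfold dWirt dbarWirt
  rw [key, key, key', key', hs.eq (Pi.single i 1) (Pi.single j 1),
    hs.eq (Pi.single i Complex.I) (Pi.single j 1), hs.eq (Pi.single i 1) (Pi.single j Complex.I),
    hs.eq (Pi.single i Complex.I) (Pi.single j Complex.I)]
  ring

theorem conj_dWirt (hF : DifferentiableAt ℝ F z) (i : Fin n) :
    starRingEnd ℂ (dWirt i F z) = dbarWirt i (fun w => starRingEnd ℂ (F w)) z := by
  have h : HasFDerivAt (fun w => starRingEnd ℂ (F w))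
      ((Complex.conjCLE : ℂ →L[ℝ] ℂ).comp (fderiv ℝ F z)) z :=
    (Complex.conjCLE : ℂ →L[ℝ] ℂ).hasFDerivAt.comp z hF.hasFDerivAt
  rw [dbarWirt, h.fderiv, dWirt]
  simp [Complex.conj_ofNat]

theorem conj_dbarWirt (hF : DifferentiableAt ℝ F z) (i : Fin n) :
    starRingEnd ℂ (dbarWirt i F z) = dWirt i (fun w => starRingEnd ℂ (F w)) z := by
  have h : HasFDerivAt (fun w => starRingEnd ℂ (F w))
      ((Complex.conjCLE : ℂ →L[ℝ] ℂ).comp (fderiv ℝ F z)) z :=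
    (Complex.conjCLE : ℂ →L[ℝ] ℂ).hasFDerivAt.comp z hF.hasFDerivAt
  rw [dWirt, h.fderiv, dbarWirt]
  simp [sub_eq_add_neg, Complex.conj_ofNat]

/-- Chain rule for a function of a real-valued function. -/
theorem dWirt_comp_real {u : (Fin n → ℂ) → ℝ} {Φ : ℝ → ℝ} {Φ' : ℝ}
    (hΦ : HasDerivAt Φ Φ' (u z)) (hu : DifferentiableAt ℝ u z) (i : Fin n) :
    dWirt i (fun w => ((Φ (u w) : ℝ) : ℂ)) z = Φ' * dWirt i (fun w => (u w : ℂ)) z := by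
  have h1 : HasFDerivAt (fun w => ((Φ (u w) : ℝ) : ℂ))
      (Complex.ofRealCLM.comp (Φ' • fderiv ℝ u z)) z :=
    Complex.ofRealCLM.hasFDerivAt.comp z (hΦ.comp_hasFDerivAt z hu.hasFDerivAt)
  have h2 : HasFDerivAt (fun w => (u w : ℂ)) (Complex.ofRealCLM.comp (fderiv ℝ u z)) z :=
    Complex.ofRealCLM.hasFDerivAt.comp z hu.hasFDerivAt
  rw [dWirt, dWirt, h1.fderiv, h2.fderiv]
  simp; ring

theorem dbarWirt_comp_real {u : (Fin n → ℂ) → ℝ} {Φ : ℝ → ℝ} {Φ' : ℝ}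
    (hΦ : HasDerivAt Φ Φ' (u z)) (hu : DifferentiableAt ℝ u z) (i : Fin n) :
    dbarWirt i (fun w => ((Φ (u w) : ℝ) : ℂ)) z = Φ' * dbarWirt i (fun w => (u w : ℂ)) z := by
  have h1 : HasFDerivAt (fun w => ((Φ (u w) : ℝ) : ℂ))
      (Complex.ofRealCLM.comp (Φ' • fderiv ℝ u z)) z :=
    Complex.ofRealCLM.hasFDerivAt.comp z (hΦ.comp_hasFDerivAt z hu.hasFDerivAt)
  have h2 : HasFDerivAt (fun w => (u w : ℂ)) (Complex.ofRealCLM.comp (fderiv ℝ u z)) z :=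
    Complex.ofRealCLM.hasFDerivAt.comp z hu.hasFDerivAt
  rw [dbarWirt, dbarWirt, h1.fderiv, h2.fderiv]
  simp; ring

theorem sum_re_smul_single_add_im_smul_single (v : Fin n → ℂ) :
    ∑ i, ((v i).re • (Pi.single i 1 : Fin n → ℂ) +
      (v i).im • (Pi.single i Complex.I : Fin n → ℂ)) = v := by
  ext j
  simp [Finset.sum_apply, Pi.single_apply, Finset.sum_add_distrib, Complex.re_add_im]

/-- A real function whose `∂`-derivatives vanish at a point has zero differential there. -/
theorem fderiv_eq_zero_of_dWirt_eq_zero {u : (Fin n → ℂ) → ℝ} (hu : DifferentiableAt ℝ u z)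
    (h : ∀ i, dWirt i (fun w => (u w : ℂ)) z = 0) : fderiv ℝ u z = 0 := by
  have h2 : HasFDerivAt (fun w => (u w : ℂ)) (Complex.ofRealCLM.comp (fderiv ℝ u z)) z :=
    Complex.ofRealCLM.hasFDerivAt.comp z hu.hasFDerivAt
  have h3 : ∀ i, fderiv ℝ u z (Pi.single i 1) = 0 ∧ fderiv ℝ u z (Pi.single i Complex.I) = 0 := by
    intro i
    have := h i
    rw [dWirt, h2.fderiv] at this
    have h4 := mul_eq_zero.1 this |>.resolve_left (by norm_num)
    constructor
    · simpa using congrArg Complex.re h4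
    · simpa using congrArg Complex.im h4
  ext v
  rw [← sum_re_smul_single_add_im_smul_single v, map_sum]
  simp [h3]

variable {φ : (Fin n → ℂ) → (Fin n → ℂ)}

theorem real_clm_apply_complex (L : (Fin n → ℂ) →L[ℝ] ℂ) (v : Fin n → ℂ) :
    L v = ∑ a, ((v a).re * L (Pi.single a 1) + (v a).im * L (Pi.single a Complex.I)) := by
  conv_lhs => rw [← sum_re_smul_single_add_im_smul_single v, map_sum]
  simp

theorem fderiv_comp_holomorphic (hF : DifferentiableAt ℝ F (φ z)) (hφ : DifferentiableAt ℂ φ z)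
    (v : Fin n → ℂ) :
    fderiv ℝ (fun w => F (φ w)) z v = fderiv ℝ F (φ z) (fderiv ℂ φ z v) := by
  have := hF.hasFDerivAt.comp z (hφ.hasFDerivAt.restrictScalars ℝ)
  rw [show (fun w => F (φ w)) = F ∘ φ from rfl, this.fderiv]
  simp

theorem single_I (i : Fin n) : (Pi.single i Complex.I : Fin n → ℂ) =
    Complex.I • (Pi.single i 1 : Fin n → ℂ) := by
  rw [← Pi.single_smul]; simp

/-- Chain rule for `∂` and a holomorphic change of coordinates. -/
theorem dWirt_comp_holomorphic (hF : DifferentiableAt ℝ F (φ z)) (hφ : DifferentiableAt ℂ φ z)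
    (i : Fin n) :
    dWirt i (fun w => F (φ w)) z =
      ∑ a, fderiv ℂ φ z (Pi.single i 1) a * dWirt a F (φ z) := by
  rw [dWirt, fderiv_comp_holomorphic hF hφ, fderiv_comp_holomorphic hF hφ, single_I i, map_smul,
    real_clm_apply_complex, real_clm_apply_complex _ (Complex.I • _), Finset.mul_sum,
    ← Finset.sum_sub_distrib, Finset.mul_sum]
  refine Finset.sum_congr rfl fun a _ => ?_
  rw [dWirt]
  conv_rhs => rw [← Complex.re_add_im (fderiv ℂ φ z (Pi.single i 1) a)]
  simp only [Pi.smul_apply, smul_eq_mul, Complex.mul_re, Complex.mul_im, Complex.I_re,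
    Complex.I_im]
  push_cast
  linear_combination ((1 / 2 : ℂ) * (fderiv ℂ φ z (Pi.single i 1) a).im
    * fderiv ℝ F (φ z) (Pi.single a Complex.I)) * Complex.I_sq

/-- Chain rule for `∂̄` and a holomorphic change of coordinates. -/
theorem dbarWirt_comp_holomorphic (hF : DifferentiableAt ℝ F (φ z))
    (hφ : DifferentiableAt ℂ φ z) (i : Fin n) :
    dbarWirt i (fun w => F (φ w)) z =
      ∑ a, starRingEnd ℂ (fderiv ℂ φ z (Pi.single i 1) a) * dbarWirt a F (φ z) := by
  rw [dbarWirt, fderiv_comp_holomorphic hF hφ, fderiv_comp_holomorphic hF hφ, single_I i, map_smul,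
    real_clm_apply_complex, real_clm_apply_complex _ (Complex.I • _), Finset.mul_sum,
    ← Finset.sum_add_distrib, Finset.mul_sum]
  refine Finset.sum_congr rfl fun a _ => ?_
  rw [dbarWirt]
  conv_rhs => rw [← Complex.re_add_im (fderiv ℂ φ z (Pi.single i 1) a)]
  simp only [Pi.smul_apply, smul_eq_mul, Complex.mul_re, Complex.mul_im, Complex.I_re,
    Complex.I_im, map_add, map_mul, Complex.conj_ofReal, Complex.conj_I]
  push_cast
  linear_combination ((1 / 2 : ℂ) * (fderiv ℂ φ z (Pi.single i 1) a).im
    * fderiv ℝ F (φ z) (Pi.single a Complex.I)) * Complex.I_sq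

theorem dbarWirt_holomorphic (hF : DifferentiableAt ℂ F z) (i : Fin n) : dbarWirt i F z = 0 := by
  rw [dbarWirt, (hF.hasFDerivAt.restrictScalars ℝ).fderiv, single_I i]
  simp only [ContinuousLinearMap.coe_restrictScalars', map_smul, smul_eq_mul, ← mul_assoc,
    Complex.I_mul_I]
  ring

theorem dWirt_conj_holomorphic (hF : DifferentiableAt ℂ F z) (i : Fin n) :
    dWirt i (fun w => starRingEnd ℂ (F w)) z = 0 := by
  rw [← conj_dbarWirt (hF.restrictScalars ℝ), dbarWirt_holomorphic hF, map_zero]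

end Wirtinger

/-! ### The Chern scalar curvature and the complex Laplacian of a matrix of coefficients -/

section Local

variable {n : ℕ}

/-- `∂/∂zⁱ` of a matrix of functions, entry by entry. -/
def matD (i : Fin n) (G : (Fin n → ℂ) → Matrix (Fin n) (Fin n) ℂ) (z : Fin n → ℂ) :
    Matrix (Fin n) (Fin n) ℂ :=
  Matrix.of fun k l => dWirt i (fun w => G w k l) z

/-- `∂/∂z̄ⁱ` of a matrix of functions, entry by entry. -/
def matDbar (i : Fin n) (G : (Fin n → ℂ) → Matrix (Fin n) (Fin n) ℂ) (z : Fin n → ℂ) :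
    Matrix (Fin n) (Fin n) ℂ :=
  Matrix.of fun k l => dbarWirt i (fun w => G w k l) z

/-- The matrix `(Θ_{i j̄ k l̄})_{k l}` of the Chern curvature of the metric with coefficients `G`. -/
def localCurv (G : (Fin n → ℂ) → Matrix (Fin n) (Fin n) ℂ) (i j : Fin n) (z : Fin n → ℂ) :
    Matrix (Fin n) (Fin n) ℂ :=
  -matD i (matDbar j G) z + matD i G z * (G z)⁻¹ * matDbar j G z

/-- The complex number `∑ g^{i j̄} g^{k l̄} Θ_{i j̄ k l̄}` for the metric with coefficients `G`. -/
def localScalar (G : (Fin n → ℂ) → Matrix (Fin n) (Fin n) ℂ) (z : Fin n → ℂ) : ℂ :=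
  ((G z)⁻¹ * Matrix.of fun i j => ((G z)⁻¹ * localCurv G i j z).trace).trace

/-- The complex Laplacian `∑ g^{i j̄} ∂²u/∂zⁱ∂z̄ʲ` for the metric with coefficients `G`. -/
def localLap (G : (Fin n → ℂ) → Matrix (Fin n) (Fin n) ℂ) (u : (Fin n → ℂ) → ℂ)
    (z : Fin n → ℂ) : ℂ :=
  ((G z)⁻¹ * Matrix.of fun i j => dWirt i (dbarWirt j u) z).trace

variable {G P A : (Fin n → ℂ) → Matrix (Fin n) (Fin n) ℂ} {z : Fin n → ℂ}

theorem matD_congr (h : G =ᶠ[𝓝 z] P) (i : Fin n) : matD i G z = matD i P z := by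
  ext k l
  exact dWirt_congr (h.mono fun w hw => by rw [hw]) i

theorem matDbar_congr (h : G =ᶠ[𝓝 z] P) (i : Fin n) : matDbar i G z = matDbar i P z := by
  ext k l
  exact dbarWirt_congr (h.mono fun w hw => by rw [hw]) i

theorem localCurv_congr (h : G =ᶠ[𝓝 z] P) (i j : Fin n) :
    localCurv G i j z = localCurv P i j z := by
  have h2 : matDbar j G =ᶠ[𝓝 z] matDbar j P :=
    h.eventuallyEq_nhds.mono fun w hw => matDbar_congr hw j
  rw [localCurv, localCurv, matD_congr h2, matD_congr h, matDbar_congr h, h.self_of_nhds]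

theorem matD_mul (hG : ∀ k l, DifferentiableAt ℝ (fun w => G w k l) z)
    (hP : ∀ k l, DifferentiableAt ℝ (fun w => P w k l) z) (i : Fin n) :
    matD i (fun w => G w * P w) z = matD i G z * P z + G z * matD i P z := by
  ext k l
  simp only [matD, Matrix.mul_apply, Matrix.of_apply, Matrix.add_apply]
  rw [dWirt_sum _ fun a _ => (hG k a).fun_mul (hP a l), ← Finset.sum_add_distrib]
  exact Finset.sum_congr rfl fun a _ => dWirt_mul (hG k a) (hP a l) i

theorem matDbar_mul (hG : ∀ k l, DifferentiableAt ℝ (fun w => G w k l) z)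
    (hP : ∀ k l, DifferentiableAt ℝ (fun w => P w k l) z) (i : Fin n) :
    matDbar i (fun w => G w * P w) z = matDbar i G z * P z + G z * matDbar i P z := by
  ext k l
  simp only [matDbar, Matrix.mul_apply, Matrix.of_apply, Matrix.add_apply]
  rw [dbarWirt_sum _ fun a _ => (hG k a).fun_mul (hP a l), ← Finset.sum_add_distrib]
  exact Finset.sum_congr rfl fun a _ => dbarWirt_mul (hG k a) (hP a l) i

theorem matD_add (hG : ∀ k l, DifferentiableAt ℝ (fun w => G w k l) z)
    (hP : ∀ k l, DifferentiableAt ℝ (fun w => P w k l) z) (i : Fin n) :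
    matD i (fun w => G w + P w) z = matD i G z + matD i P z := by
  ext k l
  exact dWirt_add (hG k l) (hP k l) i

theorem contDiffAt_matrix_mul {m : ℕ∞ω}
    (hG : ∀ k l, ContDiffAt ℝ m (fun w => G w k l) z)
    (hP : ∀ k l, ContDiffAt ℝ m (fun w => P w k l) z) (k l : Fin n) :
    ContDiffAt ℝ m (fun w => (G w * P w) k l) z := by
  simp only [Matrix.mul_apply]
  exact ContDiffAt.sum fun a _ => (hG k a).mul (hP a l)

theorem contDiffAt_det {m : ℕ∞ω} (hG : ∀ k l, ContDiffAt ℝ m (fun w => G w k l) z) :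
    ContDiffAt ℝ m (fun w => (G w).det) z := by
  simp only [Matrix.det_apply, Units.smul_def, zsmul_eq_mul]
  exact ContDiffAt.sum fun σ _ => contDiffAt_const.mul (contDiffAt_prod fun k _ => hG _ _)

theorem contDiffAt_adjugate {m : ℕ∞ω} (hG : ∀ k l, ContDiffAt ℝ m (fun w => G w k l) z)
    (k l : Fin n) : ContDiffAt ℝ m (fun w => (G w).adjugate k l) z := by
  simp only [Matrix.adjugate_apply]
  refine contDiffAt_det fun a b => ?_
  simp only [Matrix.updateRow_apply]
  split_ifs
  exacts [contDiffAt_const, hG a b]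

theorem contDiffAt_inv {m : ℕ∞ω} (hG : ∀ k l, ContDiffAt ℝ m (fun w => G w k l) z)
    (hdet : (G z).det ≠ 0) (k l : Fin n) : ContDiffAt ℝ m (fun w => (G w)⁻¹ k l) z := by
  simp only [Matrix.inv_def, Ring.inverse_eq_inv', Matrix.smul_apply, smul_eq_mul]
  exact ((contDiffAt_det hG).inv hdet).mul (contDiffAt_adjugate hG k l)

theorem contDiffAt_trace {m : ℕ∞ω} (hG : ∀ k l, ContDiffAt ℝ m (fun w => G w k l) z) :
    ContDiffAt ℝ m (fun w => (G w).trace) z := by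
  simp only [Matrix.trace, Matrix.diag_apply]
  exact ContDiffAt.sum fun k _ => hG k k

theorem contDiffAt_localScalar (hG : ∀ k l, ContDiffAt ℝ ∞ (fun w => G w k l) z)
    (hdet : (G z).det ≠ 0) : ContDiffAt ℝ ∞ (localScalar G) z := by
  have hi := contDiffAt_inv hG hdet
  refine contDiffAt_trace (contDiffAt_matrix_mul hi fun i j => ?_)
  simp only [Matrix.of_apply]
  refine contDiffAt_trace (contDiffAt_matrix_mul hi fun k l => ?_)
  simp only [localCurv, Matrix.add_apply, Matrix.neg_apply]
  refine ContDiffAt.add (ContDiffAt.neg ?_) (contDiffAt_matrix_mul (contDiffAt_matrix_mul ?_ hi) ?_ k l)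
  · exact ((hG k l).dbarWirt (m := ∞) (by simp) j).dWirt (by simp) i
  · exact fun k l => (hG k l).dWirt (by simp) i
  · exact fun k l => (hG k l).dbarWirt (by simp) j

theorem continuousAt_localLap {u : (Fin n → ℂ) → ℂ}
    (hG : ∀ k l, ContDiffAt ℝ 0 (fun w => G w k l) z)
    (hdet : (G z).det ≠ 0) (hu : ContDiffAt ℝ 2 u z) : ContinuousAt (localLap G u) z := by
  refine ContDiffAt.continuousAt (n := 0) (𝕜 := ℝ) ?_
  refine contDiffAt_trace (contDiffAt_matrix_mul (contDiffAt_inv hG hdet) fun i j => ?_)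
  exact (hu.dbarWirt (m := 1) (by norm_num) j).dWirt (by norm_num) i

/-- The contraction of a tensor with the inverse metric does not depend on the frame: under the change
of frame `A` the metric `P` and the tensor `X` become `A P Aᴴ` and `A X Aᴴ`. -/
theorem trace_congruence_inv {A P X : Matrix (Fin n) (Fin n) ℂ} (hA : A.det ≠ 0) :
    ((A * P * A.conjTranspose)⁻¹ * (A * X * A.conjTranspose)).trace = (P⁻¹ * X).trace := by
  have hA' : A.conjTranspose.det ≠ 0 := by
    rw [Matrix.det_conjTranspose]; exact star_ne_zero.2 hA
  have h1 : A⁻¹ * A = 1 := Matrix.nonsing_inv_mul _ (isUnit_iff_ne_zero.2 hA)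
  have h2 : A.conjTranspose * (A.conjTranspose)⁻¹ = 1 :=
    Matrix.mul_nonsing_inv _ (isUnit_iff_ne_zero.2 hA')
  rw [Matrix.mul_inv_rev, Matrix.mul_inv_rev, Matrix.trace_mul_comm]
  calc (A * X * A.conjTranspose * ((A.conjTranspose)⁻¹ * (P⁻¹ * A⁻¹))).trace
      = (A * (X * (A.conjTranspose * (A.conjTranspose)⁻¹) * P⁻¹ * A⁻¹)).trace := by
        simp only [Matrix.mul_assoc]
    _ = ((X * (A.conjTranspose * (A.conjTranspose)⁻¹) * P⁻¹ * A⁻¹) * A).trace :=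
        Matrix.trace_mul_comm _ _
    _ = (P⁻¹ * X).trace := by
        rw [h2, Matrix.mul_assoc, h1, mul_one, mul_one, Matrix.trace_mul_comm]

theorem matrix_congruence_apply (A X : Matrix (Fin n) (Fin n) ℂ) (i j : Fin n) :
    (A * X * A.conjTranspose) i j = ∑ b, starRingEnd ℂ (A j b) * ∑ a, A i a * X a b := by
  simp only [Matrix.mul_apply, Matrix.conjTranspose_apply, starRingEnd_apply]
  exact Finset.sum_congr rfl fun b _ => mul_comm _ _

/-- Change of the holomorphic frame: the Chern curvature is tensorial in its last two indices. -/
theorem localCurv_congruence {U : Set (Fin n → ℂ)} (hU : IsOpen U) (hz : z ∈ U)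
    (hP : ∀ k l, ContDiffOn ℝ 2 (fun w => P w k l) U)
    (hA : ∀ k l, ContDiffOn ℂ ω (fun w => A w k l) U) (hAdet : (A z).det ≠ 0)
    (hPdet : (P z).det ≠ 0) (i j : Fin n) :
    localCurv (fun w => A w * P w * (A w).conjTranspose) i j z =
      A z * localCurv P i j z * (A z).conjTranspose := by
  have hPa : ∀ w ∈ U, ∀ k l, ContDiffAt ℝ 2 (fun w => P w k l) w := fun w hw k l =>
    (hP k l).contDiffAt (hU.mem_nhds hw)
  have hAc : ∀ w ∈ U, ∀ k l, DifferentiableAt ℂ (fun w => A w k l) w := fun w hw k l =>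
    ((hA k l).contDiffAt (hU.mem_nhds hw)).differentiableAt (by simp)
  have hAa : ∀ w ∈ U, ∀ k l, ContDiffAt ℝ 2 (fun w => A w k l) w := fun w hw k l =>
    (((hA k l).contDiffAt (hU.mem_nhds hw)).restrict_scalars ℝ).of_le (by exact le_top)
  set B : (Fin n → ℂ) → Matrix (Fin n) (Fin n) ℂ := fun w => (A w).conjTranspose with hB
  have hBa : ∀ w ∈ U, ∀ k l, ContDiffAt ℝ 2 (fun w => B w k l) w := fun w hw k l =>
    Complex.conjCLE.contDiff.contDiffAt.comp w (hAa w hw l k)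
  have h2 : (2 : ℕ∞ω) ≠ 0 := by norm_num
  have hPd := fun w hw k l => (hPa w hw k l).differentiableAt h2
  have hAd := fun w hw k l => (hAa w hw k l).differentiableAt h2
  have hBd := fun w hw k l => (hBa w hw k l).differentiableAt h2
  have hAPd : ∀ w ∈ U, ∀ k l, DifferentiableAt ℝ (fun w => (A w * P w) k l) w := fun w hw k l =>
    (contDiffAt_matrix_mul (hAa w hw) (hPa w hw) k l).differentiableAt h2
  have hAbar : ∀ w ∈ U, matDbar j A w = 0 := fun w hw => by
    ext k l; exact dbarWirt_holomorphic (hAc w hw k l) j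
  have hBD : ∀ w ∈ U, matD i B w = 0 := fun w hw => by
    ext k l; exact dWirt_conj_holomorphic (hAc w hw l k) i
  have hBDD : matD i (matDbar j B) z = 0 := by
    ext k l
    change dWirt i (dbarWirt j fun w => B w k l) z = 0
    rw [dWirt_dbarWirt_comm (hBa z hz k l)]
    rw [dbarWirt_congr (H := fun _ => 0), dbarWirt_const]
    filter_upwards [hU.mem_nhds hz] with w hw
    exact dWirt_conj_holomorphic (hAc w hw l k) i
  -- first derivatives; `∂̄A` and `∂Aᴴ` vanish since `A` is holomorphic
  have e1 : ∀ w ∈ U, matDbar j (fun w => A w * P w * B w) w =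
      A w * matDbar j P w * B w + A w * P w * matDbar j B w := fun w hw => by
    rw [matDbar_mul (G := fun w => A w * P w) (hAPd w hw) (hBd w hw),
      matDbar_mul (hAd w hw) (hPd w hw), hAbar w hw, zero_mul, zero_add]
  have e2 : matD i (fun w => A w * P w * B w) z =
      (matD i A z * P z + A z * matD i P z) * B z := by
    rw [matD_mul (G := fun w => A w * P w) (hAPd z hz) (hBd z hz),
      matD_mul (hAd z hz) (hPd z hz), hBD z hz, mul_zero, add_zero]
  -- the mixed second derivative
  have hPj : ∀ k l, DifferentiableAt ℝ (fun w => matDbar j P w k l) z := fun k l =>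
    ((hPa z hz k l).dbarWirt (m := 1) (by norm_num) j).differentiableAt (by norm_num)
  have hBj : ∀ k l, DifferentiableAt ℝ (fun w => matDbar j B w k l) z := fun k l =>
    ((hBa z hz k l).dbarWirt (m := 1) (by norm_num) j).differentiableAt (by norm_num)
  have dmul : ∀ {X Y : (Fin n → ℂ) → Matrix (Fin n) (Fin n) ℂ},
      (∀ k l, DifferentiableAt ℝ (fun w => X w k l) z) →
      (∀ k l, DifferentiableAt ℝ (fun w => Y w k l) z) →
      ∀ k l, DifferentiableAt ℝ (fun w => (X w * Y w) k l) z := by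
    intro X Y hX hY k l
    simp only [Matrix.mul_apply]
    exact DifferentiableAt.fun_sum fun a _ => (hX k a).mul (hY a l)
  have e3 : matD i (matDbar j (fun w => A w * P w * B w)) z =
      (matD i A z * matDbar j P z + A z * matD i (matDbar j P) z) * B z +
      (matD i A z * P z + A z * matD i P z) * matDbar j B z := by
    have : matDbar j (fun w => A w * P w * B w) =ᶠ[𝓝 z]
        fun w => A w * matDbar j P w * B w + A w * P w * matDbar j B w := by
      filter_upwards [hU.mem_nhds hz] with w hw using e1 w hw
    rw [matD_congr this, matD_add (dmul (dmul (hAd z hz) hPj) (hBd z hz))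
      (dmul (hAPd z hz) hBj), matD_mul (G := fun w => A w * matDbar j P w)
      (dmul (hAd z hz) hPj) (hBd z hz), matD_mul (hAd z hz) hPj,
      matD_mul (G := fun w => A w * P w) (hAPd z hz) hBj, matD_mul (hAd z hz) (hPd z hz),
      hBD z hz, hBDD, mul_zero, mul_zero, add_zero, add_zero]
  have hBdet : (B z).det ≠ 0 := by
    rw [hB, Matrix.det_conjTranspose]; exact star_ne_zero.2 hAdet
  have c1 : (A z)⁻¹ * A z = 1 := Matrix.nonsing_inv_mul _ (isUnit_iff_ne_zero.2 hAdet)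
  have c2 : B z * (B z)⁻¹ = 1 := Matrix.mul_nonsing_inv _ (isUnit_iff_ne_zero.2 hBdet)
  have c3 : P z * (P z)⁻¹ = 1 := Matrix.mul_nonsing_inv _ (isUnit_iff_ne_zero.2 hPdet)
  have c4 : (P z)⁻¹ * P z = 1 := Matrix.nonsing_inv_mul _ (isUnit_iff_ne_zero.2 hPdet)
  change localCurv (fun w => A w * P w * B w) i j z = A z * localCurv P i j z * B z
  rw [localCurv, localCurv, e3, e2, e1 z hz]
  generalize matD i A z = Ai at *
  generalize matD i P z = Pi at *
  generalize matDbar j P z = Pj at *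
  generalize matDbar j B z = Bj at *
  generalize matD i (matDbar j P) z = Pij at *
  have key : (Ai * P z + A z * Pi) * B z * (A z * P z * B z)⁻¹ *
      (A z * Pj * B z + A z * P z * Bj) =
      (Ai * P z + A z * Pi) * (P z)⁻¹ * (Pj * B z + P z * Bj) := by
    rw [Matrix.mul_inv_rev, Matrix.mul_inv_rev]
    calc _ = (Ai * P z + A z * Pi) * (B z * (B z)⁻¹) * (P z)⁻¹ * ((A z)⁻¹ * A z) *
        (Pj * B z + P z * Bj) := by noncomm_ring
      _ = _ := by rw [c1, c2]; noncomm_ring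
  rw [key]
  calc _ = -((Ai * Pj + A z * Pij) * B z + (Ai * P z + A z * Pi) * Bj) +
      (Ai * (P z * (P z)⁻¹) * Pj * B z + Ai * (P z * (P z)⁻¹) * P z * Bj +
        A z * Pi * (P z)⁻¹ * Pj * B z + A z * Pi * ((P z)⁻¹ * P z) * Bj) := by noncomm_ring
    _ = _ := by rw [c3, c4]; noncomm_ring

/-- The Jacobian matrix `(∂φᵃ/∂zⁱ)_{i a}` of a map of `ℂⁿ`. -/
def jac (φ : (Fin n → ℂ) → (Fin n → ℂ)) (z : Fin n → ℂ) : Matrix (Fin n) (Fin n) ℂ :=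
  Matrix.of fun i a => fderiv ℂ φ z (Pi.single i 1) a

variable {φ : (Fin n → ℂ) → (Fin n → ℂ)} {U : Set (Fin n → ℂ)}

theorem contDiffOn_jac (hU : IsOpen U) (hφ : ContDiffOn ℂ ω φ U) (k l : Fin n) :
    ContDiffOn ℂ ω (fun w => jac φ w k l) U := by
  have h1 : ContDiffOn ℂ ω (fderiv ℂ φ) U := hφ.fderiv_of_isOpen hU (by simp)
  have h2 : ContDiffOn ℂ ω (fun w => fderiv ℂ φ w (Pi.single k 1)) U := by fun_prop
  exact (contDiffOn_pi.1 h2) l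

/-- Change of holomorphic coordinates in a mixed second derivative. -/
theorem dWirt_dbarWirt_comp_holomorphic (hU : IsOpen U) (hz : z ∈ U) (hφ : ContDiffOn ℂ ω φ U)
    {u : (Fin n → ℂ) → ℂ} (hu : ∀ w ∈ U, ContDiffAt ℝ 2 u (φ w)) (i j : Fin n) :
    dWirt i (dbarWirt j fun w => u (φ w)) z =
      ∑ b, starRingEnd ℂ (jac φ z j b) *
        ∑ a, jac φ z i a * dWirt a (dbarWirt b u) (φ z) := by
  have hφd : ∀ w ∈ U, DifferentiableAt ℂ φ w := fun w hw =>
    (hφ.contDiffAt (hU.mem_nhds hw)).differentiableAt (by simp)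
  have hJ : ∀ k l, DifferentiableAt ℂ (fun w => jac φ w k l) z := fun k l =>
    ((contDiffOn_jac hU hφ k l).contDiffAt (hU.mem_nhds hz)).differentiableAt (by simp)
  have hJc : ∀ k l, DifferentiableAt ℝ (fun w => starRingEnd ℂ (jac φ w k l)) z := fun k l =>
    Complex.conjCLE.differentiableAt.comp z ((hJ k l).restrictScalars ℝ)
  have h1 : (dbarWirt j fun w => u (φ w)) =ᶠ[𝓝 z]
      fun w => ∑ b, starRingEnd ℂ (jac φ w j b) * dbarWirt b u (φ w) := by
    filter_upwards [hU.mem_nhds hz] with w hw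
    exact dbarWirt_comp_holomorphic ((hu w hw).differentiableAt (by norm_num)) (hφd w hw) j
  have hub : ∀ b, DifferentiableAt ℝ (dbarWirt b u) (φ z) := fun b =>
    ((hu z hz).dbarWirt (m := 1) (by norm_num) b).differentiableAt (by norm_num)
  have hub' : ∀ b, DifferentiableAt ℝ (fun w => dbarWirt b u (φ w)) z := fun b =>
    (hub b).comp z ((hφd z hz).restrictScalars ℝ)
  rw [dWirt_congr h1, dWirt_sum _ fun b _ => (hJc j b).fun_mul (hub' b)]
  refine Finset.sum_congr rfl fun b _ => ?_
  rw [dWirt_mul (hJc j b) (hub' b), dWirt_conj_holomorphic (hJ j b), zero_mul, zero_add,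
    dWirt_comp_holomorphic (hub b) (hφd z hz)]
  rfl

/-- Change of holomorphic coordinates, in a fixed frame: the Chern curvature is tensorial in its first
two indices. -/
theorem localCurv_comp_holomorphic (hU : IsOpen U) (hz : z ∈ U) (hφ : ContDiffOn ℂ ω φ U)
    (hP : ∀ w ∈ U, ∀ k l, ContDiffAt ℝ 2 (fun w => P w k l) (φ w)) (i j : Fin n) :
    localCurv (fun w => P (φ w)) i j z =
      ∑ b, starRingEnd ℂ (jac φ z j b) • ∑ a, jac φ z i a • localCurv P a b (φ z) := by
  have hφd : DifferentiableAt ℂ φ z :=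
    (hφ.contDiffAt (hU.mem_nhds hz)).differentiableAt (by simp)
  have h1 : matD i (matDbar j fun w => P (φ w)) z = ∑ b, starRingEnd ℂ (jac φ z j b) •
      ∑ a, jac φ z i a • matD a (matDbar b P) (φ z) := by
    ext k l
    simp only [Matrix.sum_apply, Matrix.smul_apply, smul_eq_mul]
    exact dWirt_dbarWirt_comp_holomorphic hU hz hφ (u := fun w => P w k l)
      (fun w hw => hP w hw k l) i j
  have h2 : matD i (fun w => P (φ w)) z = ∑ a, jac φ z i a • matD a P (φ z) := by
    ext k l
    simp only [Matrix.sum_apply, Matrix.smul_apply, smul_eq_mul]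
    exact dWirt_comp_holomorphic (F := fun w => P w k l)
      ((hP z hz k l).differentiableAt (by norm_num)) hφd i
  have h3 : matDbar j (fun w => P (φ w)) z =
      ∑ b, starRingEnd ℂ (jac φ z j b) • matDbar b P (φ z) := by
    ext k l
    simp only [Matrix.sum_apply, Matrix.smul_apply, smul_eq_mul]
    exact dbarWirt_comp_holomorphic (F := fun w => P w k l)
      ((hP z hz k l).differentiableAt (by norm_num)) hφd j
  rw [localCurv, h1, h2, h3]
  simp only [localCurv, Finset.mul_sum, Finset.sum_mul, smul_add, Finset.sum_add_distrib,
    Finset.smul_sum, smul_neg, Finset.sum_neg_distrib, Matrix.smul_mul, Matrix.mul_smul]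

/-- The Chern scalar curvature does not depend on the holomorphic coordinates. -/
theorem localScalar_eq_of_change (hU : IsOpen U) (hz : z ∈ U) (hφ : ContDiffOn ℂ ω φ U)
    (hP : ∀ w ∈ U, ∀ k l, ContDiffAt ℝ 2 (fun w => P w k l) (φ w))
    (hJ : (jac φ z).det ≠ 0) (hPdet : (P (φ z)).det ≠ 0)
    (hG : ∀ w ∈ U, G w = jac φ w * P (φ w) * (jac φ w).conjTranspose) :
    localScalar G z = localScalar P (φ z) := by
  have hG' : G =ᶠ[𝓝 z] fun w => jac φ w * P (φ w) * (jac φ w).conjTranspose := by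
    filter_upwards [hU.mem_nhds hz] with w hw using hG w hw
  have hφr : ContDiffOn ℝ 2 φ U := (hφ.restrict_scalars ℝ).of_le (by exact le_top)
  have h1 : ∀ i j, ((G z)⁻¹ * localCurv G i j z).trace =
      ((P (φ z))⁻¹ * localCurv (fun w => P (φ w)) i j z).trace := by
    intro i j
    rw [localCurv_congr hG', localCurv_congruence hU hz _ (contDiffOn_jac hU hφ) hJ hPdet,
      hG z hz, trace_congruence_inv hJ]
    intro k l w hw
    exact ((hP w hw k l).comp w (hφr.contDiffAt (hU.mem_nhds hw))).contDiffWithinAt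
  have h2 : (Matrix.of fun i j => ((G z)⁻¹ * localCurv G i j z).trace) =
      jac φ z * (Matrix.of fun a b => ((P (φ z))⁻¹ * localCurv P a b (φ z)).trace) *
        (jac φ z).conjTranspose := by
    ext i j
    rw [matrix_congruence_apply]
    simp only [Matrix.of_apply, h1, localCurv_comp_holomorphic hU hz hφ hP, Finset.mul_sum,
      Matrix.mul_smul, Matrix.trace_sum, Matrix.trace_smul, smul_eq_mul]
  rw [localScalar, h2, hG z hz, trace_congruence_inv hJ, localScalar]

/-- The complex Laplacian does not depend on the holomorphic coordinates. -/
theorem localLap_eq_of_change (hU : IsOpen U) (hz : z ∈ U) (hφ : ContDiffOn ℂ ω φ U)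
    {u : (Fin n → ℂ) → ℂ} (hu : ∀ w ∈ U, ContDiffAt ℝ 2 u (φ w)) (hJ : (jac φ z).det ≠ 0)
    (hG : G z = jac φ z * P (φ z) * (jac φ z).conjTranspose) :
    localLap G (fun w => u (φ w)) z = localLap P u (φ z) := by
  have h2 : (Matrix.of fun i j => dWirt i (dbarWirt j fun w => u (φ w)) z) =
      jac φ z * (Matrix.of fun a b => dWirt a (dbarWirt b u) (φ z)) *
        (jac φ z).conjTranspose := by
    ext i j
    rw [matrix_congruence_apply]
    exact dWirt_dbarWirt_comp_holomorphic hU hz hφ hu i j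
  rw [localLap, h2, hG, trace_congruence_inv hJ, localLap]

theorem localLap_congr {u v : (Fin n → ℂ) → ℂ} (h : u =ᶠ[𝓝 z] v) :
    localLap G u z = localLap G v z := by
  simp only [localLap, dWirt_congr (eventuallyEq_dbarWirt h _)]

/-- Conformal change of the curvature: `Θ̃_{i j̄ k l̄} = e^u (Θ_{i j̄ k l̄} - u_{i j̄} g_{k l̄})`. -/
theorem localCurv_conformal {u : (Fin n → ℂ) → ℝ} (hu : ContDiffAt ℝ 2 u z)
    (hG : ∀ k l, ContDiffAt ℝ 2 (fun w => G w k l) z) (hdet : (G z).det ≠ 0) (i j : Fin n) :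
    localCurv (fun w => ((Real.exp (u w) : ℝ) : ℂ) • G w) i j z =
      ((Real.exp (u z) : ℝ) : ℂ) •
        (localCurv G i j z - dWirt i (dbarWirt j fun w => (u w : ℂ)) z • G z) := by
  have h2 : (2 : ℕ∞ω) ≠ 0 := by norm_num
  set E : (Fin n → ℂ) → ℂ := fun w => ((Real.exp (u w) : ℝ) : ℂ) with hE
  have huc : ContDiffAt ℝ 2 (fun w => (u w : ℂ)) z :=
    Complex.ofRealCLM.contDiff.contDiffAt.comp z hu
  have hEc : ContDiffAt ℝ 2 E z := Complex.ofRealCLM.contDiff.contDiffAt.comp z hu.exp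
  have hEd := hEc.differentiableAt h2
  have hud : ∀ᶠ w in 𝓝 z, ContDiffAt ℝ 2 u w := hu.eventually (by norm_num)
  have hEi : dWirt i E z = E z * dWirt i (fun w => (u w : ℂ)) z :=
    dWirt_comp_real (Real.hasDerivAt_exp _) (hu.differentiableAt h2) i
  have hEj : ∀ᶠ w in 𝓝 z, dbarWirt j E w = E w * dbarWirt j (fun w => (u w : ℂ)) w :=
    hud.mono fun w hw =>
      dbarWirt_comp_real (Real.hasDerivAt_exp _) (hw.differentiableAt h2) j
  have hGe : ∀ᶠ w in 𝓝 z, ∀ k l, ContDiffAt ℝ 2 (fun w => G w k l) w := by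
    simp only [Filter.eventually_all]
    exact fun k l => (hG k l).eventually (by norm_num)
  have huj : DifferentiableAt ℝ (dbarWirt j fun w => (u w : ℂ)) z :=
    (huc.dbarWirt (m := 1) (by norm_num) j).differentiableAt (by norm_num)
  have e1 : matD i (fun w => E w • G w) z =
      E z • (dWirt i (fun w => (u w : ℂ)) z • G z + matD i G z) := by
    ext k l
    change dWirt i (fun w => E w * G w k l) z = E z * (_ * G z k l + dWirt i (fun w => G w k l) z)
    rw [dWirt_mul hEd ((hG k l).differentiableAt h2), hEi]; ring
  have e2 : ∀ᶠ w in 𝓝 z, matDbar j (fun w => E w • G w) w =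
      E w • (dbarWirt j (fun w => (u w : ℂ)) w • G w + matDbar j G w) := by
    filter_upwards [hEj, hud, hGe] with w h3 h4 h5
    ext k l
    change dbarWirt j (fun w => E w * G w k l) w =
      E w * (_ * G w k l + dbarWirt j (fun w => G w k l) w)
    have h6 : DifferentiableAt ℝ E w :=
      (Complex.ofRealCLM.contDiff.contDiffAt.comp w h4.exp).differentiableAt h2
    rw [dbarWirt_mul h6 ((h5 k l).differentiableAt h2), h3]
    ring
  have e3 : matD i (matDbar j (fun w => E w • G w)) z =
      E z • (dWirt i (fun w => (u w : ℂ)) z • (dbarWirt j (fun w => (u w : ℂ)) z • G z +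
        matDbar j G z) + dWirt i (dbarWirt j fun w => (u w : ℂ)) z • G z +
        dbarWirt j (fun w => (u w : ℂ)) z • matD i G z + matD i (matDbar j G) z) := by
    rw [matD_congr e2]
    ext k l
    change dWirt i (fun w => E w * (dbarWirt j (fun w => (u w : ℂ)) w * G w k l +
      dbarWirt j (fun w => G w k l) w)) z = E z * (_ * (_ * G z k l +
      dbarWirt j (fun w => G w k l) z) + _ * G z k l + _ * dWirt i (fun w => G w k l) z +
      dWirt i (dbarWirt j fun w => G w k l) z)
    have d1 := (hG k l).differentiableAt h2
    have d2 : DifferentiableAt ℝ (dbarWirt j fun w => G w k l) z :=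
      ((hG k l).dbarWirt (m := 1) (by norm_num) j).differentiableAt (by norm_num)
    rw [dWirt_mul hEd ((huj.fun_mul d1).fun_add d2), dWirt_add (huj.fun_mul d1) d2, dWirt_mul huj d1, hEi]
    ring
  have hE0 : E z ≠ 0 := Complex.ofReal_ne_zero.2 (Real.exp_ne_zero _)
  have c3 : G z * (G z)⁻¹ = 1 := Matrix.mul_nonsing_inv _ (isUnit_iff_ne_zero.2 hdet)
  have c4 : (G z)⁻¹ * G z = 1 := Matrix.nonsing_inv_mul _ (isUnit_iff_ne_zero.2 hdet)
  have hinv : (E z • G z)⁻¹ = (E z)⁻¹ • (G z)⁻¹ := by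
    refine Matrix.inv_eq_left_inv ?_
    rw [Matrix.smul_mul, Matrix.mul_smul, smul_smul, inv_mul_cancel₀ hE0, one_smul, c4]
  rw [localCurv, localCurv, e3, e1, e2.self_of_nhds, hinv]
  generalize matD i (matDbar j G) z = Gij
  generalize matD i G z = Gi
  generalize matDbar j G z = Gj
  generalize dWirt i (dbarWirt j fun w => (u w : ℂ)) z = uij
  generalize dWirt i (fun w => (u w : ℂ)) z = ui
  generalize dbarWirt j (fun w => (u w : ℂ)) z = uj
  have key : (E z • (ui • G z + Gi)) * ((E z)⁻¹ • (G z)⁻¹) * (E z • (uj • G z + Gj)) =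
      E z • (ui • uj • G z + ui • Gj + uj • Gi + Gi * (G z)⁻¹ * Gj) := by
    simp only [Matrix.smul_mul, Matrix.mul_smul, smul_smul]
    rw [inv_mul_cancel₀ hE0, mul_one]
    congr 1
    simp only [add_mul, mul_add, Matrix.smul_mul, Matrix.mul_smul, c3, one_mul]
    rw [Matrix.mul_assoc Gi, c4, mul_one]
    simp only [smul_smul, add_assoc]
    rw [mul_comm uj ui]; abel
  rw [key, show ((Real.exp (u z) : ℝ) : ℂ) = E z from rfl]
  module

/-- Conformal change of the Chern scalar curvature: `s̃ = e^{-u} (s - n Δu)`. -/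
theorem localScalar_conformal {u : (Fin n → ℂ) → ℝ} (hu : ContDiffAt ℝ 2 u z)
    (hG : ∀ k l, ContDiffAt ℝ 2 (fun w => G w k l) z) (hdet : (G z).det ≠ 0) :
    localScalar (fun w => ((Real.exp (u w) : ℝ) : ℂ) • G w) z =
      ((Real.exp (-u z) : ℝ) : ℂ) * (localScalar G z - n * localLap G (fun w => (u w : ℂ)) z) := by
  set E : ℂ := ((Real.exp (u z) : ℝ) : ℂ) with hE
  have hE0 : E ≠ 0 := Complex.ofReal_ne_zero.2 (Real.exp_ne_zero _)
  have c4 : (G z)⁻¹ * G z = 1 := Matrix.nonsing_inv_mul _ (isUnit_iff_ne_zero.2 hdet)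
  have hinv : (E • G z)⁻¹ = E⁻¹ • (G z)⁻¹ := by
    refine Matrix.inv_eq_left_inv ?_
    rw [Matrix.smul_mul, Matrix.mul_smul, smul_smul, inv_mul_cancel₀ hE0, one_smul, c4]
  have hEneg : ((Real.exp (-u z) : ℝ) : ℂ) = E⁻¹ := by rw [Real.exp_neg, Complex.ofReal_inv]
  have h1 : (Matrix.of fun i j => ((E • G z)⁻¹ *
      localCurv (fun w => ((Real.exp (u w) : ℝ) : ℂ) • G w) i j z).trace) =
      (Matrix.of fun i j => ((G z)⁻¹ * localCurv G i j z).trace) -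
        (n : ℂ) • Matrix.of fun i j => dWirt i (dbarWirt j fun w => (u w : ℂ)) z := by
    ext i j
    simp only [Matrix.of_apply, Matrix.sub_apply, Matrix.smul_apply, smul_eq_mul]
    rw [localCurv_conformal hu hG hdet, hinv, Matrix.smul_mul, Matrix.mul_smul, smul_smul,
      inv_mul_cancel₀ hE0, one_smul, mul_sub, Matrix.mul_smul, c4, Matrix.trace_sub,
      Matrix.trace_smul, Matrix.trace_one, Fintype.card_fin, smul_eq_mul, mul_comm]
  rw [localScalar, h1, hinv, hEneg, Matrix.smul_mul, mul_sub, Matrix.mul_smul, Matrix.trace_smul,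
    Matrix.trace_sub, Matrix.trace_smul, smul_eq_mul, smul_eq_mul, localScalar, localLap]

end Local

/-! ### Powers of the fundamental form -/

section Forms

theorem add_pow_of_sq_eq_zero {R : Type*} [CommRing R] (a : R) {x : R} (hx : x * x = 0) (m : ℕ) :
    (a + x) ^ (m + 1) = a ^ (m + 1) + (m + 1 : ℕ) * (x * a ^ m) := by
  induction m with
  | zero => simp
  | succ m ih =>
    rw [pow_succ, ih]
    push_cast
    linear_combination ((m : R) + 1) * a ^ m * hx

/-- A sum of `m` commuting elements with square zero has `m`-th power `m!` times their product, and
the next power vanishes. -/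
theorem sum_pow_card_of_sq_eq_zero {R ι : Type*} [CommRing R] [DecidableEq ι] (s : Finset ι)
    (x : ι → R) (hx : ∀ k, x k * x k = 0) :
    (∑ k ∈ s, x k) ^ s.card = (s.card.factorial : R) * ∏ k ∈ s, x k ∧
      (∑ k ∈ s, x k) ^ (s.card + 1) = 0 := by
  induction s using Finset.induction_on with
  | empty => simp
  | insert k s hk ih =>
    rw [Finset.sum_insert hk, Finset.card_insert_of_notMem hk, Finset.prod_insert hk, add_comm,
      add_pow_of_sq_eq_zero _ (hx k), add_pow_of_sq_eq_zero _ (hx k), pow_succ _ (s.card + 1),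
      ih.2, ih.1, Nat.factorial_succ]
    constructor
    · push_cast; ring
    · simp

variable {n : ℕ}

theorem det_add_single (G : Matrix (Fin n) (Fin n) ℂ) (i j : Fin n) :
    (G + Matrix.single i j 1).det = G.det + G.adjugate j i := by
  have h : G + Matrix.single i j 1 = G.updateRow i (G i + Pi.single j 1) := by
    ext a b
    rw [Matrix.add_apply, Matrix.updateRow_apply, Matrix.single_apply]
    by_cases ha : a = i
    · subst ha
      simp [Pi.single_apply, eq_comm]
    · simp [ha, Ne.symm ha]
  rw [h, Matrix.det_updateRow_add, Matrix.updateRow_eq_self, Matrix.adjugate_apply]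

section Abstract

variable {R : Type*} [CommRing R] [Algebra ℂ R] {η : Fin n → Fin n → R}
  (hη : ∀ k l k' l', η k l * η k' l' = -(η k l' * η k' l))

include hη in
theorem mul_eq_zero_of_swap (k k' l : Fin n) : η k l * η k' l = 0 := by
  have h : (2 : ℂ) • (η k l * η k' l) = 0 := by
    rw [two_smul]
    nth_rewrite 1 [hη]
    exact neg_add_cancel _
  simpa using h

include hη in
theorem mul_eq_zero_of_swap' (k l l' : Fin n) : η k l * η k l' = 0 := by
  have h : (2 : ℂ) • (η k l * η k l') = 0 := by
    rw [two_smul]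
    nth_rewrite 1 [hη]
    rw [mul_comm (η k l')]
    exact neg_add_cancel _
  simpa using h

include hη in
/-- Elements `η k l` of a commutative ring which are antisymmetric in the second indices behave like
`dzᵏ ∧ dz̄ˡ`: the product of the rows of `∑ G k l • η k l` is the determinant of `G`. -/
theorem prod_sum_eq_det_smul (G : Matrix (Fin n) (Fin n) ℂ) :
    ∏ k, ∑ l, G k l • η k l = G.det • ∏ k, η k k := by
  -- as a function of the rows of `G`, the product is multilinear and alternating
  let L : (k : Fin n) → (Fin n → ℂ) →ₗ[ℂ] R := fun k => Fintype.linearCombination ℂ (η k)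
  let m : MultilinearMap ℂ (fun _ : Fin n => Fin n → ℂ) R :=
    (MultilinearMap.mkPiAlgebra ℂ (Fin n) R).compLinearMap L
  have hm : ∀ v, m v = ∏ k, ∑ l, v k l • η k l := fun v => by
    simp [m, L, Fintype.linearCombination_apply]
  let f : (Fin n → ℂ) [⋀^Fin n]→ₗ[ℂ] R :=
    { m with
      map_eq_zero_of_eq' := by
        intro v k k' hv hkk
        change m v = 0
        rw [hm, ← Finset.mul_prod_erase _ _ (Finset.mem_univ k),
          ← Finset.mul_prod_erase _ _ (Finset.mem_erase.2 ⟨hkk.symm, Finset.mem_univ k'⟩),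
          ← mul_assoc]
        refine mul_eq_zero_of_left ?_ _
        rw [hv]
        have h2 : ∀ l l', v k' l • η k l * v k' l' • η k' l' =
            -(v k' l' • η k l' * v k' l • η k' l) := fun l l' => by
          rw [smul_mul_smul_comm, smul_mul_smul_comm, hη k l k' l', smul_neg, mul_comm (v k' l)]
        have h3 : (∑ l, v k' l • η k l) * ∑ l, v k' l • η k' l =
            -((∑ l, v k' l • η k l) * ∑ l, v k' l • η k' l) := by
          rw [Finset.sum_mul_sum]
          nth_rewrite 2 [Finset.sum_comm]
          simp only [← Finset.sum_neg_distrib]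
          exact Finset.sum_congr rfl fun l _ => Finset.sum_congr rfl fun l' _ => h2 l l'
        have h4 : (2 : ℂ) • ((∑ l, v k' l • η k l) * ∑ l, v k' l • η k' l) = 0 := by
          rw [two_smul]
          nth_rewrite 1 [h3]
          exact neg_add_cancel _
        simpa using h4 }
  let b := Pi.basisFun ℂ (Fin n)
  have hf : f = (LinearMap.toSpanSingleton ℂ R (f b)).compAlternatingMap b.det := by
    refine b.ext_alternating fun v hv => ?_
    obtain ⟨σ, hσ⟩ : ∃ σ : Equiv.Perm (Fin n), ⇑σ = v :=
      ⟨Equiv.ofBijective v (Finite.injective_iff_bijective.1 hv), rfl⟩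
    subst hσ
    change f (b ∘ σ) = (LinearMap.toSpanSingleton ℂ R (f b)) (b.det (b ∘ σ))
    rw [f.map_perm, b.det.map_perm, b.det_self]
    simp [Units.smul_def, Int.cast_smul_eq_zsmul]
  have h1 : f (fun k => G k) = b.det (fun k => G k) • f b := by
    conv_lhs => rw [hf]
    simp
  have h2 : f b = ∏ k, η k k := by
    change m b = _
    rw [hm]
    simp [b, Pi.single_apply]
  rw [← hm (fun k => G k), ← h2]
  exact h1.trans (by rw [Pi.basisFun_det_apply]; rfl)

include hη in
/-- The formula `ω^n = n! det G ∏ₖ dzᵏ ∧ dz̄ᵏ`, abstractly. -/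
theorem sum_pow_eq_det_smul (G : Matrix (Fin n) (Fin n) ℂ) :
    (∑ k, ∑ l, G k l • η k l) ^ n = (n.factorial : ℂ) • G.det • ∏ k, η k k := by
  have h := (sum_pow_card_of_sq_eq_zero Finset.univ (fun k => ∑ l, G k l • η k l) fun k => by
    rw [Finset.sum_mul_sum]
    refine Finset.sum_eq_zero fun l _ => Finset.sum_eq_zero fun l' _ => ?_
    rw [smul_mul_smul_comm, mul_eq_zero_of_swap' hη, smul_zero]).1
  rw [Finset.card_univ, Fintype.card_fin, prod_sum_eq_det_smul hη] at h
  rw [h, Nat.cast_smul_eq_nsmul, nsmul_eq_mul]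

include hη in
/-- The cofactors of `G` are the coefficients of the power of order `n - 1`: replacing `G` by
`G + E_{ij}` adds the cofactor to the determinant and `n η i j ω^{n-1}` to `ω^n`. -/
theorem mul_sum_pow_eq_adjugate_smul {m : ℕ} (hm : n = m + 1) (G : Matrix (Fin n) (Fin n) ℂ)
    (i j : Fin n) :
    η i j * (∑ k, ∑ l, G k l • η k l) ^ m =
      (m.factorial : ℂ) • G.adjugate j i • ∏ k, η k k := by
  subst hm
  have h1 := sum_pow_eq_det_smul hη (G + Matrix.single i j 1)
  have h2 : ∑ k, ∑ l, (G + Matrix.single i j (1 : ℂ)) k l • η k l =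
      (∑ k, ∑ l, G k l • η k l) + η i j := by
    simp only [Matrix.add_apply, add_smul, Finset.sum_add_distrib, Matrix.single_apply, ite_smul,
      one_smul, zero_smul, ite_and]
    simp
  have h3 := add_pow_of_sq_eq_zero (∑ k, ∑ l, G k l • η k l) (mul_eq_zero_of_swap hη i i j) m
  rw [h2, det_add_single, h3, sum_pow_eq_det_smul hη G, add_smul, smul_add] at h1
  have h4 := add_left_cancel h1
  have h5 : ((m + 1 : ℕ) : ℂ) ≠ 0 := by exact_mod_cast m.succ_ne_zero
  rw [Nat.factorial_succ, Nat.cast_mul, mul_smul] at h4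
  refine smul_right_injective R h5 ?_
  simp only
  rw [← h4, Nat.cast_smul_eq_nsmul, nsmul_eq_mul]

end Abstract

/-! ### The covector algebra -/

theorem ι_mul_ι_mem_center {V : Type*} [AddCommGroup V] [Module ℂ V] (v w : V) :
    ExteriorAlgebra.ι ℂ v * ExteriorAlgebra.ι ℂ w ∈
      Subalgebra.center ℂ (ExteriorAlgebra ℂ V) := by
  have anti : ∀ x y : V, ExteriorAlgebra.ι ℂ x * ExteriorAlgebra.ι ℂ y =
      -(ExteriorAlgebra.ι ℂ y * ExteriorAlgebra.ι ℂ x) := fun x y =>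
    eq_neg_of_add_eq_zero_left (ExteriorAlgebra.ι_add_mul_swap x y)
  rw [Subalgebra.mem_center_iff]
  intro b
  induction b using ExteriorAlgebra.induction with
  | algebraMap r => exact Algebra.commutes r _
  | ι x =>
    rw [← mul_assoc, anti x v, neg_mul, mul_assoc, anti x w, mul_neg, neg_neg, mul_assoc]
  | mul a b ha hb => rw [mul_assoc, hb, ← mul_assoc, ha, mul_assoc]
  | add a b ha hb => rw [add_mul, mul_add, ha, hb]

/-- The covector `dzⁱ ∧ dz̄ʲ`, as an element of the centre of the covector algebra, which is a
commutative ring, so that powers and products of such covectors can be computed as usual. -/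
def centralTwo (i j : Fin n) : Subalgebra.center ℂ (Covec n) :=
  ⟨dz i * dzbar j, ι_mul_ι_mem_center _ _⟩

/-- Interchanging `dz̄ˡ` and `dz̄ˡ'` changes the sign. -/
theorem centralTwo_swap (k l k' l' : Fin n) :
    centralTwo k l * centralTwo k' l' = -(centralTwo k l' * centralTwo k' l) := by
  have anti : ∀ x y : Fin n ⊕ₗ Fin n → ℂ, ExteriorAlgebra.ι ℂ x * ExteriorAlgebra.ι ℂ y =
      -(ExteriorAlgebra.ι ℂ y * ExteriorAlgebra.ι ℂ x) := fun x y =>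
    eq_neg_of_add_eq_zero_left (ExteriorAlgebra.ι_add_mul_swap x y)
  apply Subtype.ext
  change dz k * dzbar l * (dz k' * dzbar l') = -(dz k * dzbar l' * (dz k' * dzbar l))
  have h1 := Subalgebra.mem_center_iff.1 (ι_mul_ι_mem_center (Pi.single (Sum.inlₗ k') 1)
    (Pi.single (Sum.inrₗ l') 1 : Fin n ⊕ₗ Fin n → ℂ)) (dzbar l)
  change dzbar l * (dz k' * dzbar l') = dz k' * dzbar l' * dzbar l at h1
  have h2 : dz k' * dzbar l' = -(dzbar l' * dz k' : Covec n) := anti _ _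
  rw [mul_assoc, h1, h2]
  simp only [neg_mul, mul_neg, mul_assoc]

/-- The covector `∏ₖ dzᵏ ∧ dz̄ᵏ` of top degree. -/
def topCovec (n : ℕ) : Covec n := ((∏ k, centralTwo k k : Subalgebra.center ℂ (Covec n)) : Covec n)

open CliffordAlgebra in
/-- A product of distinct `dzᵏ ∧ dz̄ᵏ` does not vanish: contracting the factor of one index with the
dual vectors of `dzᵏ` and `dz̄ᵏ` leaves the product of the others. The second part, needed for the
induction, says that contraction with other dual vectors gives zero. -/
theorem prod_centralTwo_ne_zero (s : Finset (Fin n)) :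
    ((∏ k ∈ s, centralTwo k k : Subalgebra.center ℂ (Covec n)) : Covec n) ≠ 0 ∧
    ∀ d : Module.Dual ℂ (Fin n ⊕ₗ Fin n → ℂ),
      (∀ k ∈ s, d (Pi.single (Sum.inlₗ k) 1) = 0 ∧ d (Pi.single (Sum.inrₗ k) 1) = 0) →
      contractLeft (Q := (0 : QuadraticForm ℂ (Fin n ⊕ₗ Fin n → ℂ))) d
        ((∏ k ∈ s, centralTwo k k : Subalgebra.center ℂ (Covec n)) : Covec n) = 0 := by
  have step : ∀ (d : Module.Dual ℂ (Fin n ⊕ₗ Fin n → ℂ)) (a b : Fin n ⊕ₗ Fin n → ℂ)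
      (x : Covec n), contractLeft (Q := (0 : QuadraticForm ℂ (Fin n ⊕ₗ Fin n → ℂ))) d
        (ExteriorAlgebra.ι ℂ a * ExteriorAlgebra.ι ℂ b * x) =
      d a • (ExteriorAlgebra.ι ℂ b * x) - ExteriorAlgebra.ι ℂ a * (d b • x -
        ExteriorAlgebra.ι ℂ b *
          contractLeft (Q := (0 : QuadraticForm ℂ (Fin n ⊕ₗ Fin n → ℂ))) d x) := by
    intro d a b x
    rw [mul_assoc]
    refine (contractLeft_ι_mul (Q := (0 : QuadraticForm ℂ (Fin n ⊕ₗ Fin n → ℂ))) (d := d) a _).trans ?_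
    congr 2
    exact contractLeft_ι_mul (Q := (0 : QuadraticForm ℂ (Fin n ⊕ₗ Fin n → ℂ))) (d := d) b x
  induction s using Finset.induction_on with
  | empty =>
    refine ⟨by simp, fun d _ => ?_⟩
    simp
  | insert k s hk ih =>
    rw [Finset.prod_insert hk]
    change (dz k * dzbar k * _ ≠ (0 : Covec n)) ∧ _
    set x : Covec n := ((∏ k ∈ s, centralTwo k k : Subalgebra.center ℂ (Covec n)) : Covec n)
    constructor
    · intro h0
      have hs : ∀ j ∈ s, j ≠ k := fun j hj hjk => hk (hjk ▸ hj)
      have e1 := step (LinearMap.proj (Sum.inlₗ k)) (Pi.single (Sum.inlₗ k) 1)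
        (Pi.single (Sum.inrₗ k) 1) x
      have e2 : contractLeft (Q := (0 : QuadraticForm ℂ (Fin n ⊕ₗ Fin n → ℂ)))
          (LinearMap.proj (Sum.inlₗ k)) x = 0 := by
        refine ih.2 _ fun j hj => ?_
        simp [(hs j hj).symm]
      have e3 : contractLeft (Q := (0 : QuadraticForm ℂ (Fin n ⊕ₗ Fin n → ℂ)))
          (LinearMap.proj (Sum.inrₗ k)) x = 0 := by
        refine ih.2 _ fun j hj => ?_
        simp [(hs j hj).symm]
      change contractLeft (Q := (0 : QuadraticForm ℂ (Fin n ⊕ₗ Fin n → ℂ))) _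
        (dz k * dzbar k * x) = _ at e1
      rw [h0, map_zero, e2] at e1
      have e4 : (0 : Covec n) = ExteriorAlgebra.ι ℂ (Pi.single (Sum.inrₗ k) 1) * x := by
        simpa [Pi.single_apply] using e1
      have e5 := congrArg (contractLeft (Q := (0 : QuadraticForm ℂ (Fin n ⊕ₗ Fin n → ℂ)))
        (LinearMap.proj (Sum.inrₗ k))) e4
      rw [map_zero] at e5
      have e6 := e5.trans (contractLeft_ι_mul (Q := (0 : QuadraticForm ℂ (Fin n ⊕ₗ Fin n → ℂ)))
        (d := LinearMap.proj (Sum.inrₗ k)) (Pi.single (Sum.inrₗ k) 1) x)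
      rw [e3] at e6
      exact ih.1 (by simpa using e6.symm)
    · intro d hd
      have e1 := step d (Pi.single (Sum.inlₗ k) 1) (Pi.single (Sum.inrₗ k) 1) x
      have e2 := ih.2 d fun j hj => hd j (Finset.mem_insert_of_mem hj)
      have e3 := hd k (Finset.mem_insert_self _ _)
      rw [e3.1, e3.2, e2] at e1
      refine e1.trans (by simp)

theorem topCovec_ne_zero : topCovec n ≠ 0 := (prod_centralTwo_ne_zero Finset.univ).1

end Forms

/-! ### Coefficientwise derivatives of forms -/

section FormCalculus

variable {n : ℕ}

/-- The coefficientwise derivative `∂α/∂zⁱ` of a differential form. -/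
def coefD (i : Fin n) (α : (Fin n → ℂ) → Covec n) (z : Fin n → ℂ) : Covec n :=
  ∑ S, dWirt i (fun w => (covecBasis n).repr (α w) S) z • covecBasis n S

/-- The coefficientwise derivative `∂α/∂z̄ⁱ` of a differential form. -/
def coefDbar (i : Fin n) (α : (Fin n → ℂ) → Covec n) (z : Fin n → ℂ) : Covec n :=
  ∑ S, dbarWirt i (fun w => (covecBasis n).repr (α w) S) z • covecBasis n S

/-- A differential form is of class `C^m` at a point if all its coefficients are. -/
def CoefContDiffAt (m : ℕ∞ω) (α : (Fin n → ℂ) → Covec n) (z : Fin n → ℂ) : Prop :=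
  ∀ S, ContDiffAt ℝ m (fun w => (covecBasis n).repr (α w) S) z

variable {α β : (Fin n → ℂ) → Covec n} {z : Fin n → ℂ} {m : ℕ∞ω}

theorem repr_sum_smul (c : Finset (Fin n ⊕ₗ Fin n) → ℂ) (S : Finset (Fin n ⊕ₗ Fin n)) :
    (covecBasis n).repr (∑ S, c S • covecBasis n S) S = c S := by
  have := congrFun ((covecBasis n).equivFun.apply_symm_apply c) S
  rwa [Module.Basis.equivFun_symm_apply, Module.Basis.equivFun_apply] at this

theorem repr_linearMap (L : Covec n →ₗ[ℂ] Covec n) (x : Covec n)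
    (S : Finset (Fin n ⊕ₗ Fin n)) :
    (covecBasis n).repr (L x) S =
      ∑ S', (covecBasis n).repr (L (covecBasis n S')) S * (covecBasis n).repr x S' := by
  conv_lhs => rw [← (covecBasis n).sum_repr x]
  simp only [map_sum, map_smul, Finsupp.coe_finsetSum, Finset.sum_apply, Finsupp.smul_apply,
    smul_eq_mul, mul_comm]

theorem CoefContDiffAt.linearMap (h : CoefContDiffAt m α z) (L : Covec n →ₗ[ℂ] Covec n) :
    CoefContDiffAt m (fun w => L (α w)) z := fun S => by
  rw [funext fun w => repr_linearMap L (α w) S]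
  exact ContDiffAt.sum fun S' _ => contDiffAt_const.mul (h S')

theorem CoefContDiffAt.const_smul (h : CoefContDiffAt m α z) (c : ℂ) :
    CoefContDiffAt m (fun w => c • α w) z := fun S => by
  simp only [map_smul, Finsupp.smul_apply, smul_eq_mul]
  exact contDiffAt_const.mul (h S)

theorem CoefContDiffAt.sum {ι : Type*} {s : Finset ι} {α : ι → (Fin n → ℂ) → Covec n}
    (h : ∀ a ∈ s, CoefContDiffAt m (α a) z) : CoefContDiffAt m (fun w => ∑ a ∈ s, α a w) z :=
  fun S => by
  simp only [map_sum, Finsupp.coe_finsetSum, Finset.sum_apply]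
  exact ContDiffAt.sum fun a ha => h a ha S

theorem CoefContDiffAt.smul_const {c : (Fin n → ℂ) → ℂ} (h : ContDiffAt ℝ m c z) (v : Covec n) :
    CoefContDiffAt m (fun w => c w • v) z := fun S => by
  simp only [map_smul, Finsupp.smul_apply, smul_eq_mul]
  exact h.mul contDiffAt_const

theorem CoefContDiffAt.mul (hα : CoefContDiffAt m α z) (hβ : CoefContDiffAt m β z) :
    CoefContDiffAt m (fun w => α w * β w) z := by
  have h : (fun w => α w * β w) = fun w => ∑ S, ∑ S',
      ((covecBasis n).repr (α w) S * (covecBasis n).repr (β w) S') •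
        (covecBasis n S * covecBasis n S') := by
    funext w
    conv_lhs => rw [← (covecBasis n).sum_repr (α w), ← (covecBasis n).sum_repr (β w)]
    simp only [Finset.sum_mul_sum, smul_mul_smul_comm]
  rw [h]
  exact CoefContDiffAt.sum fun S _ => CoefContDiffAt.sum fun S' _ =>
    CoefContDiffAt.smul_const ((hα S).mul (hβ S')) _

theorem CoefContDiffAt.pow (hα : CoefContDiffAt m α z) (k : ℕ) :
    CoefContDiffAt m (fun w => α w ^ k) z := by
  induction k with
  | zero => exact fun S => by simpa using contDiffAt_const
  | succ k ih => simpa only [pow_succ] using ih.mul hα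

theorem CoefContDiffAt.coefDbar {k : ℕ∞ω} (h : CoefContDiffAt k α z) (hm : m + 1 ≤ k)
    (i : Fin n) : CoefContDiffAt m (coefDbar i α) z := fun S => by
  simp only [ConformalExtremal.coefDbar, repr_sum_smul]
  exact (h S).dbarWirt hm i

theorem coefD_congr (h : α =ᶠ[𝓝 z] β) (i : Fin n) : coefD i α z = coefD i β z :=
  Finset.sum_congr rfl fun S _ => congrArg (· • covecBasis n S)
    (dWirt_congr (h.fun_comp fun x => (covecBasis n).repr x S) i)

theorem coefD_linearMap (h : CoefContDiffAt 1 α z) (L : Covec n →ₗ[ℂ] Covec n) (i : Fin n) :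
    coefD i (fun w => L (α w)) z = L (coefD i α z) := by
  have hd := fun S => (h S).differentiableAt one_ne_zero
  refine (covecBasis n).ext_elem fun S => ?_
  rw [repr_linearMap L, coefD, coefD]
  rw [repr_sum_smul, funext fun w => repr_linearMap L (α w) S]
  simp only [repr_sum_smul]
  rw [dWirt_sum _ fun S' _ => (differentiableAt_const _).fun_mul (hd S')]
  exact Finset.sum_congr rfl fun S' _ => dWirt_const_mul _ (hd S') i

theorem coefDbar_linearMap (h : CoefContDiffAt 1 α z) (L : Covec n →ₗ[ℂ] Covec n) (i : Fin n) :
    coefDbar i (fun w => L (α w)) z = L (coefDbar i α z) := by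
  have hd := fun S => (h S).differentiableAt one_ne_zero
  refine (covecBasis n).ext_elem fun S => ?_
  rw [repr_linearMap L, coefDbar, coefDbar]
  rw [repr_sum_smul, funext fun w => repr_linearMap L (α w) S]
  simp only [repr_sum_smul]
  rw [dbarWirt_sum _ fun S' _ => (differentiableAt_const _).fun_mul (hd S')]
  exact Finset.sum_congr rfl fun S' _ => dbarWirt_const_mul _ (hd S') i

theorem coefD_sum {ι : Type*} {s : Finset ι} {α : ι → (Fin n → ℂ) → Covec n}
    (h : ∀ a ∈ s, CoefContDiffAt 1 (α a) z) (i : Fin n) :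
    coefD i (fun w => ∑ a ∈ s, α a w) z = ∑ a ∈ s, coefD i (α a) z := by
  have hd := fun a ha S => (h a ha S).differentiableAt one_ne_zero
  simp only [coefD, map_sum, Finsupp.coe_finsetSum, Finset.sum_apply]
  rw [Finset.sum_comm]
  refine Finset.sum_congr rfl fun S _ => ?_
  rw [dWirt_sum _ fun a ha => hd a ha S, Finset.sum_smul]

theorem coefD_smul_const {c : (Fin n → ℂ) → ℂ} (h : DifferentiableAt ℝ c z) (v : Covec n)
    (i : Fin n) : coefD i (fun w => c w • v) z = dWirt i c z • v := by
  conv_rhs => rw [← (covecBasis n).sum_repr v]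
  rw [coefD, Finset.smul_sum]
  refine Finset.sum_congr rfl fun S _ => ?_
  simp only [map_smul, Finsupp.smul_apply, smul_eq_mul]
  rw [dWirt_mul h (by fun_prop), dWirt_const, mul_zero, add_zero, mul_smul]

theorem coefDbar_smul_const {c : (Fin n → ℂ) → ℂ} (h : DifferentiableAt ℝ c z) (v : Covec n)
    (i : Fin n) : coefDbar i (fun w => c w • v) z = dbarWirt i c z • v := by
  conv_rhs => rw [← (covecBasis n).sum_repr v]
  rw [coefDbar, Finset.smul_sum]
  refine Finset.sum_congr rfl fun S _ => ?_
  simp only [map_smul, Finsupp.smul_apply, smul_eq_mul]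
  rw [dbarWirt_mul h (by fun_prop), dbarWirt_const, mul_zero, add_zero, mul_smul]

theorem delForm_delbarForm (h : CoefContDiffAt 2 α z) :
    delForm (delbarForm α) z = ∑ i, ∑ j, dz i * dzbar j * coefD i (coefDbar j α) z := by
  have h1 : ∀ j, CoefContDiffAt 1 (coefDbar j α) z := fun j => h.coefDbar (by norm_num) j
  change ∑ i, dz i * coefD i (fun w => ∑ j, dzbar j * coefDbar j α w) z = _
  refine Finset.sum_congr rfl fun i _ => ?_
  rw [coefD_sum (α := fun j w => dzbar j * coefDbar j α w)
    fun j _ => (h1 j).linearMap (LinearMap.mulLeft ℂ (dzbar j)), Finset.mul_sum]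
  refine Finset.sum_congr rfl fun j _ => ?_
  rw [mul_assoc]
  exact congrArg _ (coefD_linearMap (h1 j) (LinearMap.mulLeft ℂ (dzbar j)) i)

/-- For the metric with coefficients `G` one has
`∂∂̄ ω^{n-1} = √-1^{n-1} (n-1)! (∑ ∂²(det G · G^{i j̄})/∂zⁱ∂z̄ʲ) ∏ₖ dzᵏ ∧ dz̄ᵏ`; the adjugate of `G`
stands for `det G · G⁻¹`. -/
theorem delForm_delbarForm_fundForm_pow (hn : 1 ≤ n)
    {G : (Fin n → ℂ) → Matrix (Fin n) (Fin n) ℂ}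
    (hG : ∀ k l, ContDiffAt ℝ 2 (fun w => G w k l) z) :
    delForm (delbarForm fun w =>
      (Complex.I • ∑ i, ∑ j, G w i j • (dz i * dzbar j : Covec n)) ^ (n - 1)) z =
      (Complex.I ^ (n - 1) * ((n - 1).factorial : ℂ) *
        ∑ i, ∑ j, dWirt i (dbarWirt j fun w => (G w).adjugate j i) z) • topCovec n := by
  set α : (Fin n → ℂ) → Covec n := fun w =>
    (Complex.I • ∑ i, ∑ j, G w i j • (dz i * dzbar j : Covec n)) ^ (n - 1) with hα
  have hαc : CoefContDiffAt 2 α z := by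
    refine CoefContDiffAt.pow (CoefContDiffAt.const_smul ?_ _) _
    exact CoefContDiffAt.sum fun i _ => CoefContDiffAt.sum fun j _ =>
      CoefContDiffAt.smul_const (hG i j) _
  have hαe : ∀ᶠ w in 𝓝 z, CoefContDiffAt 2 α w := by
    simp only [CoefContDiffAt, Filter.eventually_all]
    exact fun S => (hαc S).eventually (by norm_num)
  have hGe : ∀ᶠ w in 𝓝 z, ∀ k l, ContDiffAt ℝ 2 (fun w => G w k l) w := by
    simp only [Filter.eventually_all]
    exact fun k l => (hG k l).eventually (by norm_num)
  obtain ⟨c, hc⟩ : ∃ c, c = Complex.I ^ (n - 1) * ((n - 1).factorial : ℂ) := ⟨_, rfl⟩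
  have hmul : ∀ i j w, dz i * dzbar j * α w = (c * (G w).adjugate j i) • topCovec n := by
    intro i j w
    have h1 := congrArg (Subtype.val) (mul_sum_pow_eq_adjugate_smul
      (centralTwo_swap (n := n)) (m := n - 1) (by omega) (G w) i j)
    have h2 : ((∑ k, ∑ l, G w k l • centralTwo k l : Subalgebra.center ℂ (Covec n)) : Covec n) =
        ∑ i, ∑ j, G w i j • (dz i * dzbar j : Covec n) := by
      simp only [AddSubmonoidClass.coe_finsetSum]
      rfl
    change dz i * dzbar j * ((∑ k, ∑ l, G w k l • centralTwo k l :
      Subalgebra.center ℂ (Covec n)) : Covec n) ^ (n - 1) =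
      ((n - 1).factorial : ℂ) • (G w).adjugate j i • topCovec n at h1
    rw [h2] at h1
    rw [hα]
    simp only [smul_pow, mul_smul_comm]
    rw [h1, hc, smul_smul, smul_smul, mul_assoc]
  rw [delForm_delbarForm hαc, ← hc, Finset.mul_sum, Finset.sum_smul]
  refine Finset.sum_congr rfl fun i _ => ?_
  rw [Finset.mul_sum, Finset.sum_smul]
  refine Finset.sum_congr rfl fun j _ => ?_
  have h1 := coefD_linearMap (hαc.coefDbar (m := 1) (by norm_num) j)
    (LinearMap.mulLeft ℂ (dz i * dzbar j)) i
  refine h1.symm.trans ?_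
  have hadj : ∀ᶠ w in 𝓝 z, ContDiffAt ℝ 2 (fun w => (G w).adjugate j i) w :=
    hGe.mono fun w hw => contDiffAt_adjugate hw j i
  have h3 : (fun w => LinearMap.mulLeft ℂ (dz i * dzbar j) (coefDbar j α w)) =ᶠ[𝓝 z]
      fun w => dbarWirt j (fun w => c * (G w).adjugate j i) w • topCovec n := by
    filter_upwards [hαe, hadj] with w hw hw2
    rw [← coefDbar_linearMap (fun S => (hw S).of_le (by norm_num))]
    simp only [LinearMap.mulLeft_apply, hmul]
    rw [coefDbar_smul_const]
    exact (hw2.differentiableAt (by norm_num)).const_mul c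
  have h4 : dbarWirt j (fun w => c * (G w).adjugate j i) =ᶠ[𝓝 z]
      fun w => c * dbarWirt j (fun w => (G w).adjugate j i) w :=
    hadj.mono fun w hw => dbarWirt_const_mul c (hw.differentiableAt (by norm_num)) j
  have h5 : DifferentiableAt ℝ (dbarWirt j fun w => (G w).adjugate j i) z :=
    (hadj.self_of_nhds.dbarWirt (m := 1) (by norm_num) j).differentiableAt one_ne_zero
  rw [coefD_congr h3, coefD_smul_const, dWirt_congr h4, dWirt_const_mul c h5]
  exact (h5.const_mul c).congr_of_eventuallyEq h4

end FormCalculus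

/-! ### Change of charts -/

theorem two_le_infty : (2 : ℕ∞ω) ≤ ∞ := WithTop.coe_le_coe.2 (le_top : (2 : ℕ∞) ≤ ⊤)

section Charts

theorem mem_transition_source {X Y : Type*} [TopologicalSpace X] [TopologicalSpace Y]
    {e e' : OpenPartialHomeomorph X Y} {z : Y} (hz : z ∈ e.target) (hz' : e.symm z ∈ e'.source) :
    z ∈ (e.symm ≫ₕ e').source := by
  rw [OpenPartialHomeomorph.trans_source]
  exact ⟨hz, hz'⟩

variable {n : ℕ} {M : Type*} [TopologicalSpace M] [ChartedSpace (Fin n → ℂ) M]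
  {e e' : OpenPartialHomeomorph M (Fin n → ℂ)} {z : Fin n → ℂ}

theorem contDiffOn_transition [IsManifold 𝓘(ℂ, Fin n → ℂ) ω M]
    (he : e ∈ atlas (Fin n → ℂ) M) (he' : e' ∈ atlas (Fin n → ℂ) M) :
    ContDiffOn ℂ ω (fun z => e' (e.symm z)) (e.symm ≫ₕ e').source := by
  have h := (contDiffGroupoid ω 𝓘(ℂ, Fin n → ℂ)).compatible he he'
  rw [contDiffGroupoid, mem_groupoid_of_pregroupoid] at h
  simpa [contDiffPregroupoid, Function.comp_def] using h.1

namespace HermitianMetric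

variable (g : HermitianMetric n M)

theorem form_congr {x y : M} (h : x = y) (v w : Fin n → ℂ) : g.form x v w = g.form y v w := by
  subst h; rfl

theorem isHermitian_coeff (e : OpenPartialHomeomorph M (Fin n → ℂ)) (z : Fin n → ℂ) :
    (g.coeff e z).IsHermitian := by
  ext i j
  exact (g.conj_symm _ _ _).symm

theorem contDiffAt_coeff (he : e ∈ atlas (Fin n → ℂ) M) (hz : z ∈ e.target) (i j : Fin n) :
    ContDiffAt ℝ ∞ (fun w => g.coeff e w i j) z :=
  (g.smooth e he i j).contDiffAt (e.open_target.mem_nhds hz)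

theorem chernScalar_eq_localScalar_chartAt (x : M) :
    g.chernScalar x =
      (localScalar (g.coeff (chartAt (Fin n → ℂ) x)) (chartAt (Fin n → ℂ) x x)).re := by
  unfold chernScalar localScalar
  congr 1
  simp only [Matrix.trace, Matrix.diag_apply, Matrix.mul_apply, Matrix.of_apply, Finset.mul_sum]
  rw [Finset.sum_comm]
  refine Finset.sum_congr rfl fun j _ => Finset.sum_congr rfl fun i _ => ?_
  rw [Finset.sum_comm]
  refine Finset.sum_congr rfl fun l _ => Finset.sum_congr rfl fun k _ => ?_
  rw [mul_assoc]
  unfold invCoeff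
  congr 2
  simp only [chernCurv, localCurv, invCoeff, Matrix.add_apply, Matrix.neg_apply, Matrix.mul_apply,
    Finset.sum_mul]
  congr 1
  refine Finset.sum_congr rfl fun p _ => Finset.sum_congr rfl fun q _ => ?_
  simp only [matD, matDbar, Matrix.of_apply]
  ring

variable [IsManifold 𝓘(ℂ, Fin n → ℂ) ω M]

theorem coordVec_change (he : e ∈ atlas (Fin n → ℂ) M) (he' : e' ∈ atlas (Fin n → ℂ) M)
    (hz : z ∈ (e.symm ≫ₕ e').source) (i : Fin n) :
    (coordVec e z i : Fin n → ℂ) =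
      ∑ a, jac (fun z => e' (e.symm z)) z i a • (coordVec e' (e' (e.symm z)) a : Fin n → ℂ) := by
  have : IsManifold 𝓘(ℂ, Fin n → ℂ) 1 M := IsManifold.of_le (n := ω) le_top
  have hz2 := hz
  rw [OpenPartialHomeomorph.trans_source] at hz2
  have hd : DifferentiableAt ℂ (fun z => e' (e.symm z)) z :=
    ((contDiffOn_transition he he').contDiffAt
      ((e.symm ≫ₕ e').open_source.mem_nhds hz)).differentiableAt (by simp)
  have h1 := (mdifferentiableAt_atlas_symm (I := 𝓘(ℂ, Fin n → ℂ)) he'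
    (e'.map_source hz2.2)).hasMFDerivAt
  have h2 := h1.comp z hd.hasFDerivAt.hasMFDerivAt
  have h3 : e.symm =ᶠ[𝓝 z] e'.symm ∘ fun z => e' (e.symm z) := by
    filter_upwards [(e.symm ≫ₕ e').open_source.mem_nhds hz] with w hw
    rw [OpenPartialHomeomorph.trans_source] at hw
    exact (e'.left_inv hw.2).symm
  have h4 := (h2.congr_of_eventuallyEq h3).mfderiv
  have h5 : (coordVec e z i : Fin n → ℂ) =
      mfderiv 𝓘(ℂ, Fin n → ℂ) 𝓘(ℂ, Fin n → ℂ) e'.symm (e' (e.symm z))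
        (fderiv ℂ (fun z => e' (e.symm z)) z (Pi.single i 1)) := by
    unfold coordVec
    rw [h4]; rfl
  rw [h5]
  have h6 : fderiv ℂ (fun z => e' (e.symm z)) z (Pi.single i 1) =
      ∑ a, jac (fun z => e' (e.symm z)) z i a • (Pi.single a 1 : Fin n → ℂ) := by
    ext b
    simp [jac, Finset.sum_apply, Pi.single_apply]
  rw [h6]
  refine (map_sum (mfderiv 𝓘(ℂ, Fin n → ℂ) 𝓘(ℂ, Fin n → ℂ) e'.symm (e' (e.symm z))) _ _).trans ?_
  exact Finset.sum_congr rfl fun a _ => map_smul _ _ _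

/-- The transformation law of the metric coefficients under a change of charts. -/
theorem coeff_change (he : e ∈ atlas (Fin n → ℂ) M) (he' : e' ∈ atlas (Fin n → ℂ) M)
    (hz : z ∈ (e.symm ≫ₕ e').source) :
    g.coeff e z = jac (fun z => e' (e.symm z)) z * g.coeff e' (e' (e.symm z)) *
      (jac (fun z => e' (e.symm z)) z).conjTranspose := by
  have hz2 := hz
  rw [OpenPartialHomeomorph.trans_source] at hz2
  have hx : e.symm z = e'.symm (e' (e.symm z)) := (e'.left_inv hz2.2).symm
  ext i j
  rw [matrix_congruence_apply]
  have h1 : g.coeff e z i j = g.form (e'.symm (e' (e.symm z)))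
      (coordVec e z i : Fin n → ℂ) (coordVec e z j : Fin n → ℂ) := g.form_congr hx _ _
  rw [h1, coordVec_change he he' hz i, coordVec_change he he' hz j]
  generalize jac (fun z => e' (e.symm z)) z = A
  refine (map_sum (g.form (e'.symm (e' (e.symm z))) _) _ _).trans ?_
  refine Finset.sum_congr rfl fun b _ => ?_
  refine (map_smulₛₗ (g.form (e'.symm (e' (e.symm z))) _) _ _).trans ?_
  rw [smul_eq_mul]
  congr 1
  refine (congrArg (fun L => L (coordVec e' (e' (e.symm z)) b))
    (map_sum (g.form (e'.symm (e' (e.symm z)))) _ _)).trans ?_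
  rw [LinearMap.sum_apply]
  refine Finset.sum_congr rfl fun a _ => ?_
  refine (congrArg (fun L => L (coordVec e' (e' (e.symm z)) b))
    (map_smul (g.form (e'.symm (e' (e.symm z)))) _ _)).trans ?_
  rfl

open ComplexOrder in
theorem posDef_coeff (he : e ∈ atlas (Fin n → ℂ) M) (hz : z ∈ e.target) :
    (g.coeff e z).PosDef := by
  have : IsManifold 𝓘(ℂ, Fin n → ℂ) 1 M := IsManifold.of_le (n := ω) le_top
  have hinj : Function.Injective
      (mfderiv 𝓘(ℂ, Fin n → ℂ) 𝓘(ℂ, Fin n → ℂ) e.symm z) := by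
    have h1 := (mdifferentiableAt_atlas_symm (I := 𝓘(ℂ, Fin n → ℂ)) he hz).hasMFDerivAt
    have h2 := (mdifferentiableAt_atlas (I := 𝓘(ℂ, Fin n → ℂ)) he
      (e.map_target hz)).hasMFDerivAt
    have h3 := h2.comp z h1
    have h4 : (e ∘ e.symm) =ᶠ[𝓝 z] id := by
      filter_upwards [e.open_target.mem_nhds hz] with w hw using e.right_inv hw
    have h5 := (h3.congr_of_eventuallyEq h4.symm).mfderiv
    intro v w hvw
    have h6 := congrArg (mfderiv 𝓘(ℂ, Fin n → ℂ) 𝓘(ℂ, Fin n → ℂ) e (e.symm z)) hvw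
    have h7 : ∀ v : Fin n → ℂ, mfderiv 𝓘(ℂ, Fin n → ℂ) 𝓘(ℂ, Fin n → ℂ) e (e.symm z)
        (mfderiv 𝓘(ℂ, Fin n → ℂ) 𝓘(ℂ, Fin n → ℂ) e.symm z v) = v := fun v => by
      have h8 := DFunLike.congr_fun h5 v
      rw [mfderiv_id] at h8
      exact h8.symm
    exact (h7 v).symm.trans (h6.trans (h7 w))
  -- the form is linear in its first argument, whence the conjugate of `y`
  refine Matrix.PosDef.of_dotProduct_mulVec_pos ?_ fun y hy => ?_
  · exact g.isHermitian_coeff e z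
  · set v : Fin n → ℂ := star y with hv
    have hv0 : v ≠ 0 := fun h => hy (by simpa [hv] using h)
    set V : TangentSpace 𝓘(ℂ, Fin n → ℂ) (e.symm z) :=
      mfderiv 𝓘(ℂ, Fin n → ℂ) 𝓘(ℂ, Fin n → ℂ) e.symm z v with hV
    have hV0 : V ≠ 0 := fun h => hv0 (hinj (h.trans (map_zero _).symm))
    have hVs : V = ∑ i, v i • coordVec e z i := by
      have h6 : v = ∑ a, v a • (Pi.single a 1 : Fin n → ℂ) := by
        ext b
        simp [Finset.sum_apply, Pi.single_apply]
      conv_lhs => rw [hV, h6]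
      refine (map_sum (mfderiv 𝓘(ℂ, Fin n → ℂ) 𝓘(ℂ, Fin n → ℂ) e.symm z) _ _).trans ?_
      exact Finset.sum_congr rfl fun a _ => map_smul _ _ _
    have hsum : star y ⬝ᵥ (g.coeff e z).mulVec y = g.form _ V V := by
      rw [hVs, map_sum]
      simp only [map_sum, LinearMap.sum_apply, map_smulₛₗ, LinearMap.smul_apply,
        smul_eq_mul, dotProduct, Matrix.mulVec, Finset.mul_sum, hv]
      rw [Finset.sum_comm]
      refine Finset.sum_congr rfl fun j _ => Finset.sum_congr rfl fun i _ => ?_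
      simp only [Pi.star_apply, RCLike.star_def, Complex.conj_conj]
      change _ * (g.coeff e z i j * _) = _ * (_ * g.coeff e z i j)
      rw [RingHom.id_apply]
      ring
    rw [hsum, Complex.lt_def]
    refine ⟨g.pos _ V hV0, ?_⟩
    exact (Complex.conj_eq_iff_im.1 (g.conj_symm _ V V).symm).symm

open ComplexOrder in
theorem det_coeff_pos (he : e ∈ atlas (Fin n → ℂ) M) (hz : z ∈ e.target) :
    0 < (g.coeff e z).det := (g.posDef_coeff he hz).det_pos

open ComplexOrder in
theorem det_coeff_ne_zero (he : e ∈ atlas (Fin n → ℂ) M) (hz : z ∈ e.target) :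
    (g.coeff e z).det ≠ 0 := (g.det_coeff_pos he hz).ne'

theorem det_coeff_re_pos (he : e ∈ atlas (Fin n → ℂ) M) (hz : z ∈ e.target) :
    0 < (g.coeff e z).det.re := (Complex.lt_def.1 (g.det_coeff_pos he hz)).1

theorem det_coeff_eq_re (he : e ∈ atlas (Fin n → ℂ) M) (hz : z ∈ e.target) :
    (g.coeff e z).det = ((g.coeff e z).det.re : ℂ) :=
  Complex.ext rfl (Complex.lt_def.1 (g.det_coeff_pos he hz)).2.symm

theorem det_coeff_change (he : e ∈ atlas (Fin n → ℂ) M) (he' : e' ∈ atlas (Fin n → ℂ) M)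
    (hz : z ∈ (e.symm ≫ₕ e').source) :
    (g.coeff e z).det.re = Complex.normSq (jac (fun z => e' (e.symm z)) z).det *
      (g.coeff e' (e' (e.symm z))).det.re := by
  have hz2 := hz
  rw [OpenPartialHomeomorph.trans_source] at hz2
  have h := congrArg Matrix.det (g.coeff_change he he' hz)
  rw [Matrix.det_mul, Matrix.det_mul, Matrix.det_conjTranspose, RCLike.star_def, mul_right_comm,
    Complex.mul_conj, g.det_coeff_eq_re he hz2.1,
    g.det_coeff_eq_re he' (e'.map_source hz2.2), ← Complex.ofReal_mul] at h
  exact Complex.ofReal_injective h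

theorem det_jac_ne_zero (g : HermitianMetric n M) (he : e ∈ atlas (Fin n → ℂ) M) (he' : e' ∈ atlas (Fin n → ℂ) M)
    (hz : z ∈ (e.symm ≫ₕ e').source) : (jac (fun z => e' (e.symm z)) z).det ≠ 0 := by
  intro h
  have h1 := g.det_coeff_change he he' hz
  rw [h, map_zero, zero_mul] at h1
  rw [OpenPartialHomeomorph.trans_source] at hz
  exact (g.det_coeff_re_pos he hz.1).ne' h1

/-- The Chern scalar curvature can be computed in any chart of the atlas. -/
theorem chernScalar_symm (he : e ∈ atlas (Fin n → ℂ) M) (hz : z ∈ e.target) :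
    g.chernScalar (e.symm z) = (localScalar (g.coeff e) z).re := by
  set x := e.symm z with hx
  set e' := chartAt (Fin n → ℂ) x with he'
  have hea : e' ∈ atlas (Fin n → ℂ) M := chart_mem_atlas _ _
  have hzs : z ∈ (e.symm ≫ₕ e').source := mem_transition_source hz (mem_chart_source _ _)
  have h := localScalar_eq_of_change (G := g.coeff e) (P := g.coeff e')
    (e.symm ≫ₕ e').open_source hzs (contDiffOn_transition he hea)
    (fun w hw k l => (g.contDiffAt_coeff hea (e'.map_source
      (by rw [OpenPartialHomeomorph.trans_source] at hw; exact hw.2)) k l).of_le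
        two_le_infty)
    (g.det_jac_ne_zero he hea hzs) (g.det_coeff_ne_zero hea (e'.map_source (mem_chart_source _ _)))
    (fun w hw => g.coeff_change he hea hw)
  rw [g.chernScalar_eq_localScalar_chartAt, h]

end HermitianMetric

/-- A real function on `M` is of class `C^m` if its expressions in the charts of the atlas are. -/
def ChartContDiff (m : ℕ∞ω) (u : M → ℝ) : Prop :=
  ∀ e ∈ atlas (Fin n → ℂ) M, ContDiffOn ℝ m (fun z => u (e.symm z)) e.target

theorem ChartContDiff.contDiffAt {m : ℕ∞ω} {u : M → ℝ} (hu : ChartContDiff (n := n) m u)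
    (he : e ∈ atlas (Fin n → ℂ) M) (hz : z ∈ e.target) :
    ContDiffAt ℝ m (fun z => u (e.symm z)) z :=
  (hu e he).contDiffAt (e.open_target.mem_nhds hz)

theorem ChartContDiff.contDiffAt_ofReal {m : ℕ∞ω} {u : M → ℝ} (hu : ChartContDiff (n := n) m u)
    (he : e ∈ atlas (Fin n → ℂ) M) (hz : z ∈ e.target) :
    ContDiffAt ℝ m (fun z => (u (e.symm z) : ℂ)) z :=
  Complex.ofRealCLM.contDiff.contDiffAt.comp z (hu.contDiffAt he hz)

/-- A function on `M` is continuous as soon as its expressions in the charts are. -/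
theorem continuous_of_chart {Y : Type*} [TopologicalSpace Y] {u : M → Y}
    (hu : ∀ e ∈ atlas (Fin n → ℂ) M, ∀ z ∈ e.target, ContinuousAt (fun z => u (e.symm z)) z) :
    Continuous u := by
  rw [continuous_iff_continuousAt]
  intro x
  have hx := mem_chart_source (Fin n → ℂ) x
  have h := (hu _ (chart_mem_atlas _ x) _ (mem_chart_target _ x)).comp
    ((chartAt (Fin n → ℂ) x).continuousAt hx)
  refine h.congr ?_
  filter_upwards [(chartAt (Fin n → ℂ) x).open_source.mem_nhds hx] with y hy
  simp [(chartAt (Fin n → ℂ) x).left_inv hy]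

theorem ChartContDiff.continuous {m : ℕ∞ω} {u : M → ℝ} (hu : ChartContDiff (n := n) m u) :
    Continuous u :=
  continuous_of_chart fun _ he _ hz => (hu.contDiffAt he hz).continuousAt

theorem ChartContDiff.contMDiff [IsManifold 𝓘(ℂ, Fin n → ℂ) ω M] {u : M → ℝ}
    (hu : ChartContDiff (n := n) ∞ u) : ContMDiff 𝓘(ℝ, Fin n → ℂ) 𝓘(ℝ) ∞ u := by
  have : IsManifold 𝓘(ℝ, Fin n → ℂ) ∞ M := isManifold_real
  intro x
  have hx := mem_chart_source (Fin n → ℂ) x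
  have h1 := (hu.contDiffAt (chart_mem_atlas _ x) (mem_chart_target _ x)).contMDiffAt
  have h2 : ContMDiffAt 𝓘(ℝ, Fin n → ℂ) 𝓘(ℝ, Fin n → ℂ) ∞ (chartAt (Fin n → ℂ) x) x :=
    contMDiffAt_of_mem_maximalAtlas
      (IsManifold.subset_maximalAtlas (chart_mem_atlas _ x)) hx
  refine (h1.comp x h2).congr_of_eventuallyEq ?_
  filter_upwards [(chartAt (Fin n → ℂ) x).open_source.mem_nhds hx] with y hy
  simp [(chartAt (Fin n → ℂ) x).left_inv hy]

namespace HermitianMetric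

variable (g : HermitianMetric n M)

/-- The Laplacian `∑ g^{i j̄} ∂²u/∂zⁱ∂z̄ʲ` of a real function `u`, computed in the preferred chart at
each point. -/
def lap (u : M → ℝ) (x : M) : ℝ :=
  (localLap (g.coeff (chartAt (Fin n → ℂ) x))
    (fun z => (u ((chartAt (Fin n → ℂ) x).symm z) : ℂ)) (chartAt (Fin n → ℂ) x x)).re

variable [IsManifold 𝓘(ℂ, Fin n → ℂ) ω M]

theorem chartContDiff_chernScalar : ChartContDiff (n := n) ∞ g.chernScalar := by
  intro e he z hz
  refine ContDiffAt.contDiffWithinAt ?_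
  have h1 : ContDiffAt ℝ ∞ (fun z => (localScalar (g.coeff e) z).re) z :=
    Complex.reCLM.contDiff.contDiffAt.comp z
      (contDiffAt_localScalar (g.contDiffAt_coeff he hz) (g.det_coeff_ne_zero he hz))
  refine h1.congr_of_eventuallyEq ?_
  filter_upwards [e.open_target.mem_nhds hz] with w hw using g.chernScalar_symm he hw

/-- The Laplacian can be computed in any chart of the atlas. -/
theorem lap_symm {u : M → ℝ} (hu : ChartContDiff (n := n) 2 u) (he : e ∈ atlas (Fin n → ℂ) M)
    (hz : z ∈ e.target) :
    g.lap u (e.symm z) = (localLap (g.coeff e) (fun z => (u (e.symm z) : ℂ)) z).re := by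
  set x := e.symm z with hx
  set e' := chartAt (Fin n → ℂ) x with he'
  have hea : e' ∈ atlas (Fin n → ℂ) M := chart_mem_atlas _ _
  have hzs : z ∈ (e.symm ≫ₕ e').source := mem_transition_source hz (mem_chart_source _ _)
  have h := localLap_eq_of_change (G := g.coeff e) (P := g.coeff e')
    (e.symm ≫ₕ e').open_source hzs (contDiffOn_transition he hea)
    (u := fun z => (u (e'.symm z) : ℂ))
    (fun w hw => hu.contDiffAt_ofReal hea (e'.map_source
      (by rw [OpenPartialHomeomorph.trans_source] at hw; exact hw.2)))
    (g.det_jac_ne_zero he hea hzs) (g.coeff_change he hea hzs)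
  rw [lap, ← he', ← h]
  congr 1
  refine localLap_congr ?_
  filter_upwards [(e.symm ≫ₕ e').open_source.mem_nhds hzs] with w hw
  rw [OpenPartialHomeomorph.trans_source] at hw
  rw [e'.left_inv hw.2]

theorem continuous_lap {u : M → ℝ} (hu : ChartContDiff (n := n) 2 u) : Continuous (g.lap u) := by
  refine continuous_of_chart (n := n) fun e he z hz => ?_
  have h1 : ContinuousAt (fun z => (localLap (g.coeff e) (fun z => (u (e.symm z) : ℂ)) z).re) z :=
    Complex.continuous_re.continuousAt.comp (continuousAt_localLap
      (fun k l => (g.contDiffAt_coeff he hz k l).of_le (by simp)) (g.det_coeff_ne_zero he hz)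
      (hu.contDiffAt_ofReal he hz))
  refine h1.congr ?_
  filter_upwards [e.open_target.mem_nhds hz] with w hw using (g.lap_symm hu he hw).symm

theorem coeff_conformal (f : C^∞⟮𝓘(ℝ, Fin n → ℂ), M; ℝ⟯)
    (e : OpenPartialHomeomorph M (Fin n → ℂ)) (z : Fin n → ℂ) :
    (g.conformal f).coeff e z = ((Real.exp (f (e.symm z)) : ℝ) : ℂ) • g.coeff e z := rfl

theorem chartContDiff_smooth (f : C^∞⟮𝓘(ℝ, Fin n → ℂ), M; ℝ⟯) : ChartContDiff (n := n) ∞ f :=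
  fun _ he => contDiffOn_chart f he

/-- Conformal change of the Chern scalar curvature: `s̃ = e^{-f} (s - n Δf)`. -/
theorem chernScalar_conformal (f : C^∞⟮𝓘(ℝ, Fin n → ℂ), M; ℝ⟯) (x : M) :
    (g.conformal f).chernScalar x =
      Real.exp (-f x) * (g.chernScalar x - n * g.lap f x) := by
  have he := chart_mem_atlas (Fin n → ℂ) x
  have hz := mem_chart_target (Fin n → ℂ) x
  have h := localScalar_conformal (G := g.coeff (chartAt (Fin n → ℂ) x))
    (((chartContDiff_smooth f).contDiffAt he hz).of_le two_le_infty)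
    (fun k l => (g.contDiffAt_coeff he hz k l).of_le two_le_infty) (g.det_coeff_ne_zero he hz)
  rw [chernScalar_eq_localScalar_chartAt, chernScalar_eq_localScalar_chartAt, lap]
  rw [show (g.conformal f).coeff (chartAt (Fin n → ℂ) x) = fun w =>
    ((Real.exp (f ((chartAt (Fin n → ℂ) x).symm w)) : ℝ) : ℂ) • g.coeff (chartAt (Fin n → ℂ) x) w
    from rfl, h, (chartAt (Fin n → ℂ) x).left_inv (mem_chart_source _ x), Complex.re_ofReal_mul]
  simp

end HermitianMetric

end Charts

/-! ### The volume measure in charts -/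

theorem measurableSet_inter_preimage_of_continuousOn {X Y : Type*} [TopologicalSpace X]
    [MeasurableSpace X] [BorelSpace X] [TopologicalSpace Y] [MeasurableSpace Y] [BorelSpace Y]
    {f : X → Y} {U : Set X} (hf : ContinuousOn f U) (hU : MeasurableSet U) {A : Set Y}
    (hA : MeasurableSet A) : MeasurableSet (U ∩ f ⁻¹' A) := by
  have h := hU.subtype_image ((continuousOn_iff_continuous_domRestrict.1 hf).measurable hA)
  convert h using 1
  ext x
  simp [Set.mem_image, and_comm]

/-- The real Jacobian determinant of a holomorphic map is the squared modulus of the complex one. -/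
theorem abs_det_restrictScalars_fderiv {n : ℕ} (φ : (Fin n → ℂ) → (Fin n → ℂ)) (z : Fin n → ℂ) :
    |((fderiv ℂ φ z).restrictScalars ℝ).det| = Complex.normSq (jac φ z).det := by
  have h1 : (jac φ z).det = LinearMap.det (fderiv ℂ φ z : (Fin n → ℂ) →ₗ[ℂ] (Fin n → ℂ)) := by
    rw [← LinearMap.det_toMatrix', ← Matrix.det_transpose]
    congr 1
  have h2 : ((fderiv ℂ φ z).restrictScalars ℝ).det =
      LinearMap.det ((fderiv ℂ φ z : (Fin n → ℂ) →ₗ[ℂ] (Fin n → ℂ)).restrictScalars ℝ) := rfl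
  rw [h2, LinearMap.det_restrictScalars, Algebra.norm_complex_apply, h1,
    abs_of_nonneg (Complex.normSq_nonneg _)]

section Measurable

variable {X Y : Type*} [TopologicalSpace X] [MeasurableSpace X] [BorelSpace X] [TopologicalSpace Y]
  [MeasurableSpace Y] [BorelSpace Y]

theorem aemeasurable_symm_restrict (e : OpenPartialHomeomorph Y X) (μ : Measure X) :
    AEMeasurable e.symm (μ.restrict e.target) :=
  e.continuousOn_symm.aemeasurable e.open_target.measurableSet

theorem measurableSet_chart_preimage (e : OpenPartialHomeomorph Y X) {A : Set Y}
    (hA : MeasurableSet A) : MeasurableSet (e.target ∩ e.symm ⁻¹' A) :=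
  measurableSet_inter_preimage_of_continuousOn e.continuousOn_symm
    e.open_target.measurableSet hA

end Measurable

section Volume

variable {n : ℕ} {M : Type*} [TopologicalSpace M] [ChartedSpace (Fin n → ℂ) M]

theorem HermitianMetric.continuousOn_det_re (g : HermitianMetric n M)
    {e : OpenPartialHomeomorph M (Fin n → ℂ)} (he : e ∈ atlas (Fin n → ℂ) M) :
    ContinuousOn (fun z => (g.coeff e z).det.re) e.target := fun _ hz =>
  (Complex.continuous_re.continuousAt.comp
    (contDiffAt_det (g.contDiffAt_coeff he hz)).continuousAt).continuousWithinAt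

theorem HermitianMetric.aemeasurable_density (g : HermitianMetric n M)
    {e : OpenPartialHomeomorph M (Fin n → ℂ)} (he : e ∈ atlas (Fin n → ℂ) M) :
    AEMeasurable (fun z => ENNReal.ofReal (2 ^ n * (g.coeff e z).det.re))
      ((volume : Measure (Fin n → ℂ)).restrict e.target) :=
  AEMeasurable.ennreal_ofReal
    (((g.continuousOn_det_re he).aemeasurable e.open_target.measurableSet).const_mul _)

variable [MeasurableSpace M] [BorelSpace M]
  {e e' : OpenPartialHomeomorph M (Fin n → ℂ)} {z : Fin n → ℂ}

namespace HermitianMetric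

variable (g : HermitianMetric n M)

theorem aemeasurable_symm (e : OpenPartialHomeomorph M (Fin n → ℂ)) :
    AEMeasurable e.symm (((volume : Measure (Fin n → ℂ)).restrict e.target).withDensity
      fun z => ENNReal.ofReal (2 ^ n * (g.coeff e z).det.re)) :=
  (aemeasurable_symm_restrict e _).mono_ac (withDensity_absolutelyContinuous _ _)

/-- `e.symm` is only continuous on `e.target`, so both the measurability of the map and the restriction
of the preimage to `e.target` matter here. -/
theorem chartVolume_apply (e : OpenPartialHomeomorph M (Fin n → ℂ)) {A : Set M}
    (hA : MeasurableSet A) : g.chartVolume e A =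
      ∫⁻ z in e.target ∩ e.symm ⁻¹' A, ENNReal.ofReal (2 ^ n * (g.coeff e z).det.re) := by
  rw [chartVolume, Measure.map_apply_of_aemeasurable (g.aemeasurable_symm e) hA]
  have h1 : (((volume : Measure (Fin n → ℂ)).restrict e.target).withDensity
      fun z => ENNReal.ofReal (2 ^ n * (g.coeff e z).det.re)) (e.symm ⁻¹' A) =
      (((volume : Measure (Fin n → ℂ)).restrict e.target).withDensity
      fun z => ENNReal.ofReal (2 ^ n * (g.coeff e z).det.re)) (e.target ∩ e.symm ⁻¹' A) := by
    refine measure_congr ?_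
    have h2 : ∀ᵐ z ∂(((volume : Measure (Fin n → ℂ)).restrict e.target).withDensity
      fun z => ENNReal.ofReal (2 ^ n * (g.coeff e z).det.re)), z ∈ e.target :=
      (withDensity_absolutelyContinuous _ _).ae_le (ae_restrict_mem e.open_target.measurableSet)
    filter_upwards [h2] with z hz
    exact propext ⟨fun h => ⟨hz, h⟩, fun h => h.2⟩
  rw [h1, withDensity_apply _ (measurableSet_chart_preimage e hA),
    Measure.restrict_restrict (measurableSet_chart_preimage e hA),
    Set.inter_eq_left.2 Set.inter_subset_left]

theorem chartVolume_compl_source (e : OpenPartialHomeomorph M (Fin n → ℂ)) :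
    g.chartVolume e e.sourceᶜ = 0 := by
  rw [g.chartVolume_apply e e.open_source.measurableSet.compl]
  have : e.target ∩ e.symm ⁻¹' e.sourceᶜ = ∅ := by
    ext z
    simp only [Set.mem_inter_iff, Set.mem_preimage, Set.mem_compl_iff, Set.mem_empty_iff_false,
      iff_false, not_and, not_not]
    exact fun h => e.map_target h
  rw [this]; simp

variable [IsManifold 𝓘(ℂ, Fin n → ℂ) ω M]

/-- The change of variables formula: the volume measures of two charts agree on the overlap. -/
theorem chartVolume_eq_of_subset (he : e ∈ atlas (Fin n → ℂ) M) (he' : e' ∈ atlas (Fin n → ℂ) M)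
    {A : Set M} (hA : MeasurableSet A) (h1 : A ⊆ e.source) (h2 : A ⊆ e'.source) :
    g.chartVolume e A = g.chartVolume e' A := by
  set φ : (Fin n → ℂ) → (Fin n → ℂ) := fun z => e' (e.symm z) with hφ
  set s := e.target ∩ e.symm ⁻¹' A with hs
  have hsub : s ⊆ (e.symm ≫ₕ e').source := fun z hz => mem_transition_source hz.1 (h2 hz.2)
  have himg : φ '' s = e'.target ∩ e'.symm ⁻¹' A := by
    ext w
    constructor
    · rintro ⟨z, hz, rfl⟩
      refine ⟨e'.map_source (h2 hz.2), ?_⟩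
      change e'.symm (e' (e.symm z)) ∈ A
      rw [e'.left_inv (h2 hz.2)]
      exact hz.2
    · rintro ⟨hw, hwA⟩
      refine ⟨e (e'.symm w), ⟨e.map_source (h1 hwA), ?_⟩, ?_⟩
      · change e.symm (e (e'.symm w)) ∈ A
        rw [e.left_inv (h1 hwA)]
        exact hwA
      · change e' (e.symm (e (e'.symm w))) = w
        rw [e.left_inv (h1 hwA), e'.right_inv hw]
  have hinj : Set.InjOn φ s := by
    intro z hz w hw hzw
    have h3 : e.symm z = e.symm w := e'.injOn (h2 hz.2) (h2 hw.2) hzw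
    rw [← e.right_inv hz.1, ← e.right_inv hw.1, h3]
  have hder : ∀ z ∈ s, HasFDerivWithinAt φ ((fderiv ℂ φ z).restrictScalars ℝ) s z := fun z hz =>
    ((((contDiffOn_transition he he').contDiffAt ((e.symm ≫ₕ e').open_source.mem_nhds
      (hsub hz))).differentiableAt (by simp)).hasFDerivAt.restrictScalars ℝ).hasFDerivWithinAt
  rw [g.chartVolume_apply e hA, g.chartVolume_apply e' hA, ← himg,
    lintegral_image_eq_lintegral_abs_det_fderiv_mul _ (measurableSet_chart_preimage e hA) hder hinj]
  refine setLIntegral_congr_fun (measurableSet_chart_preimage e hA) fun z hz => ?_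
  rw [abs_det_restrictScalars_fderiv, ← ENNReal.ofReal_mul (Complex.normSq_nonneg _),
    g.det_coeff_change he he' (hsub hz)]
  congr 1
  ring

/-- The volume measure restricts to the measure of each chart. -/
theorem volumeMeasure_apply_of_subset (he : e ∈ atlas (Fin n → ℂ) M) {A : Set M}
    (hA : MeasurableSet A) (h1 : A ⊆ e.source) : g.volumeMeasure A = g.chartVolume e A := by
  have hle : ∀ e' ∈ atlas (Fin n → ℂ) M, g.chartVolume e' ≤ g.volumeMeasure := fun e' he' =>
    le_iSup₂ (f := fun e (_ : e ∈ atlas (Fin n → ℂ) M) => g.chartVolume e) e' he'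
  refine le_antisymm ?_ (hle e he A)
  -- a measure dominating all chart measures, and equal to that of `e` on its domain
  have hub : g.volumeMeasure ≤ g.chartVolume e + g.volumeMeasure.restrict e.sourceᶜ := by
    refine iSup₂_le fun e' he' => Measure.le_iff.2 fun B hB => ?_
    have hsm := e.open_source.measurableSet
    have hsm' := e'.open_source.measurableSet
    rw [← measure_inter_add_sdiff B hsm, Measure.add_apply, Measure.restrict_apply hB]
    refine add_le_add ?_ (hle e' he' _)
    rw [← measure_inter_add_sdiff (B ∩ e.source) hsm']
    have h3 : g.chartVolume e' ((B ∩ e.source) \ e'.source) = 0 :=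
      measure_mono_null (fun x hx => hx.2) (g.chartVolume_compl_source e')
    rw [h3, add_zero, ← g.chartVolume_eq_of_subset he he' ((hB.inter hsm).inter hsm')
      (fun x hx => hx.1.2) (fun x hx => hx.2)]
    exact measure_mono fun x hx => hx.1.1
  refine (hub A).trans ?_
  rw [Measure.add_apply, Measure.restrict_apply hA, (Set.disjoint_compl_right_iff_subset.2 h1).inter_eq,
    measure_empty, add_zero]

theorem restrict_volumeMeasure (he : e ∈ atlas (Fin n → ℂ) M) :
    g.volumeMeasure.restrict e.source = g.chartVolume e := by
  ext A hA
  have hsm := e.open_source.measurableSet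
  rw [Measure.restrict_apply hA, g.volumeMeasure_apply_of_subset he (hA.inter hsm)
    Set.inter_subset_right, ← measure_inter_add_sdiff (μ := g.chartVolume e) A hsm,
    measure_mono_null (fun x hx => hx.2) (g.chartVolume_compl_source e) (s := A \ e.source),
    add_zero]

instance : IsLocallyFiniteMeasure g.volumeMeasure where
  finiteAtNhds x := by
    set e := chartAt (Fin n → ℂ) x with he
    have hea : e ∈ atlas (Fin n → ℂ) M := chart_mem_atlas _ x
    have hx : x ∈ e.source := mem_chart_source _ x
    obtain ⟨K, hK, hKe⟩ := exists_compact_subset e.open_target (e.map_source hx)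
    obtain ⟨C, hC⟩ := hK.bddAbove_image ((g.continuousOn_det_re hea).mono hKe.2)
    refine ⟨e.source ∩ e ⁻¹' interior K,
      (e.isOpen_inter_preimage isOpen_interior).mem_nhds ⟨hx, hKe.1⟩, ?_⟩
    have hm : MeasurableSet (e.source ∩ e ⁻¹' interior K) :=
      (e.isOpen_inter_preimage isOpen_interior).measurableSet
    rw [g.volumeMeasure_apply_of_subset hea hm Set.inter_subset_left, g.chartVolume_apply e hm]
    calc ∫⁻ z in e.target ∩ e.symm ⁻¹' (e.source ∩ e ⁻¹' interior K),
          ENNReal.ofReal (2 ^ n * (g.coeff e z).det.re)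
        ≤ ∫⁻ z in K, ENNReal.ofReal (2 ^ n * (g.coeff e z).det.re) := by
          refine lintegral_mono_set fun z hz => interior_subset ?_
          have := hz.2.2
          rwa [Set.mem_preimage, e.right_inv hz.1] at this
      _ ≤ ∫⁻ z in K, ENNReal.ofReal (2 ^ n * C) := by
          refine setLIntegral_mono' hK.measurableSet fun z hz => ENNReal.ofReal_le_ofReal ?_
          exact mul_le_mul_of_nonneg_left (hC (Set.mem_image_of_mem _ hz)) (by positivity)
      _ < ⊤ := by
          rw [setLIntegral_const]
          exact ENNReal.mul_lt_top ENNReal.ofReal_lt_top hK.measure_lt_top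

instance : Measure.IsOpenPosMeasure g.volumeMeasure where
  open_pos U hU := by
    rintro ⟨x, hx⟩ h0
    set e := chartAt (Fin n → ℂ) x with he
    have hea : e ∈ atlas (Fin n → ℂ) M := chart_mem_atlas _ x
    have hxs : x ∈ e.source := mem_chart_source _ x
    have hUm := hU.inter e.open_source
    have h1 : g.volumeMeasure (U ∩ e.source) = 0 := measure_mono_null Set.inter_subset_left h0
    rw [g.volumeMeasure_apply_of_subset hea hUm.measurableSet Set.inter_subset_right,
      g.chartVolume_apply e hUm.measurableSet] at h1
    have hopen : IsOpen (e.target ∩ e.symm ⁻¹' (U ∩ e.source)) :=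
      e.symm.isOpen_inter_preimage hUm
    have hpos : 0 < volume (e.target ∩ e.symm ⁻¹' (U ∩ e.source)) :=
      hopen.measure_pos volume ⟨e x, e.map_source hxs, by
        rw [Set.mem_preimage, e.left_inv hxs]; exact ⟨hx, hxs⟩⟩
    have hm := hopen.measurableSet
    have h2 : AEMeasurable (fun z => ENNReal.ofReal (2 ^ n * (g.coeff e z).det.re))
        ((volume : Measure (Fin n → ℂ)).restrict (e.target ∩ e.symm ⁻¹' (U ∩ e.source))) :=
      (g.aemeasurable_density hea).mono_measure (Measure.restrict_mono_set _ Set.inter_subset_left)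
    have h3 := (ae_restrict_iff' hm).1 ((lintegral_eq_zero_iff' h2).1 h1)
    refine hpos.ne' (measure_eq_zero_iff_ae_notMem.2 (h3.mono fun z hz hzm => ?_))
    have h4 : 0 < 2 ^ n * (g.coeff e z).det.re :=
      mul_pos (by positivity) (g.det_coeff_re_pos hea hzm.1)
    exact (ENNReal.ofReal_pos.2 h4).ne' (hz hzm)

/-- Conformal change of the volume: `dṼ = e^{n f} dV`. -/
theorem volumeMeasure_conformal [SigmaCompactSpace M] (f : C^∞⟮𝓘(ℝ, Fin n → ℂ), M; ℝ⟯) :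
    (g.conformal f).volumeMeasure =
      g.volumeMeasure.withDensity fun x => ENNReal.ofReal (Real.exp (n * f x)) := by
  have hcov : ∃ s : Set M, s.Countable ∧ ⋃ x ∈ s, (chartAt (Fin n → ℂ) x).source = Set.univ :=
    countable_cover_nhds_of_sigmaCompact fun x =>
      (chartAt (Fin n → ℂ) x).open_source.mem_nhds (mem_chart_source _ x)
  obtain ⟨s, hs, hsU⟩ := hcov
  have := hs.to_subtype
  rw [Set.biUnion_eq_iUnion] at hsU
  rw [Measure.ext_iff_of_iUnion_eq_univ hsU]
  rintro ⟨x, -⟩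
  have hea := chart_mem_atlas (Fin n → ℂ) x
  generalize chartAt (Fin n → ℂ) x = e at hea ⊢
  have hfm : Measurable fun x => ENNReal.ofReal (Real.exp (n * f x)) := by
    have : Continuous f := f.contMDiff.continuous
    fun_prop
  rw [restrict_withDensity e.open_source.measurableSet, restrict_volumeMeasure _ hea,
    restrict_volumeMeasure _ hea]
  ext A hA
  rw [chartVolume_apply _ _ hA, withDensity_apply _ hA, ← lintegral_indicator hA]
  have h1 := g.aemeasurable_symm e
  rw [chartVolume, lintegral_map' (hfm.indicator hA).aemeasurable h1]
  have hS := measurableSet_chart_preimage e hA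
  have h2 : (volume : Measure (Fin n → ℂ)).restrict (e.target ∩ e.symm ⁻¹' A) =
      (volume.restrict e.target).restrict (e.target ∩ e.symm ⁻¹' A) := by
    rw [Measure.restrict_restrict hS, Set.inter_eq_left.2 Set.inter_subset_left]
  have h3 : AEMeasurable (fun z => A.indicator (fun x => ENNReal.ofReal (Real.exp (n * f x)))
      (e.symm z)) ((volume : Measure (Fin n → ℂ)).restrict e.target) :=
    (hfm.indicator hA).comp_aemeasurable (aemeasurable_symm_restrict e _)
  rw [lintegral_withDensity_eq_lintegral_mul₀ (g.aemeasurable_density hea) h3, h2,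
    ← lintegral_indicator hS]
  refine setLIntegral_congr_fun e.open_target.measurableSet fun z hz => ?_
  by_cases hzA : e.symm z ∈ A
  · have h4 : z ∈ e.target ∩ e.symm ⁻¹' A := ⟨hz, hzA⟩
    simp only [Pi.mul_apply, Set.indicator_of_mem h4, Set.indicator_of_mem hzA]
    rw [← ENNReal.ofReal_mul (mul_nonneg (by positivity) (g.det_coeff_re_pos hea hz).le),
      coeff_conformal, Matrix.det_smul, Fintype.card_fin, ← Complex.ofReal_pow,
      Complex.re_ofReal_mul, ← Real.exp_nat_mul]
    congr 1
    ring
  · have h4 : z ∉ e.target ∩ e.symm ⁻¹' A := fun h => hzA h.2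
    simp only [Pi.mul_apply, Set.indicator_of_notMem h4, Set.indicator_of_notMem hzA, mul_zero]

/-- Integration in a chart. -/
theorem integral_volumeMeasure_of_chart (he : e ∈ atlas (Fin n → ℂ) M) {F : M → ℝ}
    (hF : Continuous F) (h0 : ∀ x ∉ e.source, F x = 0) :
    ∫ x, F x ∂g.volumeMeasure =
      ∫ z in e.target, 2 ^ n * ((g.coeff e z).det.re * F (e.symm z)) := by
  rw [← setIntegral_eq_integral_of_forall_compl_eq_zero h0, restrict_volumeMeasure _ he, chartVolume,
    integral_map (g.aemeasurable_symm e) hF.aestronglyMeasurable]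
  rw [integral_withDensity_eq_integral_toReal_smul₀ (g.aemeasurable_density he)
    (ae_of_all _ fun _ => ENNReal.ofReal_lt_top)]
  refine setIntegral_congr_fun e.open_target.measurableSet fun z hz => ?_
  simp only [smul_eq_mul]
  rw [ENNReal.toReal_ofReal (mul_nonneg (by positivity) (g.det_coeff_re_pos he hz).le), mul_assoc]

end HermitianMetric

end Volume

/-! ### Integration by parts -/

section IntegrationByParts

variable {n : ℕ} {a f : (Fin n → ℂ) → ℂ} {U : Set (Fin n → ℂ)}

theorem integrable_mul_of_tsupport_subset (hU : IsOpen U) (ha : ContinuousOn a U)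
    (hf : Continuous f) (hc : HasCompactSupport f) (hs : tsupport f ⊆ U) :
    Integrable (fun z => a z * f z) := by
  have hs' : tsupport (fun z => a z * f z) ⊆ tsupport f :=
    closure_mono (Function.support_mul_subset_right _ _)
  have h1 : Continuous (fun z => a z * f z) :=
    (ha.mul hf.continuousOn).continuous_of_tsupport_subset hU (hs'.trans hs)
  exact h1.integrable_of_hasCompactSupport (hc.mono' (Function.support_mul_subset_right _ _ |>.trans
    subset_closure))

theorem integral_mul_fderiv_eq_neg (hU : IsOpen U) (ha : ContDiffOn ℝ 1 a U)
    (hf : ContDiff ℝ 1 f) (hc : HasCompactSupport f) (hs : tsupport f ⊆ U) (v : Fin n → ℂ) :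
    ∫ z, a z * fderiv ℝ f z v = -∫ z, fderiv ℝ a z v * f z := by
  have had : ContinuousOn (fun z => fderiv ℝ a z v) U :=
    (ha.continuousOn_fderiv_of_isOpen hU le_rfl).clm_apply continuousOn_const
  have hfd : Continuous (fun z => fderiv ℝ f z v) :=
    (hf.continuous_fderiv one_ne_zero).clm_apply continuous_const
  refine integral_mul_fderiv_eq_neg_fderiv_mul_of_integrable ?_ ?_ ?_ ?_ ?_
  · exact integrable_mul_of_tsupport_subset hU had hf.continuous hc hs
  · refine integrable_mul_of_tsupport_subset hU ha.continuousOn hfd (hc.fderiv_apply ℝ v) ?_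
    exact (tsupport_fderiv_apply_subset ℝ v).trans hs
  · exact integrable_mul_of_tsupport_subset hU ha.continuousOn hf.continuous hc hs
  · exact fun z hz => (ha.contDiffAt (hU.mem_nhds (hs hz))).differentiableAt one_ne_zero
  · exact fun z _ => hf.differentiable one_ne_zero z

theorem integrable_mul_fderiv (hU : IsOpen U) (ha : ContinuousOn a U)
    (hf : ContDiff ℝ 1 f) (hc : HasCompactSupport f) (hs : tsupport f ⊆ U) (v : Fin n → ℂ) :
    Integrable (fun z => a z * fderiv ℝ f z v) :=
  integrable_mul_of_tsupport_subset hU ha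
    ((hf.continuous_fderiv one_ne_zero).clm_apply continuous_const) (hc.fderiv_apply ℝ v)
    ((tsupport_fderiv_apply_subset ℝ v).trans hs)

theorem integrable_fderiv_mul (hU : IsOpen U) (ha : ContDiffOn ℝ 1 a U)
    (hf : ContDiff ℝ 1 f) (hc : HasCompactSupport f) (hs : tsupport f ⊆ U) (v : Fin n → ℂ) :
    Integrable (fun z => fderiv ℝ a z v * f z) :=
  integrable_mul_of_tsupport_subset hU
    ((ha.continuousOn_fderiv_of_isOpen hU le_rfl).clm_apply continuousOn_const) hf.continuous hc hs

theorem integral_mul_dWirt (hU : IsOpen U) (ha : ContDiffOn ℝ 1 a U)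
    (hf : ContDiff ℝ 1 f) (hc : HasCompactSupport f) (hs : tsupport f ⊆ U) (i : Fin n) :
    ∫ z, a z * dWirt i f z = -∫ z, dWirt i a z * f z := by
  have h1 := integral_mul_fderiv_eq_neg hU ha hf hc hs (Pi.single i 1)
  have h2 := integral_mul_fderiv_eq_neg hU ha hf hc hs (Pi.single i Complex.I)
  have e1 : ∀ z, a z * dWirt i f z = (1 / 2 : ℂ) * (a z * fderiv ℝ f z (Pi.single i 1)) -
      (1 / 2 * Complex.I) * (a z * fderiv ℝ f z (Pi.single i Complex.I)) := fun z => by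
    rw [dWirt]; ring
  have e2 : ∀ z, dWirt i a z * f z = (1 / 2 : ℂ) * (fderiv ℝ a z (Pi.single i 1) * f z) -
      (1 / 2 * Complex.I) * (fderiv ℝ a z (Pi.single i Complex.I) * f z) := fun z => by
    rw [dWirt]; ring
  simp only [e1, e2]
  rw [integral_sub ((integrable_mul_fderiv hU ha.continuousOn hf hc hs _).const_mul _)
      ((integrable_mul_fderiv hU ha.continuousOn hf hc hs _).const_mul _),
    integral_sub ((integrable_fderiv_mul hU ha hf hc hs _).const_mul _)
      ((integrable_fderiv_mul hU ha hf hc hs _).const_mul _)]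
  simp only [integral_const_mul, h1, h2]
  ring

theorem integral_mul_dbarWirt (hU : IsOpen U) (ha : ContDiffOn ℝ 1 a U)
    (hf : ContDiff ℝ 1 f) (hc : HasCompactSupport f) (hs : tsupport f ⊆ U) (i : Fin n) :
    ∫ z, a z * dbarWirt i f z = -∫ z, dbarWirt i a z * f z := by
  have h1 := integral_mul_fderiv_eq_neg hU ha hf hc hs (Pi.single i 1)
  have h2 := integral_mul_fderiv_eq_neg hU ha hf hc hs (Pi.single i Complex.I)
  have e1 : ∀ z, a z * dbarWirt i f z = (1 / 2 : ℂ) * (a z * fderiv ℝ f z (Pi.single i 1)) +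
      (1 / 2 * Complex.I) * (a z * fderiv ℝ f z (Pi.single i Complex.I)) := fun z => by
    rw [dbarWirt]; ring
  have e2 : ∀ z, dbarWirt i a z * f z = (1 / 2 : ℂ) * (fderiv ℝ a z (Pi.single i 1) * f z) +
      (1 / 2 * Complex.I) * (fderiv ℝ a z (Pi.single i Complex.I) * f z) := fun z => by
    rw [dbarWirt]; ring
  simp only [e1, e2]
  rw [integral_add ((integrable_mul_fderiv hU ha.continuousOn hf hc hs _).const_mul _)
      ((integrable_mul_fderiv hU ha.continuousOn hf hc hs _).const_mul _),
    integral_add ((integrable_fderiv_mul hU ha hf hc hs _).const_mul _)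
      ((integrable_fderiv_mul hU ha hf hc hs _).const_mul _)]
  simp only [integral_const_mul, h1, h2]
  ring

theorem tsupport_dbarWirt_subset (i : Fin n) : tsupport (dbarWirt i f) ⊆ tsupport f := by
  refine closure_minimal (fun z hz => ?_) (isClosed_tsupport f)
  by_contra h
  refine hz ?_
  rw [dbarWirt_congr (notMem_tsupport_iff_eventuallyEq.1 h)]
  exact dbarWirt_const 0 i

/-- Two integrations by parts move `∂²/∂zⁱ∂z̄ʲ` to the other factor, which needs to be defined only near
the support of `f`. -/
theorem integral_mul_dWirt_dbarWirt (hU : IsOpen U) (ha : ContDiffOn ℝ 2 a U)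
    (hf : ContDiff ℝ 2 f) (hc : HasCompactSupport f) (hs : tsupport f ⊆ U) (i j : Fin n) :
    ∫ z, a z * dWirt i (dbarWirt j f) z = ∫ z, dWirt i (dbarWirt j a) z * f z := by
  have hf1 : ContDiff ℝ 1 (dbarWirt j f) := contDiff_iff_contDiffAt.2 fun z =>
    hf.contDiffAt.dbarWirt (by norm_num) j
  have ha1 : ContDiffOn ℝ 1 (dWirt i a) U := fun z hz =>
    ((ha.contDiffAt (hU.mem_nhds hz)).dWirt (by norm_num) i).contDiffWithinAt
  have hs1 := tsupport_dbarWirt_subset (f := f) j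
  rw [integral_mul_dWirt hU (ha.of_le (by norm_num)) hf1 (hc.of_isClosed_subset
    (isClosed_tsupport _) hs1) (hs1.trans hs), integral_mul_dbarWirt hU ha1
    (hf.of_le (by norm_num)) hc hs, neg_neg]
  refine integral_congr_ae (ae_of_all _ fun z => ?_)
  by_cases hz : z ∈ tsupport f
  · simp only
    rw [dWirt_dbarWirt_comm (ha.contDiffAt (hU.mem_nhds (hs hz)))]
  · simp only [image_eq_zero_of_notMem_tsupport hz, mul_zero]

end IntegrationByParts

/-! ### The integral of the Laplacian -/

section LaplacianIntegral

variable {n : ℕ} {M : Type*} [TopologicalSpace M] [ChartedSpace (Fin n → ℂ) M]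
  {e : OpenPartialHomeomorph M (Fin n → ℂ)} {z : Fin n → ℂ}

/-- The function `∑ ∂²(det G · G^{i j̄})/∂zⁱ∂z̄ʲ`, which is the coefficient of `∂∂̄ ω^{n-1}`. -/
def gauduchonCoeff (G : (Fin n → ℂ) → Matrix (Fin n) (Fin n) ℂ) (z : Fin n → ℂ) : ℂ :=
  ∑ i, ∑ j, dWirt i (dbarWirt j fun w => (G w).adjugate j i) z

theorem contDiffAt_gauduchonCoeff {G : (Fin n → ℂ) → Matrix (Fin n) (Fin n) ℂ}
    (hG : ∀ k l, ContDiffAt ℝ ∞ (fun w => G w k l) z) : ContDiffAt ℝ ∞ (gauduchonCoeff G) z :=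
  ContDiffAt.sum fun i _ => ContDiffAt.sum fun j _ =>
    ((contDiffAt_adjugate hG j i).dbarWirt (m := ∞) (by simp) j).dWirt (by simp) i

/-- The coefficient of `∂∂̄ ω^{n-1}` is real, because `G` is Hermitian and mixed derivatives commute. -/
theorem gauduchonCoeff_im {G : (Fin n → ℂ) → Matrix (Fin n) (Fin n) ℂ}
    (hG : ∀ k l, ContDiffAt ℝ 2 (fun w => G w k l) z)
    (hH : ∀ᶠ w in 𝓝 z, (G w).IsHermitian) : (gauduchonCoeff G z).im = 0 := by
  rw [← Complex.conj_eq_iff_im, gauduchonCoeff, map_sum]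
  simp only [map_sum]
  rw [Finset.sum_comm]
  refine Finset.sum_congr rfl fun i _ => Finset.sum_congr rfl fun j _ => ?_
  have hG' : ∀ᶠ w in 𝓝 z, ∀ k l, ContDiffAt ℝ 2 (fun w => G w k l) w := by
    simp only [Filter.eventually_all]
    exact fun k l => (hG k l).eventually (by norm_num)
  have hadj : ∀ᶠ w in 𝓝 z, ∀ i j, ContDiffAt ℝ 2 (fun w => (G w).adjugate i j) w :=
    hG'.mono fun w hw i j => contDiffAt_adjugate hw i j
  have hc : ∀ᶠ w in 𝓝 z, starRingEnd ℂ ((G w).adjugate i j) = (G w).adjugate j i := by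
    filter_upwards [hH] with w hw
    have := congrFun (congrFun (Matrix.adjugate_conjTranspose (G w)) j) i
    rwa [hw.eq] at this
  have h1 : DifferentiableAt ℝ (dbarWirt i fun w => (G w).adjugate i j) z :=
    ((hadj.self_of_nhds i j).dbarWirt (m := 1) (by norm_num) i).differentiableAt one_ne_zero
  rw [conj_dWirt h1, dWirt_dbarWirt_comm (hadj.self_of_nhds j i)]
  refine dbarWirt_congr ?_ j
  filter_upwards [hadj, hc.eventually_nhds] with w hw hcw
  rw [conj_dbarWirt ((hw i j).differentiableAt (by norm_num))]
  exact dWirt_congr hcw i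

/-- The expression in a chart of a function supported in its domain, extended by zero. -/
theorem contDiff_indicator_chart [CompactSpace M] {m : ℕ∞ω} {w : M → ℝ} (hw : ChartContDiff (n := n) m w)
    (he : e ∈ atlas (Fin n → ℂ) M) (hs : tsupport w ⊆ e.source) :
    ContDiff ℝ m (e.target.indicator fun z => w (e.symm z)) ∧
    HasCompactSupport (e.target.indicator fun z => w (e.symm z)) ∧
    tsupport (e.target.indicator fun z => w (e.symm z)) ⊆ e.target := by
  have hK : IsCompact (e '' tsupport w) :=
    (isClosed_tsupport w).isCompact.image_of_continuousOn (e.continuousOn.mono hs)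
  have hKt : e '' tsupport w ⊆ e.target := by
    rintro _ ⟨x, hx, rfl⟩
    exact e.map_source (hs hx)
  have hsup : Function.support (e.target.indicator fun z => w (e.symm z)) ⊆ e '' tsupport w := by
    intro z hz
    have hzt : z ∈ e.target := Set.mem_of_indicator_ne_zero hz
    rw [Function.mem_support, Set.indicator_of_mem hzt] at hz
    exact ⟨e.symm z, subset_tsupport _ hz, e.right_inv hzt⟩
  have hts : tsupport (e.target.indicator fun z => w (e.symm z)) ⊆ e '' tsupport w :=
    closure_minimal hsup hK.isClosed
  refine ⟨contDiff_iff_contDiffAt.2 fun z => ?_, hK.of_isClosed_subset (isClosed_tsupport _) hts,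
    hts.trans hKt⟩
  by_cases hz : z ∈ e.target
  · refine (hw.contDiffAt he hz).congr_of_eventuallyEq ?_
    filter_upwards [e.open_target.mem_nhds hz] with y hy using Set.indicator_of_mem hy _
  · refine (contDiffAt_const (c := (0 : ℝ))).congr_of_eventuallyEq ?_
    exact notMem_tsupport_iff_eventuallyEq.1 fun h => hz (hKt (hts h))

namespace HermitianMetric

variable (g : HermitianMetric n M)

/-- The top covector and the constant factor of `∂∂̄ ω^{n-1}` do not vanish. -/
theorem isGauduchon_iff (hn : 1 ≤ n) : g.IsGauduchon ↔
    ∀ e ∈ atlas (Fin n → ℂ) M, ∀ z ∈ e.target, gauduchonCoeff (g.coeff e) z = 0 := by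
  refine forall₂_congr fun e he => forall₂_congr fun z hz => ?_
  have h := delForm_delbarForm_fundForm_pow hn (G := g.coeff e) (z := z)
    fun k l => (g.contDiffAt_coeff he hz k l).of_le two_le_infty
  change delForm (delbarForm fun w => g.fundForm e w ^ (n - 1)) z = _ at h
  rw [h, smul_eq_zero, or_iff_left topCovec_ne_zero, mul_eq_zero, or_iff_right]
  · rfl
  · exact mul_ne_zero (pow_ne_zero _ Complex.I_ne_zero)
      (Nat.cast_ne_zero.2 (Nat.factorial_ne_zero _))

theorem lap_eq_zero_of_eventuallyEq {u : M → ℝ} {x : M} (h : u =ᶠ[𝓝 x] 0) : g.lap u x = 0 := by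
  have hx := mem_chart_source (Fin n → ℂ) x
  have h1 : (fun z => (u ((chartAt (Fin n → ℂ) x).symm z) : ℂ)) =ᶠ[𝓝 (chartAt (Fin n → ℂ) x x)]
      fun _ => 0 := by
    have h2 := (chartAt (Fin n → ℂ) x).continuousAt_symm (mem_chart_target _ x)
    rw [ContinuousAt, (chartAt (Fin n → ℂ) x).left_inv hx] at h2
    filter_upwards [h2.eventually h] with w hw
    simp [hw]
  rw [lap, localLap_congr h1, localLap]
  have h3 : ∀ i j : Fin n, dWirt i (dbarWirt j fun _ => (0 : ℂ)) (chartAt (Fin n → ℂ) x x) = 0 :=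
    fun i j => by
      rw [show (dbarWirt j fun _ : Fin n → ℂ => (0 : ℂ)) = fun _ => 0 from
        funext fun w => dbarWirt_const 0 j, dWirt_const]
  simp only [h3]
  simp [Matrix.trace, Matrix.mul_apply]

variable [IsManifold 𝓘(ℂ, Fin n → ℂ) ω M]

/-- The Laplacian times the volume density: the determinant turns `G⁻¹` into the adjugate. -/
theorem det_re_mul_localLap (he : e ∈ atlas (Fin n → ℂ) M) (hz : z ∈ e.target)
    (u : (Fin n → ℂ) → ℂ) :
    (g.coeff e z).det.re * (localLap (g.coeff e) u z).re =
      (∑ i, ∑ j, (g.coeff e z).adjugate j i * dWirt i (dbarWirt j u) z).re := by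
  rw [← Complex.re_ofReal_mul, ← g.det_coeff_eq_re he hz, localLap, Matrix.inv_def,
    Ring.inverse_eq_inv', Matrix.smul_mul, Matrix.trace_smul, smul_eq_mul, ← mul_assoc,
    mul_inv_cancel₀ (g.det_coeff_ne_zero he hz), one_mul]
  simp only [Matrix.trace, Matrix.diag_apply, Matrix.mul_apply, Matrix.of_apply]
  rw [Finset.sum_comm]

variable [CompactSpace M] [MeasurableSpace M] [BorelSpace M]

/-- The Laplacian of a function supported in a chart, integrated by parts twice. -/
theorem integral_lap_of_tsupport_subset {w : M → ℝ} (hw : ChartContDiff (n := n) 2 w)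
    (he : e ∈ atlas (Fin n → ℂ) M) (hs : tsupport w ⊆ e.source) :
    ∫ x, g.lap w x ∂g.volumeMeasure = 2 ^ n * ∫ z, (gauduchonCoeff (g.coeff e) z).re *
      e.target.indicator (fun z => w (e.symm z)) z := by
  set W : (Fin n → ℂ) → ℝ := e.target.indicator fun z => w (e.symm z) with hW
  obtain ⟨hW1, hW2, hW3⟩ := contDiff_indicator_chart hw he hs
  set Wc : (Fin n → ℂ) → ℂ := fun z => (W z : ℂ) with hWc
  have hWc1 : ContDiff ℝ 2 Wc := Complex.ofRealCLM.contDiff.comp hW1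
  have hsup : Function.support Wc = Function.support W := by
    ext z; simp [hWc]
  have hWc3 : tsupport Wc ⊆ e.target := by rwa [tsupport, hsup]
  have hWc2 : HasCompactSupport Wc := by rwa [HasCompactSupport, tsupport, hsup]
  have hadj : ∀ i j, ContDiffOn ℝ 2 (fun z => (g.coeff e z).adjugate j i) e.target :=
    fun i j z hz => (contDiffAt_adjugate
      (fun k l => (g.contDiffAt_coeff he hz k l).of_le two_le_infty) j i).contDiffWithinAt
  have hdd : ∀ i j, Continuous (dWirt i (dbarWirt j Wc)) := fun i j =>
    continuous_iff_continuousAt.2 fun z => ((hWc1.contDiffAt.dbarWirt (m := 1) (by norm_num)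
      j).dWirt (m := 0) (by norm_num) i).continuousAt
  have hts : ∀ i j, tsupport (dWirt i (dbarWirt j Wc)) ⊆ tsupport Wc := fun i j => by
    refine closure_minimal (fun z hz => ?_) (isClosed_tsupport Wc)
    by_contra h
    refine hz ?_
    have h1 : dbarWirt j Wc =ᶠ[𝓝 z] fun _ => 0 :=
      (eventuallyEq_dbarWirt (notMem_tsupport_iff_eventuallyEq.1 h) j).trans
        (Eventually.of_forall fun w => dbarWirt_const 0 j)
    rw [dWirt_congr h1, dWirt_const]
  have hi1 : ∀ i j, Integrable fun z =>
      (g.coeff e z).adjugate j i * dWirt i (dbarWirt j Wc) z := fun i j =>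
    integrable_mul_of_tsupport_subset e.open_target (hadj i j).continuousOn (hdd i j)
      (hWc2.of_isClosed_subset (isClosed_tsupport _) (hts i j)) ((hts i j).trans hWc3)
  have hi2 : ∀ i j, Integrable fun z =>
      dWirt i (dbarWirt j fun w => (g.coeff e w).adjugate j i) z * Wc z := fun i j =>
    integrable_mul_of_tsupport_subset e.open_target (fun z hz =>
      ((((hadj i j).contDiffAt (e.open_target.mem_nhds hz)).dbarWirt (m := 1) (by norm_num)
      j).dWirt (m := 0) (by norm_num) i).continuousAt.continuousWithinAt) hWc1.continuous hWc2 hWc3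
  have h0 : ∀ x ∉ e.source, g.lap w x = 0 := fun x hx =>
    g.lap_eq_zero_of_eventuallyEq (notMem_tsupport_iff_eventuallyEq.1 fun h => hx (hs h))
  rw [g.integral_volumeMeasure_of_chart he (g.continuous_lap hw) h0, integral_const_mul]
  congr 1
  have h1 : ∀ z ∈ e.target, (g.coeff e z).det.re * g.lap w (e.symm z) =
      (∑ i, ∑ j, (g.coeff e z).adjugate j i * dWirt i (dbarWirt j Wc) z).re := by
    intro z hz
    rw [g.lap_symm hw he hz, g.det_re_mul_localLap he hz]
    have h2 : (fun z => (w (e.symm z) : ℂ)) =ᶠ[𝓝 z] Wc := by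
      filter_upwards [e.open_target.mem_nhds hz] with y hy
      rw [hWc, hW]
      simp only [Set.indicator_of_mem hy]
    simp only [dWirt_congr (eventuallyEq_dbarWirt h2 _)]
  rw [setIntegral_congr_fun e.open_target.measurableSet h1,
    setIntegral_eq_integral_of_forall_compl_eq_zero]
  · calc ∫ z, (∑ i, ∑ j, (g.coeff e z).adjugate j i * dWirt i (dbarWirt j Wc) z).re
        = (∫ z, ∑ i, ∑ j, (g.coeff e z).adjugate j i * dWirt i (dbarWirt j Wc) z).re :=
          integral_re (𝕜 := ℂ) (integrable_finsetSum _ fun i _ =>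
            integrable_finsetSum _ fun j _ => hi1 i j)
      _ = (∫ z, ∑ i, ∑ j, dWirt i (dbarWirt j fun w => (g.coeff e w).adjugate j i) z *
            Wc z).re := by
          rw [integral_finsetSum _ fun i _ => integrable_finsetSum _ fun j _ => hi1 i j,
            integral_finsetSum _ fun i _ => integrable_finsetSum _ fun j _ => hi2 i j]
          congr 1
          refine Finset.sum_congr rfl fun i _ => ?_
          rw [integral_finsetSum _ fun j _ => hi1 i j, integral_finsetSum _ fun j _ => hi2 i j]
          exact Finset.sum_congr rfl fun j _ =>
            integral_mul_dWirt_dbarWirt e.open_target (hadj i j) hWc1 hWc2 hWc3 i j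
      _ = ∫ z, (∑ i, ∑ j, dWirt i (dbarWirt j fun w => (g.coeff e w).adjugate j i) z *
            Wc z).re := (integral_re (𝕜 := ℂ) (integrable_finsetSum _ fun i _ =>
            integrable_finsetSum _ fun j _ => hi2 i j)).symm
      _ = _ := by
          refine integral_congr_ae (ae_of_all _ fun z => ?_)
          simp only [gauduchonCoeff, ← Finset.sum_mul]
          rw [hWc, Complex.re_mul_ofReal]
  · intro z hz
    have h2 : z ∉ tsupport Wc := fun h => hz (hWc3 h)
    have h3 : ∀ i j, dWirt i (dbarWirt j Wc) z = 0 := fun i j =>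
      image_eq_zero_of_notMem_tsupport fun h => h2 (hts i j h)
    simp [h3]

end HermitianMetric

end LaplacianIntegral

/-! ### The function `|x|^m x` and the gradient -/

/-- The derivative of `|x|^m x` is `(m + 1) |x|^m`, also at the origin. -/
theorem hasDerivAt_abs_pow_mul (m : ℕ) (x : ℝ) :
    HasDerivAt (fun x : ℝ => |x| ^ m * x) ((m + 1) * |x| ^ m) x := by
  rcases eq_or_ne x 0 with rfl | hx
  · have h0 : ((m : ℝ) + 1) * |(0 : ℝ)| ^ m = |(0 : ℝ)| ^ m := by
      rcases m with _ | m <;> simp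
    rw [h0, hasDerivAt_iff_tendsto_slope]
    have hc : Tendsto (fun y : ℝ => |y| ^ m) (𝓝[≠] 0) (𝓝 (|(0 : ℝ)| ^ m)) :=
      ((continuous_abs.pow m).tendsto 0).mono_left nhdsWithin_le_nhds
    refine hc.congr' ?_
    filter_upwards [self_mem_nhdsWithin] with y hy
    rw [slope_def_field, mul_zero, sub_zero, sub_zero, mul_div_cancel_right₀ _ hy]
  · have h := ((hasDerivAt_abs hx).pow m).mul (hasDerivAt_id x)
    refine (h.congr_deriv ?_)
    have hs : (SignType.sign x : ℝ) * x = |x| := sign_mul_self x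
    rcases m with _ | m
    · simp
    · simp only [Pi.pow_apply, id_eq]
      rw [Nat.add_sub_cancel]
      push_cast
      linear_combination ((m : ℝ) + 1) * |x| ^ m * hs

theorem hasDerivAt_abs_pow_add_two (m : ℕ) (x : ℝ) :
    HasDerivAt (fun x : ℝ => |x| ^ (m + 2)) ((m + 2) * (|x| ^ m * x)) x := by
  have h := (hasDerivAt_abs_pow_mul m x).mul (hasDerivAt_id x)
  have e : (fun x : ℝ => |x| ^ (m + 2)) = (fun x : ℝ => |x| ^ m * x) * id := by
    funext y
    simp only [Pi.mul_apply, id_eq]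
    rw [pow_add, sq_abs, mul_assoc, sq]
  rw [e]
  refine h.congr_deriv ?_
  simp only [id_eq]
  ring

section Gradient

variable {n : ℕ} {G : (Fin n → ℂ) → Matrix (Fin n) (Fin n) ℂ} {z : Fin n → ℂ}

/-- The squared length `∑ g^{i j̄} ∂u/∂zⁱ ∂u/∂z̄ʲ` of the differential of `u`. -/
def localGradSq (G : (Fin n → ℂ) → Matrix (Fin n) (Fin n) ℂ) (u : (Fin n → ℂ) → ℂ)
    (z : Fin n → ℂ) : ℂ :=
  ((G z)⁻¹ * Matrix.of fun i j => dWirt i u z * dbarWirt j u z).trace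

/-- The Laplacian of a function of `u`. -/
theorem localLap_comp_real {u : (Fin n → ℂ) → ℝ} (hu : ContDiffAt ℝ 2 u z) {Φ Φ' : ℝ → ℝ}
    {Φ'' : ℝ} (hΦ : ∀ x, HasDerivAt Φ (Φ' x) x) (hΦ' : HasDerivAt Φ' Φ'' (u z)) :
    localLap G (fun w => ((Φ (u w) : ℝ) : ℂ)) z =
      Φ' (u z) * localLap G (fun w => (u w : ℂ)) z +
        Φ'' * localGradSq G (fun w => (u w : ℂ)) z := by
  have hue : ∀ᶠ w in 𝓝 z, ContDiffAt ℝ 2 u w := hu.eventually (by norm_num)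
  have huc : ContDiffAt ℝ 2 (fun w => (u w : ℂ)) z :=
    Complex.ofRealCLM.contDiff.contDiffAt.comp z hu
  have hud := hu.differentiableAt two_ne_zero
  have h1 : ∀ j, dbarWirt j (fun w => ((Φ (u w) : ℝ) : ℂ)) =ᶠ[𝓝 z]
      fun w => ((Φ' (u w) : ℝ) : ℂ) * dbarWirt j (fun w => (u w : ℂ)) w := fun j =>
    hue.mono fun w hw => dbarWirt_comp_real (hΦ _) (hw.differentiableAt two_ne_zero) j
  have h2 : DifferentiableAt ℝ (fun w => ((Φ' (u w) : ℝ) : ℂ)) z :=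
    (Complex.ofRealCLM.hasFDerivAt.comp z
      (hΦ'.comp_hasFDerivAt z hud.hasFDerivAt)).differentiableAt
  have h3 : ∀ j, DifferentiableAt ℝ (dbarWirt j fun w => (u w : ℂ)) z := fun j =>
    (huc.dbarWirt (m := 1) (by norm_num) j).differentiableAt one_ne_zero
  have h4 : (Matrix.of fun i j => dWirt i (dbarWirt j fun w => ((Φ (u w) : ℝ) : ℂ)) z) =
      ((Φ' (u z) : ℝ) : ℂ) • (Matrix.of fun i j => dWirt i (dbarWirt j fun w => (u w : ℂ)) z) +
      (Φ'' : ℂ) • Matrix.of fun i j =>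
        dWirt i (fun w => (u w : ℂ)) z * dbarWirt j (fun w => (u w : ℂ)) z := by
    ext i j
    simp only [Matrix.of_apply, Matrix.add_apply, Matrix.smul_apply, smul_eq_mul]
    rw [dWirt_congr (h1 j), dWirt_mul h2 (h3 j), dWirt_comp_real hΦ' hud]
    ring
  rw [localLap, h4, mul_add, Matrix.mul_smul, Matrix.mul_smul, Matrix.trace_add,
    Matrix.trace_smul, Matrix.trace_smul]
  rfl

open ComplexOrder

/-- The indices are arranged so that the form of `G⁻¹` is evaluated at the vector of the `∂u/∂zⁱ`. -/
theorem localGradSq_eq_dotProduct {u : (Fin n → ℂ) → ℝ} (hu : DifferentiableAt ℝ u z) :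
    localGradSq G (fun w => (u w : ℂ)) z = star (fun i => dWirt i (fun w => (u w : ℂ)) z) ⬝ᵥ
      (G z)⁻¹.mulVec fun i => dWirt i (fun w => (u w : ℂ)) z := by
  have huc : DifferentiableAt ℝ (fun w => (u w : ℂ)) z :=
    Complex.ofRealCLM.differentiableAt.comp z hu
  have h : ∀ j, dbarWirt j (fun w => (u w : ℂ)) z =
      starRingEnd ℂ (dWirt j (fun w => (u w : ℂ)) z) := fun j => by
    rw [conj_dWirt huc]; simp
  simp only [localGradSq, h, Matrix.trace, Matrix.diag_apply, Matrix.mul_apply, Matrix.of_apply,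
    dotProduct, Matrix.mulVec, Pi.star_apply, RCLike.star_def, Finset.mul_sum]
  refine Finset.sum_congr rfl fun i _ => Finset.sum_congr rfl fun j _ => ?_
  ring

theorem localGradSq_re_nonneg {u : (Fin n → ℂ) → ℝ} (hu : DifferentiableAt ℝ u z)
    (hG : (G z).PosDef) : 0 ≤ (localGradSq G (fun w => (u w : ℂ)) z).re := by
  rw [localGradSq_eq_dotProduct hu]
  exact (Complex.le_def.1 (hG.inv.posSemidef.dotProduct_mulVec_nonneg _)).1

theorem fderiv_eq_zero_of_localGradSq {u : (Fin n → ℂ) → ℝ} (hu : DifferentiableAt ℝ u z)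
    (hG : (G z).PosDef) (h : (localGradSq G (fun w => (u w : ℂ)) z).re = 0) :
    fderiv ℝ u z = 0 := by
  refine fderiv_eq_zero_of_dWirt_eq_zero hu ?_
  by_contra hne
  push Not at hne
  obtain ⟨i, hi⟩ := hne
  rw [localGradSq_eq_dotProduct hu] at h
  have hy : (fun i => dWirt i (fun w => (u w : ℂ)) z) ≠ 0 := fun h0 => hi (congrFun h0 i)
  exact (Complex.lt_def.1 (hG.inv.dotProduct_mulVec_pos hy)).1.ne' h

end Gradient

/-! ### Functions on the manifold and the first variation -/

section Manifold

variable {n : ℕ} {M : Type*} [TopologicalSpace M] [ChartedSpace (Fin n → ℂ) M]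

theorem ChartContDiff.of_le {m k : ℕ∞ω} {u : M → ℝ} (hu : ChartContDiff (n := n) k u)
    (h : m ≤ k) : ChartContDiff (n := n) m u := fun e he => (hu e he).of_le h

theorem ChartContDiff.mul {m : ℕ∞ω} {u v : M → ℝ} (hu : ChartContDiff (n := n) m u)
    (hv : ChartContDiff (n := n) m v) : ChartContDiff (n := n) m fun x => u x * v x :=
  fun e he => (hu e he).mul (hv e he)

theorem ChartContDiff.comp {m : ℕ∞ω} {u : M → ℝ} (hu : ChartContDiff (n := n) m u) {Φ : ℝ → ℝ}
    (hΦ : ContDiff ℝ m Φ) : ChartContDiff (n := n) m fun x => Φ (u x) :=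
  fun e he => hΦ.comp_contDiffOn (hu e he)

/-- A function on a connected manifold whose differential vanishes in every chart is constant. -/
theorem exists_eq_const_of_fderiv_eq_zero [ConnectedSpace M] {u : M → ℝ}
    (hu : ChartContDiff (n := n) 1 u) (h : ∀ e ∈ atlas (Fin n → ℂ) M, ∀ z ∈ e.target,
      fderiv ℝ (fun z => u (e.symm z)) z = 0) : ∃ c, ∀ x, u x = c := by
  have hloc : IsLocallyConstant u := by
    rw [IsLocallyConstant.iff_eventually_eq]
    intro x
    set e := chartAt (Fin n → ℂ) x with he
    have hea : e ∈ atlas (Fin n → ℂ) M := chart_mem_atlas _ x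
    have hx : x ∈ e.source := mem_chart_source _ x
    obtain ⟨r, hr, hb⟩ := Metric.isOpen_iff.1 e.open_target _ (e.map_source hx)
    have hev : ∀ᶠ y in 𝓝 x, e y ∈ Metric.ball (e x) r :=
      (e.continuousAt hx).eventually (Metric.ball_mem_nhds _ hr)
    filter_upwards [hev, e.open_source.mem_nhds hx] with y hy hys
    have h1 := (convex_ball (e x) r).is_const_of_fderivWithin_eq_zero (𝕜 := ℝ)
      (f := fun z => u (e.symm z)) (fun z hz => ((hu.contDiffAt hea (hb hz)).differentiableAt
        one_ne_zero).differentiableWithinAt) (fun z hz => by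
        rw [fderivWithin_of_isOpen Metric.isOpen_ball hz]; exact h e hea z (hb hz))
      hy (Metric.mem_ball_self hr)
    simpa [e.left_inv hys, e.left_inv hx] using h1
  exact ⟨u (Classical.arbitrary M), fun x => hloc.apply_eq_of_preconnectedSpace _ _⟩

theorem localLap_sum {ι : Type*} {s : Finset ι} {G : (Fin n → ℂ) → Matrix (Fin n) (Fin n) ℂ}
    {z : Fin n → ℂ} {u : ι → (Fin n → ℂ) → ℂ} (hu : ∀ a ∈ s, ContDiffAt ℝ 2 (u a) z) :
    localLap G (fun w => ∑ a ∈ s, u a w) z = ∑ a ∈ s, localLap G (u a) z := by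
  have h1 : ∀ᶠ w in 𝓝 z, ∀ a ∈ s, ContDiffAt ℝ 2 (u a) w :=
    (Filter.eventually_all_finset s).2 fun a ha => (hu a ha).eventually (by norm_num)
  have h2 : (Matrix.of fun i j => dWirt i (dbarWirt j fun w => ∑ a ∈ s, u a w) z) =
      ∑ a ∈ s, Matrix.of fun i j => dWirt i (dbarWirt j (u a)) z := by
    ext i j
    rw [Matrix.sum_apply]
    simp only [Matrix.of_apply]
    have h3 : (dbarWirt j fun w => ∑ a ∈ s, u a w) =ᶠ[𝓝 z]
        fun w => ∑ a ∈ s, dbarWirt j (u a) w := by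
      filter_upwards [h1] with w hw
      exact dbarWirt_sum s (fun a ha => (hw a ha).differentiableAt two_ne_zero) j
    rw [dWirt_congr h3, dWirt_sum s fun a ha =>
      ((hu a ha).dbarWirt (m := 1) (by norm_num) j).differentiableAt one_ne_zero]
  rw [localLap, h2, Finset.mul_sum, Matrix.trace_sum]
  rfl

namespace HermitianMetric

variable (g : HermitianMetric n M)

theorem lap_sum {ι : Type*} {s : Finset ι} {u : ι → M → ℝ}
    (hu : ∀ a ∈ s, ChartContDiff (n := n) 2 (u a)) (x : M) :
    g.lap (fun x => ∑ a ∈ s, u a x) x = ∑ a ∈ s, g.lap (u a) x := by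
  rw [lap]
  simp only [Complex.ofReal_sum]
  rw [localLap_sum fun a ha => (hu a ha).contDiffAt_ofReal (chart_mem_atlas _ x)
    (mem_chart_target _ x), Complex.re_sum]
  rfl

theorem lap_const_mul (t : ℝ) {u : M → ℝ} (hu : ChartContDiff (n := n) 2 u) (x : M) :
    g.lap (fun x => t * u x) x = t * g.lap u x := by
  have h := localLap_comp_real (G := g.coeff (chartAt (Fin n → ℂ) x)) (Φ := fun y => t * y)
    (Φ' := fun _ => t) (Φ'' := 0) (hu.contDiffAt (chart_mem_atlas _ x) (mem_chart_target _ x))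
    (fun y => by simpa using (hasDerivAt_id y).const_mul t) (hasDerivAt_const _ _)
  rw [lap, h, Complex.ofReal_zero, zero_mul, add_zero, Complex.re_ofReal_mul, lap]

variable [IsManifold 𝓘(ℂ, Fin n → ℂ) ω M] [CompactSpace M] [MeasurableSpace M] [BorelSpace M]

theorem integrable_of_continuous {F : M → ℝ} (hF : Continuous F) :
    Integrable F g.volumeMeasure :=
  hF.integrable_of_hasCompactSupport (HasCompactSupport.of_compactSpace F)

/-- The Calabi functional with `p = n` along a conformal deformation: the volume factor is trivial
and `C_n(e^{tf} ω) = ∫ |s - n t Δf|^n dV`. -/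
theorem calabi_conformal_smul (hn : 2 ≤ n) (f : C^∞⟮𝓘(ℝ, Fin n → ℂ), M; ℝ⟯) (t : ℝ) :
    (g.conformal (t • f)).calabi n =
      ∫ x, |g.chernScalar x - t * (n * g.lap f x)| ^ n ∂g.volumeMeasure := by
  have hn0 : (n : ℝ) ≠ 0 := by positivity
  have hfm : Measurable fun x => ENNReal.ofReal (Real.exp (n * (t • f) x)) := by
    have : Continuous (t • f) := (t • f).contMDiff.continuous
    fun_prop
  rw [calabi, sub_self, zero_div, neg_zero, Real.rpow_zero, mul_one, volumeMeasure_conformal,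
    integral_withDensity_eq_integral_toReal_smul hfm (ae_of_all _ fun _ => ENNReal.ofReal_lt_top)]
  refine integral_congr_ae (ae_of_all _ fun x => ?_)
  have h1 : g.lap (t • f : C^∞⟮𝓘(ℝ, Fin n → ℂ), M; ℝ⟯) x = t * g.lap f x :=
    g.lap_const_mul t ((chartContDiff_smooth f).of_le two_le_infty) x
  simp only [smul_eq_mul]
  rw [ENNReal.toReal_ofReal (Real.exp_pos _).le, Real.rpow_natCast, chernScalar_conformal, h1,
    abs_mul, mul_pow, abs_of_pos (Real.exp_pos _), ← Real.exp_nat_mul, ← mul_assoc, ← Real.exp_add]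
  rw [show (n : ℝ) * (t • f) x + n * -(t • f) x = 0 by ring, Real.exp_zero, one_mul]
  congr 2
  ring

/-- The Euler-Lagrange equation of an `n`-conformal extremal metric, in weak form. -/
theorem IsConformalExtremal.integral_eq_zero {m : ℕ} (hm : n = m + 2)
    (hext : g.IsConformalExtremal (n : ℝ)) (f : C^∞⟮𝓘(ℝ, Fin n → ℂ), M; ℝ⟯) :
    ∫ x, |g.chernScalar x| ^ m * g.chernScalar x * g.lap f x ∂g.volumeMeasure = 0 := by
  have hs : Continuous g.chernScalar := g.chartContDiff_chernScalar.continuous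
  have hL : Continuous (g.lap f) :=
    g.continuous_lap ((chartContDiff_smooth f).of_le two_le_infty)
  have hn : 2 ≤ n := by omega
  have hn0 : (n : ℝ) ≠ 0 := by positivity
  set s := g.chernScalar
  set L := g.lap f
  have h := hext f
  simp only [calabi_conformal_smul g hn f] at h
  have hder := hasDerivAt_integral_of_dominated_loc_of_deriv_le (μ := g.volumeMeasure) (𝕜 := ℝ)
    (s := Metric.ball 0 1) (x₀ := (0 : ℝ)) (F := fun t x => |s x - t * (n * L x)| ^ n)
    (F' := fun t x => n * (|s x - t * (n * L x)| ^ m * (s x - t * (n * L x))) * -(n * L x))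
    (bound := fun x => n * (|s x| + |n * L x|) ^ (m + 1) * |n * L x|)
    (Metric.ball_mem_nhds _ one_pos)
    (Eventually.of_forall fun t => (by fun_prop : Continuous fun x =>
      |s x - t * (n * L x)| ^ n).aestronglyMeasurable)
    (g.integrable_of_continuous (by fun_prop))
    (by fun_prop : Continuous fun x => n * (|s x - 0 * (n * L x)| ^ m *
      (s x - 0 * (n * L x))) * -(n * L x)).aestronglyMeasurable
    (ae_of_all _ fun x t ht => by
      have ht1 : |t| ≤ 1 := by
        have := Metric.mem_ball.1 ht
        rw [Real.dist_0_eq_abs] at this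
        exact this.le
      have h1 : |s x - t * (n * L x)| ≤ |s x| + |n * L x| := by
        refine (abs_sub _ _).trans ?_
        rw [abs_mul t]
        exact add_le_add le_rfl (mul_le_of_le_one_left (abs_nonneg _) ht1)
      rw [Real.norm_eq_abs, abs_mul, abs_neg, abs_mul, abs_mul, abs_pow, abs_abs, ← pow_succ,
        Nat.abs_cast]
      gcongr)
    (g.integrable_of_continuous (by fun_prop))
    (ae_of_all _ fun x t _ => by
      have h1 : HasDerivAt (fun t : ℝ => s x - t * (n * L x)) (-(n * L x)) t := by
        simpa using ((hasDerivAt_id t).mul_const (n * L x)).const_sub (s x)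
      have h2 := (hasDerivAt_abs_pow_add_two m (s x - t * (n * L x))).comp t h1
      have h3 : (n : ℝ) = m + 2 := by rw [hm]; push_cast; ring
      rw [← hm, ← h3] at h2
      exact h2)
  have h0 := hder.2.unique h
  have h1 : ∀ x, n * (|s x - 0 * (n * L x)| ^ m * (s x - 0 * (n * L x))) * -(n * L x) =
      -((n : ℝ) * n) * (|s x| ^ m * s x * L x) := fun x => by
    rw [zero_mul, sub_zero]; ring
  simp only [h1] at h0
  rw [integral_const_mul] at h0
  exact (mul_eq_zero.1 h0).resolve_left (neg_ne_zero.2 (mul_ne_zero hn0 hn0))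

variable [T2Space M]

/-- The Laplacian of a Gauduchon metric has integral zero: the metric condition says that constants
are annihilated by the adjoint of the Laplacian. -/
theorem integral_lap_eq_zero (h : ∀ e ∈ atlas (Fin n → ℂ) M, ∀ z ∈ e.target,
    gauduchonCoeff (g.coeff e) z = 0) {u : M → ℝ} (hu : ChartContDiff (n := n) 2 u) :
    ∫ x, g.lap u x ∂g.volumeMeasure = 0 := by
  have : IsManifold 𝓘(ℝ, Fin n → ℂ) ∞ M := isManifold_real
  obtain ⟨t, ht⟩ := isCompact_univ.elim_nhds_subcover
    (fun x : M => (chartAt (Fin n → ℂ) x).source)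
    (fun x _ => (chartAt (Fin n → ℂ) x).open_source.mem_nhds (mem_chart_source _ x))
  obtain ⟨ρ, hρ⟩ := SmoothPartitionOfUnity.exists_isSubordinate 𝓘(ℝ, Fin n → ℂ)
    (isClosed_univ (X := M)) (fun x : t => (chartAt (Fin n → ℂ) (x : M)).source)
    (fun x => (chartAt (Fin n → ℂ) (x : M)).open_source)
    (by rw [Set.iUnion_subtype]; exact ht.2)
  have hw : ∀ a : t, ChartContDiff (n := n) 2 fun x => ρ a x * u x := fun a =>
    ((chartContDiff_smooth (ρ a)).of_le two_le_infty).mul hu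
  have hsum : u = fun x => ∑ a : t, ρ a x * u x := by
    funext x
    rw [← Finset.sum_mul, ← finsum_eq_sum_of_fintype, ρ.sum_eq_one (Set.mem_univ x), one_mul]
  have h1 : ∀ x, g.lap u x = ∑ a : t, g.lap (fun x => ρ a x * u x) x := fun x => by
    conv_lhs => rw [hsum]
    exact g.lap_sum (fun a _ => hw a) x
  simp only [h1]
  rw [integral_finsetSum _ fun a _ => g.integrable_of_continuous (g.continuous_lap (hw a))]
  refine Finset.sum_eq_zero fun a _ => ?_
  have hea := chart_mem_atlas (Fin n → ℂ) (a : M)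
  rw [g.integral_lap_of_tsupport_subset (hw a) hea
    ((tsupport_mul_subset_left (f := ρ a) (g := u)).trans (hρ a)), mul_eq_zero]
  right
  refine (integral_congr_ae (ae_of_all _ fun z => ?_)).trans (integral_zero _ _)
  by_cases hz : z ∈ (chartAt (Fin n → ℂ) (a : M)).target
  · simp [h _ hea z hz]
  · simp [Set.indicator_of_notMem hz]

/-- Conversely, if all Laplacians have integral zero, then `∂∂̄ ω^{n-1} = 0`. -/
theorem gauduchonCoeff_eq_zero (h : ∀ u : M → ℝ, ChartContDiff (n := n) ∞ u →
    ∫ x, g.lap u x ∂g.volumeMeasure = 0) {e : OpenPartialHomeomorph M (Fin n → ℂ)}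
    (he : e ∈ atlas (Fin n → ℂ) M) {z : Fin n → ℂ} (hz : z ∈ e.target) :
    gauduchonCoeff (g.coeff e) z = 0 := by
  have hcont : ContinuousOn (fun z => (gauduchonCoeff (g.coeff e) z).re) e.target := fun z hz =>
    (Complex.continuous_re.continuousAt.comp (contDiffAt_gauduchonCoeff
      (g.contDiffAt_coeff he hz)).continuousAt).continuousWithinAt
  have him : (gauduchonCoeff (g.coeff e) z).im = 0 :=
    gauduchonCoeff_im (fun k l => (g.contDiffAt_coeff he hz k l).of_le two_le_infty) (by
      exact Eventually.of_forall fun w => g.isHermitian_coeff e w)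
  have hae : ∀ᵐ z ∂(volume : Measure (Fin n → ℂ)), z ∈ e.target →
      (gauduchonCoeff (g.coeff e) z).re = 0 := by
    refine e.open_target.ae_eq_zero_of_integral_contDiff_smul_eq_zero
      (hcont.locallyIntegrableOn e.open_target.measurableSet) fun φ hφ hφc hφs => ?_
    -- transport the test function to `M`
    set w : M → ℝ := e.source.indicator fun x => φ (e x) with hw
    have hK : IsCompact (e.symm '' tsupport φ) :=
      hφc.isCompact.image_of_continuousOn (e.continuousOn_symm.mono hφs)
    have hKs : e.symm '' tsupport φ ⊆ e.source := by
      rintro _ ⟨y, hy, rfl⟩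
      exact e.map_target (hφs hy)
    have hsup : Function.support w ⊆ e.symm '' tsupport φ := by
      intro x hx
      have hxs : x ∈ e.source := Set.mem_of_indicator_ne_zero hx
      rw [Function.mem_support, hw, Set.indicator_of_mem hxs] at hx
      exact ⟨e x, subset_tsupport _ hx, e.left_inv hxs⟩
    have hts : tsupport w ⊆ e.symm '' tsupport φ := closure_minimal hsup hK.isClosed
    have hwc : ChartContDiff (n := n) ∞ w := by
      intro e' he' y hy
      refine ContDiffAt.contDiffWithinAt ?_
      by_cases hys : e'.symm y ∈ e.source
      · have hy' := mem_transition_source hy hys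
        have h1 : ContDiffAt ℝ ∞ (fun y => e (e'.symm y)) y :=
          (((contDiffOn_transition he' he).contDiffAt ((e'.symm ≫ₕ e).open_source.mem_nhds
            hy')).restrict_scalars ℝ).of_le (by exact le_top)
        refine (hφ.contDiffAt.comp y h1).congr_of_eventuallyEq ?_
        filter_upwards [(e'.symm ≫ₕ e).open_source.mem_nhds hy'] with v hv
        rw [OpenPartialHomeomorph.trans_source] at hv
        exact Set.indicator_of_mem (show e'.symm v ∈ e.source from hv.2) _
      · refine (contDiffAt_const (c := (0 : ℝ))).congr_of_eventuallyEq ?_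
        have h2 : w =ᶠ[𝓝 (e'.symm y)] 0 :=
          notMem_tsupport_iff_eventuallyEq.1 fun h3 => hys (hKs (hts h3))
        exact (e'.continuousAt_symm hy).eventually h2
    have hφw : e.target.indicator (fun z => w (e.symm z)) = φ := by
      funext y
      by_cases hy : y ∈ e.target
      · rw [Set.indicator_of_mem hy, hw, Set.indicator_of_mem (e.map_target hy), e.right_inv hy]
      · rw [Set.indicator_of_notMem hy]
        exact (image_eq_zero_of_notMem_tsupport fun h3 => hy (hφs h3)).symm
    have h4 := h w hwc
    rw [g.integral_lap_of_tsupport_subset (hwc.of_le two_le_infty) he (hts.trans hKs), hφw] at h4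
    have h5 := (mul_eq_zero.1 h4).resolve_left (by positivity)
    simpa only [smul_eq_mul, mul_comm] using h5
  have h6 := Measure.eqOn_open_of_ae_eq (μ := (volume : Measure (Fin n → ℂ)))
    ((ae_restrict_iff' e.open_target.measurableSet).2 hae) e.open_target hcont continuousOn_const
  exact Complex.ext (h6 hz) him

end HermitianMetric

end Manifold

/-! ### Extremal Gauduchon metrics -/

/-- For odd `m` the function is not smooth at the origin, but it is of class `C²`. -/
theorem contDiff_abs_pow_add_two (m : ℕ) : ContDiff ℝ 2 fun x : ℝ => |x| ^ (m + 2) := by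
  have h1 : deriv (fun x : ℝ => |x| ^ (m + 2)) = fun x : ℝ => ((m : ℝ) + 2) * (|x| ^ m * x) :=
    funext fun x => (hasDerivAt_abs_pow_add_two m x).deriv
  have h2 : deriv (fun x : ℝ => ((m : ℝ) + 2) * (|x| ^ m * x)) =
      fun x : ℝ => ((m : ℝ) + 2) * ((m + 1) * |x| ^ m) :=
    funext fun x => ((hasDerivAt_abs_pow_mul m x).const_mul _).deriv
  rw [show (2 : ℕ∞ω) = 1 + 1 by norm_num, contDiff_succ_iff_deriv, h1]
  refine ⟨fun x => (hasDerivAt_abs_pow_add_two m x).differentiableAt, by simp, ?_⟩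
  rw [contDiff_one_iff_deriv, h2]
  exact ⟨fun x => ((hasDerivAt_abs_pow_mul m x).const_mul _).differentiableAt, by fun_prop⟩

section Manifold

variable {n : ℕ} {M : Type*} [TopologicalSpace M] [ChartedSpace (Fin n → ℂ) M]
  [IsManifold 𝓘(ℂ, Fin n → ℂ) ω M]

namespace HermitianMetric

variable (g : HermitianMetric n M)

/-- The part of `Δ|u|^{m+2}` quadratic in the differential of `u`, computed in a chart. -/
theorem lap_abs_pow_symm (m : ℕ) {u : M → ℝ} (hu : ChartContDiff (n := n) 2 u)
    {e : OpenPartialHomeomorph M (Fin n → ℂ)} (he : e ∈ atlas (Fin n → ℂ) M) {z : Fin n → ℂ}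
    (hz : z ∈ e.target) :
    g.lap (fun x => |u x| ^ (m + 2)) (e.symm z) -
      (m + 2) * (|u (e.symm z)| ^ m * u (e.symm z) * g.lap u (e.symm z)) =
    (m + 2) * ((m + 1) * |u (e.symm z)| ^ m) *
      (localGradSq (g.coeff e) (fun w => (u (e.symm w) : ℂ)) z).re := by
  rw [g.lap_symm (hu.comp (contDiff_abs_pow_add_two m)) he hz, g.lap_symm hu he hz,
    localLap_comp_real (u := fun w => u (e.symm w)) (hu.contDiffAt he hz)
      (fun x => hasDerivAt_abs_pow_add_two m x) ((hasDerivAt_abs_pow_mul m _).const_mul _),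
    Complex.add_re, Complex.re_ofReal_mul, Complex.re_ofReal_mul]
  ring

variable [T2Space M] [CompactSpace M] [MeasurableSpace M] [BorelSpace M]

/-- For a Gauduchon metric, a function `u` with `∫ |u|^m u Δu = 0` is constant: since also
`∫ Δ|u|^{m+2} = 0`, the integral of `|u|^m |∂u|²` vanishes. -/
theorem exists_eq_const_of_integral_eq_zero [ConnectedSpace M] (m : ℕ)
    (h : ∀ e ∈ atlas (Fin n → ℂ) M, ∀ z ∈ e.target, gauduchonCoeff (g.coeff e) z = 0)
    {u : M → ℝ} (hu : ChartContDiff (n := n) 2 u)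
    (h0 : ∫ x, |u x| ^ m * u x * g.lap u x ∂g.volumeMeasure = 0) : ∃ c, ∀ x, u x = c := by
  have hu2 := hu.comp (contDiff_abs_pow_add_two m)
  have huc := hu.continuous
  have hL := g.continuous_lap hu
  have hL2 := g.continuous_lap hu2
  set Q : M → ℝ := fun x => g.lap (fun x => |u x| ^ (m + 2)) x -
    (m + 2) * (|u x| ^ m * u x * g.lap u x) with hQ
  have hQc : Continuous Q := by fun_prop
  have hQ0 : ∀ x, 0 ≤ Q x := by
    intro x
    have he := chart_mem_atlas (Fin n → ℂ) x
    have hz := mem_chart_target (Fin n → ℂ) x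
    have h1 := g.lap_abs_pow_symm m hu he hz
    rw [(chartAt (Fin n → ℂ) x).left_inv (mem_chart_source _ x)] at h1
    rw [hQ]
    simp only
    rw [h1]
    exact mul_nonneg (by positivity) (localGradSq_re_nonneg
      ((hu.contDiffAt he hz).differentiableAt two_ne_zero) (g.posDef_coeff he hz))
  have hQi : ∫ x, Q x ∂g.volumeMeasure = 0 := by
    rw [hQ, integral_sub (g.integrable_of_continuous hL2)
      (g.integrable_of_continuous (by fun_prop)), integral_const_mul, h0, mul_zero, sub_zero]
    exact g.integral_lap_eq_zero h hu2
  have hQz : Q = 0 := by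
    have h1 := (integral_eq_zero_iff_of_nonneg hQ0 (g.integrable_of_continuous hQc)).1 hQi
    exact (hQc.ae_eq_iff_eq g.volumeMeasure continuous_zero).1 h1
  -- wherever `u ≠ 0` the differential of `u` vanishes, hence that of `u ^ 3` vanishes everywhere
  obtain ⟨c, hc⟩ := exists_eq_const_of_fderiv_eq_zero (n := n) (u := fun x => u x ^ 3)
    ((hu.of_le (by norm_num)).comp (contDiff_id.pow 3)) fun e he z hz => by
      have hd := (hu.contDiffAt he hz).differentiableAt two_ne_zero
      rw [fderiv_fun_pow 3 hd]
      by_cases hz0 : u (e.symm z) = 0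
      · simp [hz0]
      · have h1 := g.lap_abs_pow_symm m hu he hz
        have h2 : Q (e.symm z) = 0 := congrFun hQz _
        rw [hQ] at h2
        have h3 := (mul_eq_zero.1 (h1.symm.trans h2)).resolve_left (by positivity)
        rw [fderiv_eq_zero_of_localGradSq hd (g.posDef_coeff he hz) h3, smul_zero]
  have hinj : Function.Injective fun x : ℝ => x ^ 3 :=
    (Odd.strictMono_pow (by decide)).injective
  exact ⟨u (Classical.arbitrary M), fun x => hinj ((hc x).trans (hc _).symm)⟩

end HermitianMetric

end Manifold

end ConformalExtremal

end

theorem theorem3 {n : ℕ} (hn : 2 ≤ n) {M : Type*} [TopologicalSpace M] [T2Space M]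
    [CompactSpace M] [ConnectedSpace M] [MeasurableSpace M] [BorelSpace M]
    [ChartedSpace (Fin n → ℂ) M] [IsManifold 𝓘(ℂ, Fin n → ℂ) ω M]
    (g gE : ConformalExtremal.HermitianMetric n M)
    (hconf : ∃ f : C^∞⟮𝓘(ℝ, Fin n → ℂ), M; ℝ⟯, gE = g.conformal f)
    (hext : gE.IsConformalExtremal (n : ℝ)) :
    (gE.IsGauduchon → ∃ c : ℝ, ∀ x, gE.chernScalar x = c) ∧
    ((∃ c : ℝ, c ≠ 0 ∧ ∀ x, gE.chernScalar x = c) → gE.IsGauduchon) := by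
  obtain ⟨m, hm⟩ : ∃ m, n = m + 2 := ⟨n - 2, by omega⟩
  rw [gE.isGauduchon_iff (by omega)]
  constructor
  · intro h
    have hs := gE.chartContDiff_chernScalar
    exact gE.exists_eq_const_of_integral_eq_zero m h
      (hs.of_le ConformalExtremal.two_le_infty)
      (hext.integral_eq_zero gE hm ⟨gE.chernScalar, hs.contMDiff⟩)
  · rintro ⟨c, hc0, hc⟩ e he z hz
    refine gE.gauduchonCoeff_eq_zero (fun u hu => ?_) he hz
    have h1 := hext.integral_eq_zero gE hm ⟨u, hu.contMDiff⟩
    simp only [hc] at h1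
    rw [integral_const_mul] at h1
    exact (mul_eq_zero.1 h1).resolve_left (mul_ne_zero (pow_ne_zero _ (abs_ne_zero.2 hc0)) hc0)
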